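/- Let $d\in\mathbb N$ and let $\mathbf C,\mathbf K,\mathbf D\in\mathbb R^{d\times d}$, where $\mathbf D$ is symmetric positive semi-definite. Assume that $\{0\}$ is the only $(\mathbf C+\mathbf K)^T$-invariant subspace of $\mathbb R^d$ contained in $\ker\mathbf D$. Let $p\in(1,\infty]$ and let $\rho_0\in L^1(\mathbb R^d)\cap L^p(\mathbb R^d)$ be non-negative with $\int_{\mathbb R^d}\rho_0(x)\,dx=1$ and finite first moment $\int_{\mathbb R^d}|x|\rho_0(x)\,dx<\infty$. Put $$\bm m_1=\int_{\mathbb R^d}x\rho_0(x)\,dx,\qquad s(t)=\big(e^{-\mathbf Ct}-e^{-(\mathbf C+\mathbf K)t}\big)\bm m_1 .$$ Consider functions $u:\mathbb R^d\times[0,\infty)\to\mathbb R$ that are $C^\infty$ on $\mathbb R^d\times(0,\infty)$ and such that $t\mapsto u(\cdot,t)$ is a continuous map from $[0,\infty)$ to $L^1(\mathbb R^d)$; call these smooth. Then: (1) there is exactly one smooth $f$ that satisfies the Fokker–Planck equation $$\partial_t f(x,t)=\operatorname{div}\big[(\mathbf C+\mathbf K)x\,f(x,t)+\mathbf D\nabla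 f(x,t)\big],\quad x\in\mathbb R^d,\ t\in(0,\infty),\qquad f(x,0)=\rho_0(x);$$ (2) the function $\rho(x,t)=f(x-s(t),t)$ is smooth, has unit mass $\int_{\mathbb R^d}\rho(x,t)\,dx=1$ and finite first moment $\int_{\mathbb R^d}|x||\rho(x,t)|\,dx<\infty$ for every $t\ge0$, and satisfies the McKean–Vlasov equation $$\partial_t\rho(x,t)=\operatorname{div}\Big[\mathbf Cx\,\rho(x,t)+\Big(\int_{\mathbb R^d}\mathbf K(x-y)\rho(y,t)\,dy\Big)\rho(x,t)+\mathbf D\nabla\rho(x,t)\Big],\quad x\in\mathbb R^d,\ t\in(0,\infty),\qquad \rho(x,0)=\rho_0(x).$$ -/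

import Mathlib

open MeasureTheory Filter Topology Set
open scoped ContDiff ENNReal

/-- The divergence `∑ i, ∂ᵢ Fᵢ` of a vector field on `ℝᵈ`. -/
noncomputable def euclideanDiv {d : ℕ}
    (F : EuclideanSpace ℝ (Fin d) → EuclideanSpace ℝ (Fin d))
    (x : EuclideanSpace ℝ (Fin d)) : ℝ :=
  ∑ i, (fderiv ℝ F x (EuclideanSpace.single i 1)) i

/-- There is no nonzero `Aᵀ`-invariant subspace contained in `ker B`. -/
def NoInvariantSubspaceInKer {d : ℕ} (A B : Matrix (Fin d) (Fin d) ℝ) : Prop :=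
  ∀ V : Submodule ℝ (EuclideanSpace ℝ (Fin d)),
    V ≤ LinearMap.ker (Matrix.toEuclideanLin B) →
    (∀ v ∈ V, Matrix.toEuclideanLin A.transpose v ∈ V) → V = ⊥

/-- `f t x`, for `t ∈ [0, ∞)` and `x ∈ ℝᵈ`, starts at `ρ₀`, is a continuous curve
`[0, ∞) → L¹(ℝᵈ)`, and is jointly smooth on `(0, ∞) × ℝᵈ`.
(Values at negative times are irrelevant.) -/
structure IsSmoothL1Curve {d : ℕ} (ρ₀ : EuclideanSpace ℝ (Fin d) → ℝ)
    (f : ℝ → EuclideanSpace ℝ (Fin d) → ℝ) : Prop where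
  initial : ∀ x, f 0 x = ρ₀ x
  integrable : ∀ t, 0 ≤ t → Integrable (f t) volume
  continuous_L1 : ∀ t₀, 0 ≤ t₀ →
    Tendsto (fun t => ∫ x, |f t x - f t₀ x|) (𝓝[Ici 0] t₀) (𝓝 0)
  smooth : ContDiffOn ℝ ∞ (fun q : ℝ × EuclideanSpace ℝ (Fin d) => f q.1 q.2)
    (Ioi (0 : ℝ) ×ˢ (univ : Set (EuclideanSpace ℝ (Fin d))))

/-- `f` is a smooth solution on `(0, ∞) × ℝᵈ` of the Fokker–Planck equation
`∂ₜ f = div (A x f + B ∇f)` with `f(·, 0) = ρ₀`. -/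
structure IsFokkerPlanckSolution {d : ℕ} (A B : Matrix (Fin d) (Fin d) ℝ)
    (ρ₀ : EuclideanSpace ℝ (Fin d) → ℝ)
    (f : ℝ → EuclideanSpace ℝ (Fin d) → ℝ) : Prop extends IsSmoothL1Curve ρ₀ f where
  equation : ∀ t, 0 < t → ∀ x : EuclideanSpace ℝ (Fin d),
    HasDerivAt (fun τ => f τ x)
      (euclideanDiv (fun z => f t z • Matrix.toEuclideanLin A z
        + Matrix.toEuclideanLin B (gradient (f t) z)) x) t

/-- `ρ` is a smooth solution on `(0, ∞) × ℝᵈ`, with finite first moments, of the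
McKean–Vlasov equation `∂ₜ ρ = div (C x ρ + (∫ K (x - y) ρ(y, t) dy) ρ + D ∇ρ)`
with `ρ(·, 0) = ρ₀`. -/
structure IsMcKeanVlasovSolution {d : ℕ} (C K D : Matrix (Fin d) (Fin d) ℝ)
    (ρ₀ : EuclideanSpace ℝ (Fin d) → ℝ)
    (ρ : ℝ → EuclideanSpace ℝ (Fin d) → ℝ) : Prop extends IsSmoothL1Curve ρ₀ ρ where
  first_moment : ∀ t, 0 ≤ t → Integrable (fun x => ρ t x • x) volume
  equation : ∀ t, 0 < t → ∀ x : EuclideanSpace ℝ (Fin d),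
    HasDerivAt (fun τ => ρ τ x)
      (euclideanDiv (fun z => ρ t z • Matrix.toEuclideanLin C z
        + ρ t z • (∫ y, ρ t y • Matrix.toEuclideanLin K (z - y))
        + Matrix.toEuclideanLin D (gradient (ρ t) z)) x) t

/-- The shift `s(t) = (e^{-Ct} - e^{-(C+K)t}) m₁`, where `m₁ = ∫ x ρ₀(x) dx`. -/
noncomputable def mkShift {d : ℕ} (C K : Matrix (Fin d) (Fin d) ℝ)
    (ρ₀ : EuclideanSpace ℝ (Fin d) → ℝ) (t : ℝ) : EuclideanSpace ℝ (Fin d) :=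
  Matrix.toEuclideanLin (NormedSpace.exp (-(t • C)) - NormedSpace.exp (-(t • (C + K))))
    (∫ x, ρ₀ x • x)

/-! Write A = C + K and S_t = 2∫₀ᵗ e^{sA} D e^{sA*} ds. The invariance condition on ker D is
Kalman's rank condition in disguise: it makes S_t positive definite for every t > 0 (`gramian_pos`),
even where D itself is degenerate. Hence the Fokker–Planck equation has the Gaussian kernel N_t⁻¹
exp(-⟪z, S_t⁻¹ z⟫/2) with z = e^{tA}x - y, and the solution is the integral of this kernel against
ρ₀.

Smoothness: the exponent is affine in finitely many coefficients (a, w, M), themselves smooth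
functions of (t, x), and an integral of exp(a + ⟪w, y⟫ - ⟪y, M y⟫/2) is smooth in (a, w, M) wherever
M is coercive (`contDiffOn_gaussIntegral`). The equation is then an identity between integrands
(`fokkerPlanck_fpEvolve`). The derivative of log N_t comes from Gaussian integration by parts and a
Riccati equation, so no determinant formula for N_t is needed. As a function of x the kernel is a
probability density with mean e^{-tA}y; Fubini gives conservation of mass, and e^{-tA}m₁ as first
moment. L¹-continuity follows from pointwise convergence and conserved mass by Scheffé's lemma; at t
= 0 one also approximates ρ₀ by continuous compactly supported functions and uses that the evolution
contracts L¹.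

Uniqueness is by duality. The waves exp(∫₀ᵗ⟪ξ(s), Dξ(s)⟫ds) cos(⟪ξ(t), x⟫ + a), with ξ(t) =
e^{tA*}ξ, are bounded on compact time intervals and solve the backward equation. Pairing any
solution with such a wave gives a constant in time (`integral_mul_dualWave_eq`): the error caused by
a radial cutoff is bounded and lives far out, where an L¹-continuous curve has uniformly small mass.
Thus two solutions with equal initial data have equal Fourier transforms.

For McKean–Vlasov, unit mass turns the nonlocal term into Kx - K·(mean of ρ). Once the mean is known
to be e^{-Ct}m₁ the equation is linear with a constant extra drift at each time, and the translation
by s(t) removes exactly that drift (`mckeanVlasov_of_fokkerPlanck`). -/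

set_option linter.unusedSectionVars false

/-! ### Smooth dependence of Gaussian integrals on their coefficients. -/

section GaussianIntegrals

theorem norm_exp_smul {V : Type*} [SeminormedAddCommGroup V] [NormedSpace ℝ V] (a : ℝ) (g : V) :
    ‖Real.exp a • g‖ = Real.exp a * ‖g‖ := by
  rw [norm_smul, Real.norm_eq_abs, Real.abs_exp]

theorem norm_exp_smul_clm {V G : Type*} [NormedAddCommGroup V] [NormedSpace ℝ V]
    [NormedAddCommGroup G] [NormedSpace ℝ G] (a : ℝ) (f : V →L[ℝ] G) :
    ‖Real.exp a • f‖ = Real.exp a * ‖f‖ := by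
  rw [norm_smul, Real.norm_eq_abs, Real.abs_exp]

theorem hasFDerivAt_exp_clm_smul {V G : Type*} [NormedAddCommGroup V] [NormedSpace ℝ V]
    [NormedAddCommGroup G] [NormedSpace ℝ G] (L : V →L[ℝ] ℝ) (g : G) (v : V) :
    HasFDerivAt (fun v => Real.exp (L v) • g) (Real.exp (L v) • L.smulRight g) v := by
  convert (L.hasFDerivAt (x := v)).exp.smul_const g using 1
  ext u
  simp [mul_smul]

theorem aestronglyMeasurable_smulRight {X V G : Type*} [MeasurableSpace X] {μ : Measure X}
    [NormedAddCommGroup V] [NormedSpace ℝ V] [NormedAddCommGroup G] [NormedSpace ℝ G]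
    {L : X → V →L[ℝ] ℝ} {g : X → G} (hL : AEStronglyMeasurable L μ)
    (hg : AEStronglyMeasurable g μ) : AEStronglyMeasurable (fun x => (L x).smulRight (g x)) μ := by
  have h : Continuous fun p : (V →L[ℝ] ℝ) × G => p.1.smulRight p.2 :=
    (ContinuousLinearMap.smulRightL ℝ V G).continuous₂
  exact h.comp_aestronglyMeasurable (hL.prodMk hg)

variable {E : Type*} [NormedAddCommGroup E] [InnerProductSpace ℝ E]

/-- The coefficients `(a, w, M)` of the exponents `a + ⟪w, y⟫ - ⟪y, M y⟫ / 2`. -/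
def GaussParam (E : Type*) [NormedAddCommGroup E] [InnerProductSpace ℝ E] : Type _ :=
  ℝ × E × (E →L[ℝ] E)

noncomputable instance : NormedAddCommGroup (GaussParam E) :=
  inferInstanceAs (NormedAddCommGroup (ℝ × E × (E →L[ℝ] E)))

noncomputable instance : NormedSpace ℝ (GaussParam E) :=
  inferInstanceAs (NormedSpace ℝ (ℝ × E × (E →L[ℝ] E)))

/-- The functional `(a, w, M) ↦ a + ⟪w, y⟫ - ⟪y, M y⟫ / 2` on `ℝ × E × (E →L[ℝ] E)`. -/
noncomputable def gaussExponentAux (y : E) : (ℝ × E × (E →L[ℝ] E)) →L[ℝ] ℝ :=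
  ContinuousLinearMap.fst ℝ ℝ (E × (E →L[ℝ] E)) +
    (innerSL ℝ y).comp ((ContinuousLinearMap.fst ℝ E (E →L[ℝ] E)).comp
      (ContinuousLinearMap.snd ℝ ℝ (E × (E →L[ℝ] E)))) -
    (1 / 2 : ℝ) • ((innerSL ℝ y).comp (((ContinuousLinearMap.apply ℝ E) y).comp
      ((ContinuousLinearMap.snd ℝ E (E →L[ℝ] E)).comp
        (ContinuousLinearMap.snd ℝ ℝ (E × (E →L[ℝ] E))))))

theorem continuous_gaussExponentAux : Continuous (gaussExponentAux : E → _) := by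
  unfold gaussExponentAux
  fun_prop

/-- The functional `(a, w, M) ↦ a + ⟪w, y⟫ - ⟪y, M y⟫ / 2`. -/
noncomputable def gaussExponent (y : E) : GaussParam E →L[ℝ] ℝ := gaussExponentAux y

theorem continuous_gaussExponent : Continuous (gaussExponent : E → _) :=
  continuous_gaussExponentAux

theorem GaussParam.norm_le (v : GaussParam E) : ‖v.1‖ ≤ ‖v‖ ∧ ‖v.2.1‖ ≤ ‖v‖ ∧ ‖v.2.2‖ ≤ ‖v‖ := by
  have h (v : ℝ × E × (E →L[ℝ] E)) : ‖v.1‖ ≤ ‖v‖ ∧ ‖v.2.1‖ ≤ ‖v‖ ∧ ‖v.2.2‖ ≤ ‖v‖ :=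
    ⟨norm_fst_le v, (norm_fst_le v.2).trans (norm_snd_le v),
      (norm_snd_le v.2).trans (norm_snd_le v)⟩
  exact h v

theorem GaussParam.continuous_op : Continuous fun v : GaussParam E => v.2.2 := by
  have h : Continuous fun v : ℝ × E × (E →L[ℝ] E) => v.2.2 := by fun_prop
  exact h

theorem gaussExponent_apply (y : E) (v : GaussParam E) :
    gaussExponent y v = v.1 + inner ℝ y v.2.1 - (1 / 2) * inner ℝ y (v.2.2 y) := by
  have h (v : ℝ × E × (E →L[ℝ] E)) : gaussExponentAux y v =
      v.1 + inner ℝ y v.2.1 - (1 / 2) * inner ℝ y (v.2.2 y) := rfl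
  exact h v

/-- Each derivative in the coefficients multiplies the integrand by this functional, so a factor of
size 1 + ‖y‖² is what `GaussIntegrable.of_le` has to absorb. -/
theorem norm_gaussExponent_le (y : E) : ‖gaussExponent y‖ ≤ 2 * (1 + ‖y‖ ^ 2) := by
  refine ContinuousLinearMap.opNorm_le_bound _ (by positivity) fun v => ?_
  rw [gaussExponent_apply]
  obtain ⟨h1, h2, h3⟩ := v.norm_le
  have h4 : ‖inner ℝ y v.2.1‖ ≤ ‖y‖ * ‖v‖ :=
    (norm_inner_le_norm _ _).trans (by gcongr)
  have h5 : ‖inner ℝ y (v.2.2 y)‖ ≤ ‖y‖ * (‖v‖ * ‖y‖) :=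
    (norm_inner_le_norm _ _).trans (by gcongr; exact v.2.2.le_of_opNorm_le h3 y)
  have h6 : ‖v.1 + inner ℝ y v.2.1 - (1 / 2) * inner ℝ y (v.2.2 y)‖ ≤
      ‖v.1‖ + ‖inner ℝ y v.2.1‖ + (1 / 2) * ‖inner ℝ y (v.2.2 y)‖ := by
    refine (norm_sub_le _ _).trans (add_le_add (norm_add_le _ _) ?_)
    rw [norm_mul]; norm_num
  nlinarith [norm_nonneg v, mul_nonneg (norm_nonneg v) (sq_nonneg (‖y‖ - 1)), sq_nonneg ‖y‖]

/-- Coercivity of the quadratic form of an operator. -/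
def QuadCoercive (M : E →L[ℝ] E) : Prop := ∃ c > 0, ∀ y, c * ‖y‖ ^ 2 ≤ inner ℝ y (M y)

theorem quadCoercive_near {M : E →L[ℝ] E} {c : ℝ}
    (h : ∀ y, c * ‖y‖ ^ 2 ≤ inner ℝ y (M y)) {M' : E →L[ℝ] E} {r : ℝ} (hM : ‖M' - M‖ ≤ r) (y : E) :
    (c - r) * ‖y‖ ^ 2 ≤ inner ℝ y (M' y) := by
  have h1 : inner ℝ y (M' y) = inner ℝ y (M y) + inner ℝ y ((M' - M) y) := by
    rw [← inner_add_right]; simp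
  have h2 : |inner ℝ y ((M' - M) y)| ≤ ‖y‖ * (r * ‖y‖) :=
    (abs_real_inner_le_norm _ _).trans (by gcongr; exact (M' - M).le_of_opNorm_le hM y)
  nlinarith [h y, abs_le.1 h2]

theorem isOpen_quadCoercive : IsOpen {M : E →L[ℝ] E | QuadCoercive M} := by
  refine Metric.isOpen_iff.2 fun M ⟨c, hc, h⟩ => ⟨c / 2, by positivity, fun M' hM' => ?_⟩
  refine ⟨c / 2, by positivity, fun y => ?_⟩
  have := quadCoercive_near h (M' := M') (r := c / 2) (by
    rw [Metric.mem_ball, dist_eq_norm] at hM'; exact hM'.le) y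
  linarith

theorem isOpen_gaussDomain : IsOpen {v : GaussParam E | QuadCoercive v.2.2} :=
  isOpen_quadCoercive.preimage GaussParam.continuous_op

/-- A domination that is uniform near v, as needed for differentiation under the integral sign. -/
theorem exists_exp_gaussExponent_le {v : GaussParam E} (hv : QuadCoercive v.2.2) :
    ∃ c > 0, ∃ C, ∀ᶠ v' in 𝓝 v, ∀ y, Real.exp (gaussExponent y v') ≤ C * Real.exp (-c * ‖y‖ ^ 2) := by
  obtain ⟨c, hc, h⟩ := hv
  -- Near v the coercivity constant is still c/2, so the exponent contains -(c/4)‖y‖². Completing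
  -- the square spends (c/8)‖y‖² on the linear term, and c/8 is left.
  refine ⟨c / 8, by positivity, Real.exp ((‖v‖ + 1) + (‖v‖ + 1) ^ 2 * (2 / c)), ?_⟩
  have h1 : ∀ᶠ v' in 𝓝 v, ‖v'‖ < ‖v‖ + 1 :=
    (continuous_norm.tendsto v).eventually_lt_const (by linarith)
  have h2 : ∀ᶠ v' in 𝓝 v, ‖v'.2.2 - v.2.2‖ < c / 2 := by
    have : Tendsto (fun v' : GaussParam E => ‖v'.2.2 - v.2.2‖) (𝓝 v) (𝓝 ‖v.2.2 - v.2.2‖) :=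
      ((GaussParam.continuous_op.sub continuous_const).norm).tendsto v
    exact this.eventually_lt_const (by simpa using hc)
  filter_upwards [h1, h2] with v' h1 h2 y
  rw [← Real.exp_add, Real.exp_le_exp, gaussExponent_apply]
  have h3 := quadCoercive_near h h2.le y
  have h4 : v'.1 ≤ ‖v‖ + 1 := (Real.le_norm_self _).trans (v'.norm_le.1.trans h1.le)
  have h5 : inner ℝ y v'.2.1 ≤ ‖y‖ * (‖v‖ + 1) :=
    (real_inner_le_norm _ _).trans
      (by gcongr; exact v'.norm_le.2.1.trans h1.le)
  have h6 : ‖y‖ * (‖v‖ + 1) ≤ c / 8 * ‖y‖ ^ 2 + (‖v‖ + 1) ^ 2 * (2 / c) := by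
    have : 0 ≤ (2 / c) * (c / 4 * ‖y‖ - (‖v‖ + 1)) ^ 2 := by positivity
    have e : (2 / c) * (c / 4 * ‖y‖ - (‖v‖ + 1)) ^ 2 =
      c / 8 * ‖y‖ ^ 2 + (‖v‖ + 1) ^ 2 * (2 / c) - ‖y‖ * (‖v‖ + 1) := by field_simp; ring
    linarith
  nlinarith [h3, h4, h5, h6]

variable [MeasurableSpace E] [BorelSpace E] [SecondCountableTopology E] {μ : Measure E}

/-- Functions that are integrable against every centered Gaussian weight. -/
structure GaussIntegrable {G : Type*} [NormedAddCommGroup G] [NormedSpace ℝ G] (h : E → G)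
    (μ : Measure E) : Prop where
  meas : AEStronglyMeasurable h μ
  int : ∀ c > 0, Integrable (fun y => Real.exp (-c * ‖y‖ ^ 2) • h y) μ

/-- The integral `∫ exp (Λ_y v) h(y) dy`. -/
noncomputable def gaussIntegral {G : Type*} [NormedAddCommGroup G] [NormedSpace ℝ G] (μ : Measure E)
    (h : E → G) (v : GaussParam E) : G :=
  ∫ y, Real.exp (gaussExponent y v) • h y ∂μ

section

variable {G G' : Type*} [NormedAddCommGroup G] [NormedSpace ℝ G] [NormedAddCommGroup G']
  [NormedSpace ℝ G'] {h : E → G}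

theorem GaussIntegrable.of_integrable (hh : Integrable h μ) : GaussIntegrable h μ where
  meas := hh.1
  int c hc := by
    refine hh.mono ((by fun_prop : Continuous fun y : E => Real.exp (-c * ‖y‖ ^ 2)).aestronglyMeasurable.smul hh.1)
      (ae_of_all _ fun y => ?_)
    rw [norm_smul, Real.norm_eq_abs, Real.abs_exp]
    refine mul_le_of_le_one_left (norm_nonneg _) (Real.exp_le_one_iff.2 ?_)
    nlinarith [sq_nonneg ‖y‖]

/-- Half of the Gaussian weight is spent on the factor 1 + ‖y‖², which stays below 1 + 2/c; the
other half keeps h integrable. -/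
theorem GaussIntegrable.of_le (hh : GaussIntegrable h μ) {k : E → G'}
    (hk : AEStronglyMeasurable k μ) {C : ℝ} (hle : ∀ y, ‖k y‖ ≤ C * (1 + ‖y‖ ^ 2) * ‖h y‖) :
    GaussIntegrable k μ where
  meas := hk
  int c hc := by
    refine ((hh.int (c / 2) (by positivity)).norm.const_mul (|C| * (1 + 2 / c))).mono'
      ((by fun_prop : Continuous fun y : E => Real.exp (-c * ‖y‖ ^ 2)).aestronglyMeasurable.smul hk)
      (ae_of_all _ fun y => ?_)
    rw [norm_exp_smul, norm_exp_smul]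
    have e : Real.exp (-c * ‖y‖ ^ 2) =
        Real.exp (-(c / 2) * ‖y‖ ^ 2) * Real.exp (-(c / 2 * ‖y‖ ^ 2)) := by
      rw [← Real.exp_add]; congr 1; ring
    have h1 : Real.exp (-(c / 2 * ‖y‖ ^ 2)) * (1 + ‖y‖ ^ 2) ≤ 1 + 2 / c := by
      have h2 := Real.add_one_le_exp (c / 2 * ‖y‖ ^ 2)
      rw [Real.exp_neg, inv_mul_le_iff₀ (Real.exp_pos _)]
      have h3 : (1 + 2 / c) * (c / 2 * ‖y‖ ^ 2 + 1) = ‖y‖ ^ 2 + c / 2 * ‖y‖ ^ 2 + 1 + 2 / c := by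
        field_simp; ring
      have h4 : 0 ≤ 1 + 2 / c := by positivity
      have h5 : 0 ≤ c / 2 * ‖y‖ ^ 2 := by positivity
      have h6 : 0 ≤ 2 / c := by positivity
      nlinarith
    calc _ ≤ Real.exp (-c * ‖y‖ ^ 2) * (|C| * (1 + ‖y‖ ^ 2) * ‖h y‖) := by
          gcongr
          exact (hle y).trans (by gcongr; exact le_abs_self C)
      _ = |C| * (Real.exp (-(c / 2 * ‖y‖ ^ 2)) * (1 + ‖y‖ ^ 2)) *
          (Real.exp (-(c / 2) * ‖y‖ ^ 2) * ‖h y‖) := by rw [e]; ring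
      _ ≤ _ := by gcongr

theorem GaussIntegrable.smulRight (hh : GaussIntegrable h μ) :
    GaussIntegrable (fun y => (gaussExponent y).smulRight (h y)) μ := by
  refine hh.of_le (C := 2) ?_ fun y => ?_
  · exact aestronglyMeasurable_smulRight continuous_gaussExponent.aestronglyMeasurable hh.meas
  · rw [ContinuousLinearMap.norm_smulRight_apply]
    gcongr
    exact norm_gaussExponent_le y

theorem GaussIntegrable.integrable (hh : GaussIntegrable h μ) {v : GaussParam E}
    (hv : QuadCoercive v.2.2) :
    Integrable (fun y => Real.exp (gaussExponent y v) • h y) μ := by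
  obtain ⟨c, hc, C, hC⟩ := exists_exp_gaussExponent_le hv
  refine ((hh.int c hc).norm.const_mul C).mono' ?_ (ae_of_all _ fun y => ?_)
  · have : Continuous fun y : E => Real.exp (gaussExponent y v) := by
      have := continuous_gaussExponent (E := E)
      fun_prop
    exact this.aestronglyMeasurable.smul hh.meas
  · rw [norm_exp_smul, norm_exp_smul,
      ← mul_assoc]
    gcongr
    exact hC.self_of_nhds y

/-- The derivative is again a Gaussian integral, of a density with values in a space of operators;
this makes the class closed under differentiation. -/
theorem hasFDerivAt_gaussIntegral (hh : GaussIntegrable h μ) {v : GaussParam E}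
    (hv : QuadCoercive v.2.2) :
    HasFDerivAt (gaussIntegral μ h)
      (gaussIntegral μ (fun y => (gaussExponent y).smulRight (h y)) v) v := by
  obtain ⟨c, hc, C, hC⟩ := exists_exp_gaussExponent_le hv
  refine hasFDerivAt_integral_of_dominated_of_fderiv_le
    (F := fun v y => Real.exp (gaussExponent y v) • h y)
    (F' := fun v y => Real.exp (gaussExponent y v) • (gaussExponent y).smulRight (h y))
    (bound := fun y => C * ‖Real.exp (-c * ‖y‖ ^ 2) • (gaussExponent y).smulRight (h y)‖) hC ?_
    (hh.integrable hv) (hh.smulRight.integrable hv).1 (ae_of_all _ fun y v' hv' => ?_)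
    ((hh.smulRight.int c hc).norm.const_mul C) (ae_of_all _ fun y v' _ => ?_)
  · filter_upwards [isOpen_gaussDomain.mem_nhds hv] with v' hv'
    exact (hh.integrable hv').1
  · refine ((norm_exp_smul_clm _ _).trans_le ?_).trans_eq
      (congrArg (C * ·) (norm_exp_smul_clm _ _).symm)
    rw [← mul_assoc]
    gcongr
    exact hv' y
  · exact hasFDerivAt_exp_clm_smul (gaussExponent y) (h y) v'

end

/-- The codomain G is quantified inside the induction, because each differentiation replaces it by
the operators from `GaussParam E` to G. Everything lives in `Type` so that these codomains stay in
one universe. -/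
theorem contDiffOn_gaussIntegral_nat {E : Type} [NormedAddCommGroup E] [InnerProductSpace ℝ E]
    [MeasurableSpace E] [BorelSpace E] [SecondCountableTopology E] {μ : Measure E} (n : ℕ) :
    ∀ {G : Type} [NormedAddCommGroup G] [NormedSpace ℝ G] {h : E → G}, GaussIntegrable h μ →
      ContDiffOn ℝ n (gaussIntegral μ h) {v : GaussParam E | QuadCoercive v.2.2} := by
  induction n with
  | zero =>
    intro G _ _ h hh
    refine contDiffOn_zero.2 fun v hv => ?_
    exact (hasFDerivAt_gaussIntegral hh hv).continuousAt.continuousWithinAt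
  | succ n ih =>
    intro G _ _ h hh
    push_cast
    refine (contDiffOn_succ_iff_fderiv_of_isOpen isOpen_gaussDomain).2 ⟨fun v hv =>
      (hasFDerivAt_gaussIntegral hh hv).differentiableAt.differentiableWithinAt, by simp, ?_⟩
    exact (ih hh.smulRight).congr fun v hv => (hasFDerivAt_gaussIntegral hh hv).fderiv

theorem contDiffOn_gaussIntegral {E : Type} [NormedAddCommGroup E] [InnerProductSpace ℝ E]
    [MeasurableSpace E] [BorelSpace E] [SecondCountableTopology E] {μ : Measure E}
    {G : Type} [NormedAddCommGroup G] [NormedSpace ℝ G] {h : E → G} (hh : GaussIntegrable h μ) :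
    ContDiffOn ℝ ∞ (gaussIntegral μ h) {v : GaussParam E | QuadCoercive v.2.2} :=
  contDiffOn_infty.2 fun n => contDiffOn_gaussIntegral_nat n hh

end GaussianIntegrals

/-! ### Traces, coercivity by compactness, and the divergence theorem on the whole space. -/

section Divergence

variable {E : Type} [NormedAddCommGroup E] [InnerProductSpace ℝ E] [FiniteDimensional ℝ E]

/-- The trace as a continuous linear functional on operators. -/
noncomputable def clmTrace : (E →L[ℝ] E) →L[ℝ] ℝ :=
  LinearMap.toContinuousLinearMap (LinearMap.trace ℝ E ∘ₗ ContinuousLinearMap.coeLM ℝ)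

theorem clmTrace_apply (T : E →L[ℝ] E) : clmTrace T = LinearMap.trace ℝ E T := rfl

theorem clmTrace_smulRight (f : E →L[ℝ] ℝ) (v : E) : clmTrace (f.smulRight v) = f v :=
  LinearMap.trace_smulRight (f : E →ₗ[ℝ] ℝ) v

/-- The constant is the minimum of the form on the unit sphere, which is compact; an empty sphere
means that the space is trivial. -/
theorem quadCoercive_of_pos {M : E →L[ℝ] E} (hM : ∀ x, x ≠ 0 → 0 < inner ℝ x (M x)) :
    QuadCoercive M := by
  rcases (Metric.sphere (0 : E) 1).eq_empty_or_nonempty with h | h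
  · refine ⟨1, one_pos, fun y => ?_⟩
    have : y = 0 := by
      by_contra hy
      have : (‖y‖⁻¹ • y) ∈ Metric.sphere (0 : E) 1 := by
        simp [norm_smul, inv_mul_cancel₀ (norm_ne_zero_iff.2 hy)]
      rw [h] at this
      exact this
    simp [this]
  · obtain ⟨x, hx, hmin⟩ := (isCompact_sphere (0 : E) 1).exists_isMinOn h
      (f := fun x => inner ℝ x (M x)) (by fun_prop)
    have hx1 : ‖x‖ = 1 := by simpa using hx
    refine ⟨inner ℝ x (M x), hM x (by rintro rfl; simp at hx1), fun y => ?_⟩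
    rcases eq_or_ne y 0 with rfl | hy
    · simp
    have hy' : ‖y‖ ≠ 0 := norm_ne_zero_iff.2 hy
    have h1 : inner ℝ x (M x) ≤ inner ℝ (‖y‖⁻¹ • y) (M (‖y‖⁻¹ • y)) :=
      hmin (show (‖y‖⁻¹ • y) ∈ Metric.sphere (0 : E) 1 by
        simp [norm_smul, inv_mul_cancel₀ hy'])
    rw [map_smul, real_inner_smul_left, real_inner_smul_right] at h1
    calc _ ≤ (‖y‖⁻¹ * (‖y‖⁻¹ * inner ℝ y (M y))) * ‖y‖ ^ 2 := by gcongr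
      _ = _ := by field_simp

variable [MeasurableSpace E] [BorelSpace E]

/-- Integration by parts against the constant function 1, in each direction. -/
theorem integral_fderiv_eq_zero {W : E → E} {W' : E → E →L[ℝ] E}
    (hW : ∀ x, HasFDerivAt W (W' x) x) (hi : Integrable W) (hi' : Integrable W') :
    ∫ x, W' x = 0 := by
  ext v
  rw [ContinuousLinearMap.integral_apply hi']
  have h := integral_bilinear_hasFDerivAt_right_eq_neg_left_of_integrable (μ := (volume : Measure E))
    (f := fun _ => (1 : ℝ)) (f' := fun _ => 0) (g := W) (g' := W') (v := v)
    (B := ContinuousLinearMap.lsmul ℝ ℝ) (by simp) (by simpa using hi'.apply_continuousLinearMap v)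
    (by simpa using hi) (fun x _ => hasFDerivAt_const _ _) (fun x _ => hW x)
  simpa using h

theorem integral_clmTrace_fderiv_eq_zero {W : E → E} {W' : E → E →L[ℝ] E}
    (hW : ∀ x, HasFDerivAt W (W' x) x) (hi : Integrable W) (hi' : Integrable W') :
    ∫ x, clmTrace (W' x) = 0 := by
  rw [ContinuousLinearMap.integral_comp_comm _ hi', integral_fderiv_eq_zero hW hi hi', map_zero]

end Divergence

/-! ### Assembling coefficient triples. -/

section Param

variable {E : Type} [NormedAddCommGroup E] [InnerProductSpace ℝ E]

/-- The coefficient triple `(a, w, M)`. -/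
def GaussParam.mk (a : ℝ) (w : E) (M : E →L[ℝ] E) : GaussParam E := (a, w, M)

theorem gaussExponent_mk (y : E) (a : ℝ) (w : E) (M : E →L[ℝ] E) :
    gaussExponent y (GaussParam.mk a w M) = a + inner ℝ y w - (1 / 2) * inner ℝ y (M y) :=
  gaussExponent_apply y _

variable {X : Type*} [NormedAddCommGroup X] [NormedSpace ℝ X]

theorem GaussParam.hasDerivAt_mk {a : ℝ → ℝ} {w : ℝ → E} {M : ℝ → E →L[ℝ] E} {a' : ℝ}
    {w' : E} {M' : E →L[ℝ] E} {x : ℝ} (ha : HasDerivAt a a' x)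
    (hw : HasDerivAt w w' x) (hM : HasDerivAt M M' x) :
    HasDerivAt (fun x => GaussParam.mk (a x) (w x) (M x)) (GaussParam.mk a' w' M') x :=
  HasDerivAt.prodMk ha (HasDerivAt.prodMk hw hM)

theorem GaussParam.contDiffOn_mk {n : WithTop ℕ∞} {s : Set X} {a : X → ℝ} {w : X → E}
    {M : X → E →L[ℝ] E} (ha : ContDiffOn ℝ n a s) (hw : ContDiffOn ℝ n w s)
    (hM : ContDiffOn ℝ n M s) : ContDiffOn ℝ n (fun x => GaussParam.mk (a x) (w x) (M x)) s :=
  ContDiffOn.prodMk ha (ContDiffOn.prodMk hw hM)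

end Param

/-! ### Masses and second moments of Gaussian weights. -/

section GaussianMass

variable {E : Type} [NormedAddCommGroup E] [InnerProductSpace ℝ E] [FiniteDimensional ℝ E]
  [MeasurableSpace E] [BorelSpace E]

theorem gaussIntegral_smulRight_apply {G : Type} [NormedAddCommGroup G] [NormedSpace ℝ G]
    {h : E → G} (hh : GaussIntegrable h volume) {v : GaussParam E} (hv : QuadCoercive v.2.2)
    (u : GaussParam E) :
    gaussIntegral volume (fun y => (gaussExponent y).smulRight (h y)) v u =
      gaussIntegral volume (fun y => gaussExponent y u • h y) v :=
  ContinuousLinearMap.integral_apply (hh.smulRight.integrable hv) u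

theorem gaussIntegrable_one : GaussIntegrable (fun _ : E => (1 : ℝ)) volume where
  meas := aestronglyMeasurable_const
  int c hc := by
    have h := (GaussianFourier.integrable_cexp_neg_mul_sq_norm_add (V := E) (b := (c : ℂ))
      (by simpa using hc) 0 0).re
    refine h.congr (ae_of_all _ fun y => ?_)
    simp only [zero_mul, add_zero, smul_eq_mul, mul_one]
    rw [show (-(c : ℂ) * (‖y‖ : ℂ) ^ 2) = ((-c * ‖y‖ ^ 2 : ℝ) : ℂ) by push_cast; ring,
      ← Complex.ofReal_exp]
    exact (Complex.ofReal_re _)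

theorem GaussIntegrable.of_bound {G : Type*} [NormedAddCommGroup G] [NormedSpace ℝ G] {k : E → G}
    (hk : AEStronglyMeasurable k volume) {C : ℝ} (hle : ∀ y, ‖k y‖ ≤ C * (1 + ‖y‖ ^ 2)) :
    GaussIntegrable k volume :=
  gaussIntegrable_one.of_le hk (C := C) (by simpa using hle)

/-- The unnormalized centered Gaussian weight `exp (- ⟪z, P z⟫ / 2)`. -/
noncomputable def gaussWeight (P : E →L[ℝ] E) (z : E) : ℝ := Real.exp (-(1 / 2) * inner ℝ z (P z))

/-- The total mass of the weight `exp (- ⟪z, P z⟫ / 2)`. -/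
noncomputable def gaussMass (P : E →L[ℝ] E) : ℝ := ∫ z, gaussWeight P z

theorem gaussWeight_pos (P : E →L[ℝ] E) (z : E) : 0 < gaussWeight P z := Real.exp_pos _

theorem gaussWeight_eq (P : E →L[ℝ] E) (z : E) :
    gaussWeight P z = Real.exp (gaussExponent z (GaussParam.mk 0 0 P)) := by
  rw [gaussExponent_mk, gaussWeight]; congr 1; simp

theorem gaussMass_eq (P : E →L[ℝ] E) :
    gaussMass P = gaussIntegral volume (fun _ => (1 : ℝ)) (GaussParam.mk 0 0 P) := by
  simp [gaussMass, gaussIntegral, gaussWeight_eq]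

theorem continuous_gaussWeight (P : E →L[ℝ] E) : Continuous (gaussWeight P) := by
  unfold gaussWeight; fun_prop

theorem integrable_gaussWeight_smul {G : Type*} [NormedAddCommGroup G] [NormedSpace ℝ G] {k : E → G}
    (hk : GaussIntegrable k volume) {P : E →L[ℝ] E} (hP : QuadCoercive P) :
    Integrable (fun z => gaussWeight P z • k z) := by
  simp_rw [gaussWeight_eq]
  exact hk.integrable hP

theorem integrable_gaussWeight {P : E →L[ℝ] E} (hP : QuadCoercive P) :
    Integrable (gaussWeight P) := by
  simpa using integrable_gaussWeight_smul gaussIntegrable_one hP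

theorem gaussMass_pos {P : E →L[ℝ] E} (hP : QuadCoercive P) : 0 < gaussMass P :=
  integral_exp_pos (integrable_gaussWeight hP)

theorem hasFDerivAt_gaussWeight {P : E →L[ℝ] E} (hs : ∀ x y, inner ℝ (P x) y = inner ℝ x (P y))
    (z : E) : HasFDerivAt (gaussWeight P) (-(gaussWeight P z • innerSL ℝ (P z))) z := by
  unfold gaussWeight
  have h := (((hasFDerivAt_id z).inner ℝ (P.hasFDerivAt (x := z))).const_mul (-(1 / 2))).exp
  refine h.congr_fderiv (ContinuousLinearMap.ext fun v => ?_)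
  change Real.exp (-(1 / 2) * inner ℝ z (P z)) * (-(1 / 2) * (inner ℝ z (P v) + inner ℝ v (P z))) =
    -(Real.exp (-(1 / 2) * inner ℝ z (P z)) * inner ℝ (P z) v)
  rw [← hs z v, real_inner_comm (P z) v]
  ring

/-- Integration by parts against a Gaussian weight. -/
theorem clmTrace_mul_gaussMass {P : E →L[ℝ] E} (hP : QuadCoercive P)
    (hs : ∀ x y, inner ℝ (P x) y = inner ℝ x (P y)) (T : E →L[ℝ] E) :
    clmTrace T * gaussMass P = ∫ z, gaussWeight P z * inner ℝ (T z) (P z) := by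
  have hsq (z : E) : ‖z‖ ≤ 1 + ‖z‖ ^ 2 := by nlinarith [sq_nonneg (‖z‖ - 1), sq_nonneg ‖z‖]
  -- The field z ↦ w(z) T z, with w the weight, has divergence w(z)(tr T - ⟪T z, P z⟫), whose
  -- integral vanishes.
  have hd (z : E) : HasFDerivAt (fun z => gaussWeight P z • T z)
      (gaussWeight P z • (T - (innerSL ℝ (P z)).smulRight (T z))) z := by
    refine ((hasFDerivAt_gaussWeight hs z).smul (T.hasFDerivAt (x := z))).congr_fderiv
      (ContinuousLinearMap.ext fun v => ?_)
    simp [sub_eq_add_neg, smul_smul]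
  have hi : Integrable (fun z => gaussWeight P z • T z) :=
    integrable_gaussWeight_smul (GaussIntegrable.of_bound (C := ‖T‖)
      T.continuous.aestronglyMeasurable fun y => (T.le_opNorm y).trans (by gcongr; exact hsq y)) hP
  have hi' : Integrable
      (fun z => gaussWeight P z • (T - (innerSL ℝ (P z)).smulRight (T z))) := by
    refine integrable_gaussWeight_smul (GaussIntegrable.of_bound (C := ‖T‖ + ‖P‖ * ‖T‖) ?_
      fun y => ?_) hP
    · refine aestronglyMeasurable_const.sub (aestronglyMeasurable_smulRight ?_
        T.continuous.aestronglyMeasurable)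
      exact (by fun_prop : Continuous fun z => innerSL ℝ (P z)).aestronglyMeasurable
    · refine (norm_sub_le _ _).trans ?_
      rw [ContinuousLinearMap.norm_smulRight_apply, innerSL_apply_norm]
      have h1 : ‖P y‖ * ‖T y‖ ≤ (‖P‖ * ‖y‖) * (‖T‖ * ‖y‖) :=
        mul_le_mul (P.le_opNorm y) (T.le_opNorm y) (norm_nonneg _) (by positivity)
      nlinarith [norm_nonneg T, mul_nonneg (norm_nonneg T) (sq_nonneg ‖y‖),
        mul_nonneg (norm_nonneg P) (norm_nonneg T)]
  have h0 := integral_clmTrace_fderiv_eq_zero hd hi hi'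
  have e (z : E) : clmTrace (gaussWeight P z • (T - (innerSL ℝ (P z)).smulRight (T z))) =
      clmTrace T * gaussWeight P z - gaussWeight P z * inner ℝ (T z) (P z) := by
    rw [map_smul, map_sub, clmTrace_smulRight, innerSL_apply_apply, real_inner_comm, smul_eq_mul]
    ring
  have hi2 : Integrable (fun z => gaussWeight P z * inner ℝ (T z) (P z)) := by
    refine (((integrable_gaussWeight hP).const_mul (clmTrace T)).sub
      (clmTrace.integrable_comp hi')).congr (ae_of_all _ fun z => ?_)
    simp only [Pi.sub_apply, e]
    ring
  simp_rw [e] at h0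
  rw [integral_sub ((integrable_gaussWeight hP).const_mul _) hi2, integral_const_mul] at h0
  exact sub_eq_zero.1 h0

/-- Differentiating the mass produces the integral of -⟪z, P' z⟫/2 against the weight, which
`clmTrace_mul_gaussMass` evaluates once this form is written as ⟪T z, P z⟫. It replaces Jacobi's
formula for the derivative of a determinant. -/
theorem hasDerivAt_log_gaussMass {P : ℝ → E →L[ℝ] E} {P' T : E →L[ℝ] E} {t : ℝ}
    (hP : QuadCoercive (P t)) (hs : ∀ x y, inner ℝ (P t x) y = inner ℝ x (P t y))
    (hd : HasDerivAt P P' t) (hT : ∀ z, inner ℝ z (P' z) = inner ℝ (T z) (P t z)) :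
    HasDerivAt (fun τ => Real.log (gaussMass (P τ))) (-(1 / 2) * clmTrace T) t := by
  have h1 : HasDerivAt (fun τ => gaussMass (P τ)) (-(1 / 2) * clmTrace T * gaussMass (P t)) t := by
    simp_rw [gaussMass_eq]
    have h := (hasFDerivAt_gaussIntegral (gaussIntegrable_one (E := E))
      (v := GaussParam.mk 0 0 (P t)) hP).comp_hasDerivAt t
        (GaussParam.hasDerivAt_mk (hasDerivAt_const t 0) (hasDerivAt_const t 0) hd)
    refine h.congr_deriv ?_
    rw [gaussIntegral_smulRight_apply gaussIntegrable_one (v := GaussParam.mk 0 0 (P t)) hP, ← gaussMass_eq, mul_assoc,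
      clmTrace_mul_gaussMass hP hs, ← integral_const_mul, gaussIntegral]
    refine integral_congr_ae (ae_of_all _ fun z => ?_)
    simp only [← gaussWeight_eq]
    rw [gaussExponent_mk, hT]
    simp; ring
  have h2 := h1.log (gaussMass_pos hP).ne'
  rwa [mul_div_assoc, div_self (gaussMass_pos hP).ne', mul_one] at h2

theorem contDiffOn_gaussMass :
    ContDiffOn ℝ ∞ (gaussMass : (E →L[ℝ] E) → ℝ) {P | QuadCoercive P} := by
  have h := (contDiffOn_gaussIntegral (gaussIntegrable_one (E := E))).comp
    (s := {P : E →L[ℝ] E | QuadCoercive P}) (GaussParam.contDiffOn_mk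
      (contDiffOn_const (c := (0 : ℝ))) (contDiffOn_const (c := (0 : E))) contDiffOn_id)
    (fun P hP => hP)
  exact h.congr fun P _ => gaussMass_eq P

/-- Take T = S = P⁻¹ in `clmTrace_mul_gaussMass`: the second moment is the trace of the covariance.
-/
theorem integral_gaussWeight_mul_norm_sq {P S : E →L[ℝ] E} (hP : QuadCoercive P)
    (hs : ∀ x y, inner ℝ (P x) y = inner ℝ x (P y)) (hPS : ∀ x, P (S x) = x) :
    ∫ z, gaussWeight P z * ‖z‖ ^ 2 = clmTrace S * gaussMass P := by
  rw [clmTrace_mul_gaussMass hP hs]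
  simp_rw [← hs, hPS, real_inner_self_eq_norm_sq]

theorem integral_comp_clm (B : E ≃L[ℝ] E) (g : E → ℝ) :
    ∫ x, g (B x) = |(B : E →L[ℝ] E).det|⁻¹ * ∫ x, g x := by
  have hdet : LinearMap.det (B.toLinearEquiv : E →ₗ[ℝ] E) ≠ 0 := B.toLinearEquiv.isUnit_det'.ne_zero
  have h := Measure.map_linearMap_addHaar_eq_smul_addHaar (volume : Measure E) hdet
  have h2 : ∫ x, g (B x) = ∫ x, g x ∂(Measure.map (B.toLinearEquiv : E →ₗ[ℝ] E) volume) :=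
    (B.toHomeomorph.measurableEmbedding.integral_map (μ := volume) g).symm
  rw [h2, h, integral_smul_measure, abs_inv, ENNReal.toReal_ofReal (by positivity), smul_eq_mul]
  rfl

theorem gaussMass_conj (B : E ≃L[ℝ] E) (M P : E →L[ℝ] E)
    (hP : ∀ z, inner ℝ z (P z) = inner ℝ (B z) (M (B z))) :
    gaussMass P = |(B : E →L[ℝ] E).det|⁻¹ * gaussMass M := by
  unfold gaussMass
  rw [← integral_comp_clm]
  simp_rw [gaussWeight, hP]

end GaussianMass

/-! ### Linear flows, the controllability Gramian and the Riccati equation. -/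

section Gramian

variable {E : Type} [NormedAddCommGroup E] [InnerProductSpace ℝ E] [FiniteDimensional ℝ E]
  [CompleteSpace E]

/-- The linear flow `e^{tA}`. -/
noncomputable def linFlow (A : E →L[ℝ] E) (t : ℝ) : E →L[ℝ] E := NormedSpace.exp (t • A)

theorem linFlow_zero (A : E →L[ℝ] E) : linFlow A 0 = 1 := by simp [linFlow]

theorem hasDerivAt_linFlow (A : E →L[ℝ] E) (t : ℝ) :
    HasDerivAt (linFlow A) (linFlow A t * A) t := hasDerivAt_exp_smul_const A t

theorem hasDerivAt_linFlow' (A : E →L[ℝ] E) (t : ℝ) :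
    HasDerivAt (linFlow A) (A * linFlow A t) t := hasDerivAt_exp_smul_const' A t

theorem contDiff_linFlow (A : E →L[ℝ] E) : ContDiff ℝ ∞ (linFlow A) := by
  refine contDiff_iff_contDiffAt.2 fun t => ?_
  exact ((NormedSpace.exp_analytic (𝕂 := ℝ) (t • A)).contDiffAt).comp t
    (contDiff_id.smul contDiff_const).contDiffAt

theorem continuous_linFlow (A : E →L[ℝ] E) : Continuous (linFlow A) := (contDiff_linFlow A).continuous

theorem linFlow_mul_neg (A : E →L[ℝ] E) (t : ℝ) : linFlow A t * linFlow A (-t) = 1 := by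
  let : NormedAlgebra ℚ (E →L[ℝ] E) := NormedAlgebra.restrictScalars ℚ ℝ (E →L[ℝ] E)
  rw [linFlow, linFlow, ← NormedSpace.exp_add_of_commute, ← add_smul]
  · simp
  · exact ((Commute.refl A).smul_left t).smul_right (-t)

theorem linFlow_neg_mul (A : E →L[ℝ] E) (t : ℝ) : linFlow A (-t) * linFlow A t = 1 := by
  simpa using linFlow_mul_neg A (-t)

/-- The linear flow as an equivalence. -/
noncomputable def linFlowEquiv (A : E →L[ℝ] E) (t : ℝ) : E ≃L[ℝ] E :=
  ContinuousLinearEquiv.equivOfInverse (linFlow A t) (linFlow A (-t))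
    (fun x => congrArg (fun T : E →L[ℝ] E => T x) (linFlow_neg_mul A t))
    (fun x => congrArg (fun T : E →L[ℝ] E => T x) (linFlow_mul_neg A t))

theorem linFlowEquiv_coe (A : E →L[ℝ] E) (t : ℝ) : (linFlowEquiv A t : E →L[ℝ] E) = linFlow A t := rfl

theorem linFlowEquiv_apply (A : E →L[ℝ] E) (t : ℝ) (x : E) : linFlowEquiv A t x = linFlow A t x := rfl

theorem star_linFlow (A : E →L[ℝ] E) (t : ℝ) : star (linFlow A t) = linFlow (star A) t := by
  rw [linFlow, linFlow, NormedSpace.star_exp, star_smul, star_trivial]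

theorem inner_clm_star_left (A : E →L[ℝ] E) (x y : E) : inner ℝ (star A x) y = inner ℝ x (A y) :=
  ContinuousLinearMap.adjoint_inner_left A y x

theorem inner_linFlow_star (A : E →L[ℝ] E) (t : ℝ) (x y : E) :
    inner ℝ (linFlow (star A) t x) y = inner ℝ x (linFlow A t y) := by
  rw [← star_linFlow, inner_clm_star_left]

/-- `D` is symmetric positive semidefinite and its kernel contains no nontrivial `Aᵀ`-invariant
subspace. -/
structure HypoellipticPair (A D : E →L[ℝ] E) : Prop where
  symm : ∀ x y, inner ℝ (D x) y = inner ℝ x (D y)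
  nonneg : ∀ x, 0 ≤ inner ℝ x (D x)
  kalman : ∀ V : Submodule ℝ E, (∀ v ∈ V, D v = 0) → (∀ v ∈ V, star A v ∈ V) → V = ⊥

/-- The nonnegative quadratic polynomial r ↦ ⟪v + r D v, D(v + r D v)⟫ has no constant term, so its
discriminant forces the linear coefficient 2‖D v‖² to vanish. -/
theorem apply_eq_zero_of_inner_eq_zero {D : E →L[ℝ] E}
    (hs : ∀ x y, inner ℝ (D x) y = inner ℝ x (D y)) (hn : ∀ x, 0 ≤ inner ℝ x (D x)) {v : E}
    (hv : inner ℝ v (D v) = 0) : D v = 0 := by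
  have h (r : ℝ) : 0 ≤ inner ℝ (D v) (D (D v)) * (r * r) + (2 * inner ℝ (D v) (D v)) * r + 0 := by
    have := hn (v + r • D v)
    simp only [map_add, map_smul, inner_add_left, inner_add_right, inner_smul_left,
      inner_smul_right, hv, ← hs v (D v)] at this
    simp only [conj_trivial] at this
    linarith
  have h2 := discrim_le_zero h
  rw [discrim] at h2
  have h3 : inner ℝ (D v) (D v) = 0 := by nlinarith
  exact inner_self_eq_zero.1 h3

/-- The controllability Gramian `2 ∫₀ᵗ e^{sA} D e^{sA*} ds`. -/
noncomputable def gramian (A D : E →L[ℝ] E) (t : ℝ) : E →L[ℝ] E :=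
  ∫ s in (0 : ℝ)..t, (2 : ℝ) • (linFlow A s * D * linFlow (star A) s)

theorem contDiff_gramian_integrand (A D : E →L[ℝ] E) :
    ContDiff ℝ ∞ fun s => (2 : ℝ) • (linFlow A s * D * linFlow (star A) s) :=
  (((contDiff_linFlow A).mul contDiff_const).mul (contDiff_linFlow (star A))).const_smul (2 : ℝ)

theorem hasDerivAt_gramian (A D : E →L[ℝ] E) (t : ℝ) :
    HasDerivAt (gramian A D) ((2 : ℝ) • (linFlow A t * D * linFlow (star A) t)) t := by
  have hc := (contDiff_gramian_integrand A D).continuous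
  exact intervalIntegral.integral_hasDerivAt_right (hc.intervalIntegrable _ _)
    (hc.stronglyMeasurableAtFilter _ _) hc.continuousAt

theorem contDiff_gramian (A D : E →L[ℝ] E) : ContDiff ℝ ∞ (gramian A D) := by
  refine contDiff_infty_iff_deriv.2 ⟨fun t => (hasDerivAt_gramian A D t).differentiableAt, ?_⟩
  rw [show deriv (gramian A D) = _ from funext fun t => (hasDerivAt_gramian A D t).deriv]
  exact contDiff_gramian_integrand A D

theorem gramian_zero (A D : E →L[ℝ] E) : gramian A D 0 = 0 := intervalIntegral.integral_same

theorem inner_gramian (A D : E →L[ℝ] E) (t : ℝ) (x y : E) :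
    inner ℝ x (gramian A D t y) =
      ∫ s in (0 : ℝ)..t, 2 * inner ℝ (linFlow (star A) s x) (D (linFlow (star A) s y)) := by
  have hc := (contDiff_gramian_integrand A D).continuous
  have h := ((innerSL ℝ x).comp (ContinuousLinearMap.apply ℝ E y)).intervalIntegral_comp_comm
    (hc.intervalIntegrable (μ := volume) 0 t)
  refine h.symm.trans (intervalIntegral.integral_congr fun s _ => ?_)
  simp [inner_linFlow_star]

theorem gramian_symm {A D : E →L[ℝ] E} (hs : ∀ x y, inner ℝ (D x) y = inner ℝ x (D y)) (t : ℝ)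
    (x y : E) : inner ℝ (gramian A D t x) y = inner ℝ x (gramian A D t y) := by
  rw [real_inner_comm, inner_gramian, inner_gramian]
  simp_rw [← hs]
  refine intervalIntegral.integral_congr fun s _ => ?_
  simp only [hs]
  rw [← hs, real_inner_comm]

/-- Kalman's argument: if the form vanished at x, then D would kill the adjoint orbit of x on [0,
t]. Differentiating in time, D kills all images of the orbit under powers of A*, and these lie in an
A*-invariant subspace of ker D. -/
theorem gramian_pos {A D : E →L[ℝ] E} (h : HypoellipticPair A D) {t : ℝ} (ht : 0 < t) {x : E}
    (hx : x ≠ 0) : 0 < inner ℝ x (gramian A D t x) := by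
  rw [inner_gramian]
  have hcf : Continuous fun s => linFlow (star A) s x :=
    (continuous_linFlow (star A)).clm_apply continuous_const
  refine intervalIntegral.integral_pos ht (by fun_prop)
    (fun s _ => mul_nonneg zero_le_two (h.nonneg _)) ?_
  by_contra! hall
  -- The open interval lets the vanishing at level k be differentiated in s, which gives level k +
  -- 1.
  have h0 (s : ℝ) (hs : s ∈ Ioo 0 t) (k : ℕ) : D ((star A ^ k) (linFlow (star A) s x)) = 0 := by
    induction k generalizing s with
    | zero =>
      refine apply_eq_zero_of_inner_eq_zero h.symm h.nonneg (le_antisymm ?_ (h.nonneg _))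
      have := hall s (Ioo_subset_Icc_self hs)
      simp only [pow_zero]
      exact le_of_mul_le_mul_left (this.trans_eq (mul_zero 2).symm) zero_lt_two
    | succ k ih =>
      have hd : HasDerivAt (fun s => D ((star A ^ k) (linFlow (star A) s x)))
          (D ((star A ^ k) ((star A * linFlow (star A) s) x))) s :=
        D.hasFDerivAt.comp_hasDerivAt s ((star A ^ k).hasFDerivAt.comp_hasDerivAt s
          ((hasDerivAt_linFlow' (star A) s).clm_apply (hasDerivAt_const s x) |>.congr_deriv (by simp)))
      have hz : HasDerivAt (fun s => D ((star A ^ k) (linFlow (star A) s x))) 0 s :=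
        (hasDerivAt_const s (0 : E)).congr_of_eventuallyEq
          (by filter_upwards [isOpen_Ioo.mem_nhds hs] with r hr using ih r hr)
      have := hd.unique hz
      rwa [pow_succ]
  let V : Submodule ℝ E := ⨅ k : ℕ, LinearMap.ker ((D * star A ^ k : E →L[ℝ] E) : E →ₗ[ℝ] E)
  have hV {v : E} : v ∈ V ↔ ∀ k : ℕ, D ((star A ^ k) v) = 0 := by
    simp only [V, Submodule.mem_iInf]; rfl
  have hbot : V = ⊥ := by
    refine h.kalman V (fun v hv => by simpa using hV.1 hv 0) fun v hv => hV.2 fun k => ?_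
    simpa [pow_succ] using hV.1 hv (k + 1)
  -- Any interior time serves; the flow is invertible, so x itself must be zero.
  have hmem : linFlow (star A) (t / 2) x ∈ V :=
    hV.2 fun k => h0 (t / 2) ⟨by positivity, by linarith⟩ k
  rw [hbot, Submodule.mem_bot, ← linFlowEquiv_apply] at hmem
  exact hx ((linFlowEquiv (star A) (t / 2)).map_eq_zero_iff.1 hmem)

/-- The inverse of the Gramian. -/
noncomputable def precision (A D : E →L[ℝ] E) (t : ℝ) : E →L[ℝ] E := Ring.inverse (gramian A D t)

section

variable {A D : E →L[ℝ] E} (h : HypoellipticPair A D) {t : ℝ} (ht : 0 < t)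

include h ht

theorem isUnit_gramian : IsUnit (gramian A D t) := by
  rw [ContinuousLinearMap.isUnit_iff_isUnit_toLinearMap, LinearMap.isUnit_iff_ker_eq_bot,
    LinearMap.ker_eq_bot']
  intro x hx
  by_contra hx0
  have := gramian_pos h ht hx0
  rw [show gramian A D t x = 0 from hx, inner_zero_right] at this
  exact this.false

theorem gramian_precision (x : E) : gramian A D t (precision A D t x) = x :=
  congrArg (fun T : E →L[ℝ] E => T x) (Ring.mul_inverse_cancel _ (isUnit_gramian h ht))

theorem precision_gramian (x : E) : precision A D t (gramian A D t x) = x :=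
  congrArg (fun T : E →L[ℝ] E => T x) (Ring.inverse_mul_cancel _ (isUnit_gramian h ht))

theorem precision_symm (x y : E) :
    inner ℝ (precision A D t x) y = inner ℝ x (precision A D t y) := by
  conv_lhs => rw [← gramian_precision h ht y]
  rw [← gramian_symm h.symm, gramian_precision h ht]

theorem precision_pos {x : E} (hx : x ≠ 0) : 0 < inner ℝ x (precision A D t x) := by
  rw [← precision_symm h ht]
  conv_rhs => arg 3; rw [← gramian_precision h ht x]
  refine (gramian_pos h ht fun h0 => hx ?_)
  rw [← gramian_precision h ht x, h0, map_zero]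

theorem quadCoercive_precision : QuadCoercive (precision A D t) :=
  quadCoercive_of_pos fun _ => precision_pos h ht

theorem contDiffAt_precision : ContDiffAt ℝ ∞ (precision A D) t := by
  obtain ⟨u, hu⟩ := isUnit_gramian h ht
  have h1 := contDiffAt_ringInverse ℝ (n := ∞) u
  rw [hu] at h1
  exact h1.comp t (contDiff_gramian A D).contDiffAt

theorem hasDerivAt_precision : HasDerivAt (precision A D)
    (-(precision A D t * ((2 : ℝ) • (linFlow A t * D * linFlow (star A) t)) * precision A D t)) t := by
  obtain ⟨u, hu⟩ := isUnit_gramian h ht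
  have h1 := hasFDerivAt_ringInverse (𝕜 := ℝ) u
  have h2 : ((u⁻¹ : (E →L[ℝ] E)ˣ) : E →L[ℝ] E) = precision A D t := by
    rw [precision, ← hu, Ring.inverse_unit]
  rw [hu] at h1
  refine (h1.comp_hasDerivAt t (hasDerivAt_gramian A D t)).congr_deriv ?_
  rw [h2]
  rfl

end

/-- The precision operator `e^{tA*} S_t⁻¹ e^{tA}` of the transition kernel. -/
noncomputable def kernelPrecision (A D : E →L[ℝ] E) (t : ℝ) : E →L[ℝ] E :=
  linFlow (star A) t * precision A D t * linFlow A t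

theorem inner_kernelPrecision (A D : E →L[ℝ] E) (t : ℝ) (x y : E) :
    inner ℝ x (kernelPrecision A D t y) =
      inner ℝ (linFlow A t x) (precision A D t (linFlow A t y)) := by
  rw [kernelPrecision, mul_apply_eq_comp, mul_apply_eq_comp,
    real_inner_comm, inner_linFlow_star, real_inner_comm]

section

variable [MeasurableSpace E] [BorelSpace E] {A D : E →L[ℝ] E} (h : HypoellipticPair A D) {t : ℝ}
  (ht : 0 < t)

include h ht

theorem kernelPrecision_symm (x y : E) :
    inner ℝ (kernelPrecision A D t x) y = inner ℝ x (kernelPrecision A D t y) := by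
  rw [real_inner_comm, inner_kernelPrecision, inner_kernelPrecision, ← precision_symm h ht,
    real_inner_comm]

theorem quadCoercive_kernelPrecision : QuadCoercive (kernelPrecision A D t) := by
  refine quadCoercive_of_pos fun x hx => ?_
  rw [inner_kernelPrecision]
  refine precision_pos h ht fun h0 => hx ?_
  rw [← linFlowEquiv_apply] at h0
  exact (linFlowEquiv A t).map_eq_zero_iff.1 h0

theorem contDiffAt_kernelPrecision : ContDiffAt ℝ ∞ (kernelPrecision A D) t :=
  (((contDiff_linFlow (star A)).contDiffAt).mul (contDiffAt_precision h ht)).mul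
    (contDiff_linFlow A).contDiffAt

/-- A Riccati equation: in the derivative of S_t⁻¹ the flows combine with the outer ones to make P D
P, and the outer flows contribute the terms A*P and PA. -/
theorem hasDerivAt_kernelPrecision : HasDerivAt (kernelPrecision A D)
    (star A * kernelPrecision A D t + kernelPrecision A D t * A -
      (2 : ℝ) • (kernelPrecision A D t * D * kernelPrecision A D t)) t := by
  refine (((hasDerivAt_linFlow' (star A) t).mul (hasDerivAt_precision h ht)).mul
    (hasDerivAt_linFlow A t)).congr_deriv ?_
  simp only [kernelPrecision, mul_smul_comm, smul_mul_assoc]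
  noncomm_ring

theorem hasDerivAt_log_gaussMass_kernelPrecision :
    HasDerivAt (fun τ => Real.log (gaussMass (kernelPrecision A D τ)))
      (-(clmTrace A - clmTrace (D * kernelPrecision A D t))) t := by
  -- By the Riccati equation and the symmetry of P, the form of P' is ⟪(2A - 2DP)z, P z⟫.
  refine (hasDerivAt_log_gaussMass (T := (2 : ℝ) • A - (2 : ℝ) • (D * kernelPrecision A D t))
    (quadCoercive_kernelPrecision h ht) (kernelPrecision_symm h ht)
    (hasDerivAt_kernelPrecision h ht) fun z => ?_).congr_deriv ?_
  · have e1 : inner ℝ z (star A (kernelPrecision A D t z)) =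
        inner ℝ (A z) (kernelPrecision A D t z) := by
      rw [real_inner_comm, inner_clm_star_left, real_inner_comm]
    have e2 : inner ℝ z (kernelPrecision A D t (A z)) = inner ℝ (A z) (kernelPrecision A D t z) := by
      rw [← kernelPrecision_symm h ht, real_inner_comm]
    have e3 : inner ℝ z (kernelPrecision A D t (D (kernelPrecision A D t z))) =
        inner ℝ (D (kernelPrecision A D t z)) (kernelPrecision A D t z) := by
      rw [← kernelPrecision_symm h ht, real_inner_comm]
    simp only [sub_apply, add_apply,
      smul_apply, mul_apply_eq_comp, inner_sub_right,
      inner_add_right, inner_smul_right, inner_sub_left, real_inner_smul_left, e1, e2, e3]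
    ring
  · rw [map_sub, map_smul, map_smul, smul_eq_mul, smul_eq_mul]
    ring

end

end Gramian

/-! ### The transition kernel and the Fokker–Planck equation for the evolution. -/

section Evolution

variable {E : Type} [NormedAddCommGroup E] [InnerProductSpace ℝ E] [FiniteDimensional ℝ E]
  [CompleteSpace E] [MeasurableSpace E] [BorelSpace E]

/-- The coefficients of the logarithm of the transition kernel, as a function of the initial
point. -/
noncomputable def fpParam (A D : E →L[ℝ] E) (t : ℝ) (x : E) : GaussParam E :=
  GaussParam.mk
    (-Real.log (gaussMass (kernelPrecision A D t)) -
      (1 / 2) * inner ℝ (linFlow A t x) (precision A D t (linFlow A t x)))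
    (precision A D t (linFlow A t x)) (precision A D t)

/-- The Fokker–Planck evolution of the initial datum `g`. -/
noncomputable def fpEvolve {G : Type} [NormedAddCommGroup G] [NormedSpace ℝ G] (A D : E →L[ℝ] E)
    (g : E → G) (t : ℝ) (x : E) : G := gaussIntegral volume g (fpParam A D t x)

/-- The transition kernel. -/
noncomputable def fpKernel (A D : E →L[ℝ] E) (t : ℝ) (x y : E) : ℝ :=
  (gaussMass (kernelPrecision A D t))⁻¹ * gaussWeight (precision A D t) (linFlow A t x - y)

/-- The spatial logarithmic gradient of the transition kernel, up to sign. -/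
noncomputable def fpScore (A D : E →L[ℝ] E) (t : ℝ) (x y : E) : E :=
  linFlow (star A) t (precision A D t (linFlow A t x - y))

variable {A D : E →L[ℝ] E} (h : HypoellipticPair A D) {t : ℝ} (ht : 0 < t)

include h ht

/-- Completing the square: the three coefficients are the expansion of the form at e^{tA}x - y in
powers of y. -/
theorem gaussExponent_fpParam (x y : E) : gaussExponent y (fpParam A D t x) =
    -Real.log (gaussMass (kernelPrecision A D t)) -
      (1 / 2) * inner ℝ (linFlow A t x - y) (precision A D t (linFlow A t x - y)) := by
  rw [fpParam, gaussExponent_mk]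
  simp only [map_sub, inner_sub_left, inner_sub_right]
  rw [← precision_symm h ht (linFlow A t x) y, real_inner_comm y (precision A D t (linFlow A t x))]
  ring

theorem exp_gaussExponent_fpParam (x y : E) :
    Real.exp (gaussExponent y (fpParam A D t x)) = fpKernel A D t x y := by
  rw [gaussExponent_fpParam h ht, fpKernel, gaussWeight, sub_eq_add_neg, Real.exp_add, Real.exp_neg,
    Real.exp_log (gaussMass_pos (quadCoercive_kernelPrecision h ht)), neg_mul]

theorem fpEvolve_eq {G : Type} [NormedAddCommGroup G] [NormedSpace ℝ G] (g : E → G) (x : E) :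
    fpEvolve A D g t x = ∫ y, fpKernel A D t x y • g y := by
  simp_rw [fpEvolve, gaussIntegral, exp_gaussExponent_fpParam h ht]

theorem fpKernel_pos (x y : E) : 0 < fpKernel A D t x y := by
  rw [← exp_gaussExponent_fpParam h ht]; exact Real.exp_pos _

theorem contDiffAt_fpParam (x : E) :
    ContDiffAt ℝ ∞ (fun q : ℝ × E => fpParam A D q.1 q.2) (t, x) := by
  have hM : ContDiffAt ℝ ∞ (fun q : ℝ × E => precision A D q.1) (t, x) :=
    ContDiffAt.comp (t, x) (g := precision A D) (f := Prod.fst) (contDiffAt_precision h ht)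
      contDiffAt_fst
  have hB : ContDiffAt ℝ ∞ (fun q : ℝ × E => linFlow A q.1 q.2) (t, x) :=
    (((contDiff_linFlow A).comp contDiff_fst).clm_apply contDiff_snd).contDiffAt
  have hN : ContDiffAt ℝ ∞ (fun q : ℝ × E => gaussMass (kernelPrecision A D q.1)) (t, x) := by
    refine ContDiffAt.comp (t, x) (g := fun τ => gaussMass (kernelPrecision A D τ)) ?_ contDiffAt_fst
    exact (contDiffOn_gaussMass.contDiffAt (isOpen_quadCoercive.mem_nhds
      (quadCoercive_kernelPrecision h ht))).comp t (contDiffAt_kernelPrecision h ht)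
  have hMB := hM.clm_apply hB
  have ha := (hN.log (gaussMass_pos (quadCoercive_kernelPrecision h ht)).ne').neg.sub
    ((contDiffAt_const (c := (1 / 2 : ℝ))).mul (hB.inner ℝ hMB))
  exact ContDiffAt.prodMk ha (ContDiffAt.prodMk hMB hM)

theorem quadCoercive_fpParam (x : E) : QuadCoercive (fpParam A D t x).2.2 :=
  quadCoercive_precision h ht

theorem contDiffAt_fpEvolve {G : Type} [NormedAddCommGroup G] [NormedSpace ℝ G] {g : E → G}
    (hg : GaussIntegrable g volume) (x : E) :
    ContDiffAt ℝ ∞ (fun q : ℝ × E => fpEvolve A D g q.1 q.2) (t, x) :=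
  ((contDiffOn_gaussIntegral hg).contDiffAt (isOpen_gaussDomain.mem_nhds
    (quadCoercive_fpParam h ht x))).comp (t, x) (contDiffAt_fpParam h ht x)

/-- With σ = -∇ₓ log of the kernel, this is the Fokker–Planck equation divided by the kernel: the
trace terms come from the normalisation, the last two from the motion of e^{tA}x and from the
derivative of S_t⁻¹. -/
theorem hasDerivAt_gaussExponent_fpParam (x y : E) :
    HasDerivAt (fun τ => gaussExponent y (fpParam A D τ x))
      (clmTrace A - clmTrace (D * kernelPrecision A D t) - inner ℝ (fpScore A D t x y) (A x) +
        inner ℝ (fpScore A D t x y) (D (fpScore A D t x y))) t := by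
  have hz : HasDerivAt (fun τ => linFlow A τ x - y) (linFlow A t (A x)) t :=
    (((hasDerivAt_linFlow A t).clm_apply (hasDerivAt_const t x)).sub_const y).congr_deriv
      (by simp)
  have hMz := (hasDerivAt_precision h ht).clm_apply hz
  have hq := (hz.inner ℝ hMz).const_mul (1 / 2)
  have hd := (hasDerivAt_log_gaussMass_kernelPrecision h ht).neg.sub hq
  refine (hd.congr_of_eventuallyEq ?_).congr_deriv ?_
  · filter_upwards [lt_mem_nhds ht] with τ hτ
    rw [gaussExponent_fpParam h hτ]
    rfl
  · simp only [fpScore]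
    set z := linFlow A t x - y
    have e1 : inner ℝ (linFlow (star A) t (precision A D t z)) (A x) =
        inner ℝ (linFlow A t (A x)) (precision A D t z) := by
      rw [inner_linFlow_star, real_inner_comm]
    have e2 : inner ℝ z (precision A D t (linFlow A t (A x))) =
        inner ℝ (linFlow A t (A x)) (precision A D t z) := by
      rw [← precision_symm h ht, real_inner_comm]
    have e3 : inner ℝ z (precision A D t (linFlow A t (D (linFlow (star A) t (precision A D t z))))) =
        inner ℝ (linFlow (star A) t (precision A D t z))
          (D (linFlow (star A) t (precision A D t z))) := by
      rw [← precision_symm h ht, inner_linFlow_star]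
    simp only [inner_add_right, neg_apply, mul_apply_eq_comp, smul_apply, map_smul,
      inner_neg_right, inner_smul_right, e1, e2, e3]
    ring

theorem hasFDerivAt_gaussExponent_fpParam (x y : E) :
    HasFDerivAt (fun x => gaussExponent y (fpParam A D t x)) (-innerSL ℝ (fpScore A D t x y)) x := by
  have hz : HasFDerivAt (fun x => linFlow A t x - y) (linFlow A t) x :=
    (linFlow A t).hasFDerivAt.sub_const y
  have hq := ((hz.inner ℝ ((precision A D t).hasFDerivAt.comp x hz)).const_mul (1 / 2)).const_sub
    (-Real.log (gaussMass (kernelPrecision A D t)))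
  refine (hq.congr_of_eventuallyEq ?_).congr_fderiv (ContinuousLinearMap.ext fun v => ?_)
  · filter_upwards with x
    rw [gaussExponent_fpParam h ht]
    rfl
  · change -((1 / 2) * (inner ℝ (linFlow A t x - y) (precision A D t (linFlow A t v)) +
      inner ℝ (linFlow A t v) (precision A D t (linFlow A t x - y)))) =
      -inner ℝ (fpScore A D t x y) v
    rw [← precision_symm h ht, fpScore, inner_linFlow_star,
      real_inner_comm (precision A D t (linFlow A t x - y))]
    ring

theorem hasDerivAt_fpEvolve {G : Type} [NormedAddCommGroup G] [NormedSpace ℝ G] {g : E → G}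
    (hg : GaussIntegrable g volume) (x : E) :
    HasDerivAt (fun τ => fpEvolve A D g τ x)
      (∫ y, fpKernel A D t x y •
        (clmTrace A - clmTrace (D * kernelPrecision A D t) - inner ℝ (fpScore A D t x y) (A x) +
          inner ℝ (fpScore A D t x y) (D (fpScore A D t x y))) • g y) t := by
  have hp : DifferentiableAt ℝ (fun τ => fpParam A D τ x) t :=
    DifferentiableAt.comp t (g := fun q : ℝ × E => fpParam A D q.1 q.2) (f := fun τ => (τ, x))
      ((contDiffAt_fpParam h ht x).differentiableAt (by simp))
      (differentiableAt_id.prodMk (differentiableAt_const x))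
  have h1 := (hasFDerivAt_gaussIntegral hg (quadCoercive_fpParam h ht x)).comp_hasDerivAt t
    hp.hasDerivAt
  refine h1.congr_deriv ?_
  rw [gaussIntegral_smulRight_apply hg (quadCoercive_fpParam h ht x)]
  refine integral_congr_ae (ae_of_all _ fun y => ?_)
  have h2 := ((gaussExponent y).hasFDerivAt.comp_hasDerivAt t hp.hasDerivAt).unique
    (hasDerivAt_gaussExponent_fpParam h ht x y)
  simp only [exp_gaussExponent_fpParam h ht, h2]

theorem continuous_fpScore (x : E) : Continuous (fpScore A D t x) := by
  unfold fpScore; fun_prop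

theorem norm_fpScore_le (x : E) : ∃ C, ∀ y, ‖fpScore A D t x y‖ ≤ C * (1 + ‖y‖ ^ 2) := by
  refine ⟨‖linFlow (star A) t * precision A D t‖ * (‖linFlow A t x‖ + 1), fun y => ?_⟩
  have h1 : ‖fpScore A D t x y‖ ≤ ‖linFlow (star A) t * precision A D t‖ * ‖linFlow A t x - y‖ :=
    (linFlow (star A) t * precision A D t).le_opNorm _
  refine h1.trans ?_
  rw [mul_assoc]
  gcongr
  refine (norm_sub_le _ _).trans ?_
  nlinarith [norm_nonneg (linFlow A t x), sq_nonneg (‖y‖ - 1), sq_nonneg ‖y‖,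
    mul_nonneg (norm_nonneg (linFlow A t x)) (sq_nonneg ‖y‖)]

theorem gaussIntegrable_score_smulRight {G : Type} [NormedAddCommGroup G] [NormedSpace ℝ G]
    {g : E → G} (hg : GaussIntegrable g volume) (x : E) :
    GaussIntegrable (fun y => (-innerSL ℝ (fpScore A D t x y)).smulRight (g y)) volume := by
  obtain ⟨C, hC⟩ := norm_fpScore_le h ht x
  refine hg.of_le (C := C) ?_ fun y => ?_
  · refine aestronglyMeasurable_smulRight ?_ hg.meas
    exact (by have := continuous_fpScore h ht x; fun_prop :
      Continuous fun y => -innerSL ℝ (fpScore A D t x y)).aestronglyMeasurable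
  · rw [ContinuousLinearMap.norm_smulRight_apply, norm_neg, innerSL_apply_norm]
    gcongr
    exact hC y

theorem GaussIntegrable.integrable_fpKernel {G : Type} [NormedAddCommGroup G] [NormedSpace ℝ G]
    {g : E → G} (hg : GaussIntegrable g volume) (x : E) :
    Integrable (fun y => fpKernel A D t x y • g y) := by
  simp_rw [← exp_gaussExponent_fpParam h ht]
  exact hg.integrable (quadCoercive_fpParam h ht x)

theorem hasFDerivAt_fpEvolve {G : Type} [NormedAddCommGroup G] [NormedSpace ℝ G] {g : E → G}
    (hg : GaussIntegrable g volume) (x : E) :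
    HasFDerivAt (fpEvolve A D g t)
      (∫ y, fpKernel A D t x y • (-innerSL ℝ (fpScore A D t x y)).smulRight (g y)) x := by
  have hp : DifferentiableAt ℝ (fun x => fpParam A D t x) x :=
    DifferentiableAt.comp x (g := fun q : ℝ × E => fpParam A D q.1 q.2) (f := fun x => (t, x))
      ((contDiffAt_fpParam h ht x).differentiableAt (by simp))
      ((differentiableAt_const t).prodMk differentiableAt_id)
  have h1 := (hasFDerivAt_gaussIntegral hg (quadCoercive_fpParam h ht x)).comp x hp.hasFDerivAt
  refine h1.congr_fderiv (ContinuousLinearMap.ext fun e => ?_)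
  rw [ContinuousLinearMap.comp_apply,
    gaussIntegral_smulRight_apply hg (quadCoercive_fpParam h ht x),
    ContinuousLinearMap.integral_apply
      ((gaussIntegrable_score_smulRight h ht hg x).integrable_fpKernel h ht x)]
  refine integral_congr_ae (ae_of_all _ fun y => ?_)
  have h2 := ((gaussExponent y).hasFDerivAt.comp x hp.hasFDerivAt).unique
    (hasFDerivAt_gaussExponent_fpParam h ht x y)
  have h3 := congrArg (fun L : E →L[ℝ] ℝ => L e) h2
  simp only [ContinuousLinearMap.comp_apply] at h3
  simp only [exp_gaussExponent_fpParam h ht, h3]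
  rfl

variable {g : E → ℝ} (hg : GaussIntegrable g volume)

include hg

theorem gaussIntegrable_smul_id : GaussIntegrable (fun y => g y • y) volume := by
  refine hg.of_le (C := 1) (hg.meas.smul aestronglyMeasurable_id) fun y => ?_
  rw [norm_smul, one_mul, mul_comm]
  gcongr
  nlinarith [sq_nonneg (‖y‖ - 1), sq_nonneg ‖y‖]

/-- The logarithmic gradient of the kernel is affine in y, so the gradient of the evolution combines
the evolutions of g(y) and of g(y)y. A second spatial derivative then needs only
`hasFDerivAt_fpEvolve` again. -/
theorem gradient_fpEvolve (x : E) : gradient (fpEvolve A D g t) x =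
    linFlow (star A) t (precision A D t (fpEvolve A D (fun y => g y • y) t x)) -
      fpEvolve A D g t x • kernelPrecision A D t x := by
  refine HasGradientAt.gradient ?_
  rw [hasGradientAt_iff_hasFDerivAt]
  refine (hasFDerivAt_fpEvolve h ht hg x).congr_fderiv (ContinuousLinearMap.ext fun e => ?_)
  have hg1 := gaussIntegrable_smul_id h ht hg
  rw [ContinuousLinearMap.integral_apply
      ((gaussIntegrable_score_smulRight h ht hg x).integrable_fpKernel h ht x),
    InnerProductSpace.toDual_apply_apply, fpEvolve_eq h ht, fpEvolve_eq h ht]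
  have i1 := (linFlow (star A) t * precision A D t).integrable_comp (hg1.integrable_fpKernel h ht x)
  have i2 := (hg.integrable_fpKernel h ht x).smul_const (kernelPrecision A D t x)
  have e1 := (linFlow (star A) t * precision A D t).integral_comp_comm
    (hg1.integrable_fpKernel h ht x)
  rw [mul_apply_eq_comp] at e1
  rw [← e1, ← integral_smul_const, ← integral_sub i1 i2, real_inner_comm]
  refine Eq.trans ?_ ((innerSL ℝ e).integral_comp_comm (i1.sub i2))
  refine integral_congr_ae (ae_of_all _ fun y => ?_)
  have e2 : fpScore A D t x y =
      kernelPrecision A D t x - linFlow (star A) t (precision A D t y) := by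
    simp only [fpScore, kernelPrecision, map_sub, mul_apply_eq_comp]
  simp only [smul_apply, ContinuousLinearMap.smulRight_apply, neg_apply, innerSL_apply_apply,
    map_smul, mul_apply_eq_comp, smul_eq_mul, inner_sub_right, inner_smul_right, e2,
    inner_sub_left]
  rw [real_inner_comm e, real_inner_comm e]
  ring

/-- The evolution solves the Fokker–Planck equation in divergence form. -/
theorem fokkerPlanck_fpEvolve (x : E) : HasDerivAt (fun τ => fpEvolve A D g τ x)
    (clmTrace (fderiv ℝ (fun z => fpEvolve A D g t z • A z +
      D (gradient (fpEvolve A D g t) z)) x)) t := by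
  refine (hasDerivAt_fpEvolve h ht hg x).congr_deriv ?_
  have hg1 := gaussIntegrable_smul_id h ht hg
  set L : E →L[ℝ] E := D * linFlow (star A) t * precision A D t with hL
  set P := kernelPrecision A D t with hP
  -- The flux is rewritten without any gradient, as a linear expression in two evolutions.
  have hflux : (fun z => fpEvolve A D g t z • A z + D (gradient (fpEvolve A D g t) z)) =
      fun z => fpEvolve A D g t z • (A - D * P) z + L (fpEvolve A D (fun y => g y • y) t z) := by
    funext z
    rw [gradient_fpEvolve h ht hg, map_sub, map_smul]
    simp only [hL, sub_apply, mul_apply_eq_comp, smul_sub]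
    abel
  have hd := ((hasFDerivAt_fpEvolve h ht hg x).smul ((A - D * P).hasFDerivAt (x := x))).add
    (L.hasFDerivAt.comp x (hasFDerivAt_fpEvolve h ht hg1 x))
  have hfd : fderiv ℝ (fun z => fpEvolve A D g t z • (A - D * P) z +
      L (fpEvolve A D (fun y => g y • y) t z)) x = _ := hd.fderiv
  rw [hflux, hfd, map_add, map_add, map_smul, clmTrace_smulRight]
  have j0 := (gaussIntegrable_score_smulRight h ht hg x).integrable_fpKernel h ht x
  have j1 := (gaussIntegrable_score_smulRight h ht hg1 x).integrable_fpKernel h ht x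
  have e2 := (clmTrace.comp (ContinuousLinearMap.compL ℝ E E E L)).integral_comp_comm j1
  rw [ContinuousLinearMap.comp_apply, ContinuousLinearMap.compL_apply] at e2
  have i2 := (clmTrace.comp (ContinuousLinearMap.compL ℝ E E E L)).integrable_comp j1
  rw [← e2, ContinuousLinearMap.integral_apply j0, fpEvolve_eq h ht, smul_eq_mul,
    ← integral_mul_const]
  have i0 := (hg.integrable_fpKernel h ht x).mul_const (clmTrace (A - D * P))
  have i1 := j0.apply_continuousLinearMap ((A - D * P) x)
  rw [← integral_add i0 i1]
  refine Eq.trans ?_ (integral_add (i0.add i1) i2)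
  refine integral_congr_ae (ae_of_all _ fun y => ?_)
  have e3 : L ∘SL (-innerSL ℝ (fpScore A D t x y)).smulRight (g y • y) =
      (-innerSL ℝ (fpScore A D t x y)).smulRight (L (g y • y)) := by
    ext v; simp
  -- This identity matches the divergence of the flux with the time derivative under the integral.
  have e4 : D (fpScore A D t x y) = (D * P) x - L y := by
    simp only [hL, hP, fpScore, kernelPrecision, mul_apply_eq_comp, map_sub]
  simp only [ContinuousLinearMap.comp_apply, ContinuousLinearMap.compL_apply,
    map_smul, smul_apply, ContinuousLinearMap.smulRight_apply,
    e3, clmTrace_smulRight, neg_apply, innerSL_apply_apply, smul_eq_mul, e4, sub_apply,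
    inner_sub_right, map_sub]
  ring

end Evolution

/-- Scheffé's lemma. -/
theorem tendsto_integral_abs_sub_of_tendsto_integral {X ι : Type*} [MeasurableSpace X]
    {μ : Measure X} {l : Filter ι} [l.IsCountablyGenerated] {u : ι → X → ℝ} {v : X → ℝ}
    (hu : ∀ᶠ i in l, Integrable (u i) μ) (hv : Integrable v μ) (hpos : ∀ᶠ i in l, 0 ≤ᵐ[μ] u i)
    (hlim : ∀ᵐ x ∂μ, Tendsto (fun i => u i x) l (𝓝 (v x)))
    (hint : Tendsto (fun i => ∫ x, u i x ∂μ) l (𝓝 (∫ x, v x ∂μ))) :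
    Tendsto (fun i => ∫ x, |u i x - v x| ∂μ) l (𝓝 0) := by
  -- Since u ≥ 0, the positive part of v - u is dominated by |v|. The conclusion then follows from
  -- |u - v| = (u - v) + 2(v - u)⁺.
  have h1 : Tendsto (fun i => ∫ x, max (v x - u i x) 0 ∂μ) l (𝓝 (∫ _, (0 : ℝ) ∂μ)) := by
    refine tendsto_integral_filter_of_dominated_convergence (fun x => |v x|) ?_ ?_ hv.abs ?_
    · filter_upwards [hu] with i hi using ((hv.sub hi).1.sup aestronglyMeasurable_const)
    · filter_upwards [hpos] with i hi
      filter_upwards [hi] with x hx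
      rw [Real.norm_eq_abs, abs_of_nonneg (le_max_right _ _)]
      exact max_le (by simp only [Pi.zero_apply] at hx; linarith [le_abs_self (v x)]) (abs_nonneg _)
    · filter_upwards [hlim] with x hx
      have := (tendsto_const_nhds (x := v x)).sub hx |>.max (tendsto_const_nhds (x := (0 : ℝ)))
      simpa using this
  have h2 := (hint.sub_const (∫ x, v x ∂μ)).add (h1.const_mul 2)
  simp only [integral_zero, sub_self, mul_zero, add_zero] at h2
  refine h2.congr' ?_
  filter_upwards [hu] with i hi
  have a1 : Integrable (fun x => u i x - v x) μ := hi.sub hv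
  have a2 : Integrable (fun x => 2 * max (v x - u i x) 0) μ :=
    ((hv.sub hi).sup (integrable_zero X ℝ μ)).const_mul 2
  rw [← integral_sub hi hv, ← integral_const_mul, ← integral_add a1 a2]
  refine integral_congr_ae (ae_of_all _ fun x => ?_)
  rcases le_total (v x) (u i x) with hx | hx
  · simp only [max_eq_right (sub_nonpos.2 hx), abs_of_nonneg (sub_nonneg.2 hx)]; ring
  · simp only [max_eq_left (sub_nonneg.2 hx), abs_of_nonpos (sub_nonpos.2 hx)]; ring

/-! ### Approximation by continuous functions and quadratic moduli of continuity. -/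

section Approximation

variable {E : Type} [NormedAddCommGroup E] [InnerProductSpace ℝ E] [FiniteDimensional ℝ E]
  [MeasurableSpace E] [BorelSpace E]

/-- Taking positive parts is 1-Lipschitz and does not change g almost everywhere. The sign of φ is
needed for Scheffé's lemma. -/
theorem exists_nonneg_continuous_integral_sub_le {g : E → ℝ} (hg : Integrable g)
    (hpos : 0 ≤ᵐ[volume] g) {ε : ℝ} (hε : 0 < ε) : ∃ φ : E → ℝ, Continuous φ ∧ (∀ x, 0 ≤ φ x) ∧
      HasCompactSupport φ ∧ Integrable φ ∧ ∫ x, |g x - φ x| ≤ ε := by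
  obtain ⟨φ, hs, hle, hc, hi⟩ := hg.exists_hasCompactSupport_integral_sub_le hε
  have hi' : Integrable (fun x => max (φ x) 0) := hi.sup (integrable_zero E ℝ _)
  refine ⟨fun x => max (φ x) 0, hc.max continuous_const, fun x => le_max_right _ _,
    hs.comp_left (g := fun r => max r 0) (by simp), hi', le_trans ?_ hle⟩
  refine integral_mono_ae (hg.sub hi').abs (hg.sub hi).norm ?_
  filter_upwards [hpos] with x hx
  simp only [Pi.zero_apply] at hx
  have h1 : |max (g x) 0 - max (φ x) 0| ≤ |g x - φ x| := abs_max_sub_max_le_abs _ _ _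
  rw [max_eq_left hx] at h1
  exact h1

/-- Continuity handles y near x, boundedness the rest. The quadratic form of the bound lets it be
integrated against a Gaussian through its second moment. -/
theorem exists_quadratic_modulus {φ : E → ℝ} (hc : Continuous φ) (hs : HasCompactSupport φ) (x : E)
    {ε : ℝ} (hε : 0 < ε) : ∃ C, 0 ≤ C ∧ ∀ y, |φ y - φ x| ≤ ε + C * ‖y - x‖ ^ 2 := by
  obtain ⟨K, hK⟩ := hs.exists_bound_of_continuous hc
  obtain ⟨δ, hδ, h⟩ := Metric.continuous_iff.1 hc x ε hε
  have hK0 : 0 ≤ K := (norm_nonneg _).trans (hK x)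
  refine ⟨2 * K / δ ^ 2, by positivity, fun y => ?_⟩
  rcases lt_or_ge (dist y x) δ with hy | hy
  · have := (h y hy).le
    rw [Real.dist_eq] at this
    have h2 : 0 ≤ 2 * K / δ ^ 2 * ‖y - x‖ ^ 2 := by positivity
    linarith
  · rw [dist_eq_norm] at hy
    have h1 : |φ y - φ x| ≤ 2 * K := by
      refine (abs_sub _ _).trans ?_
      have h1 := hK x; have h2 := hK y
      simp only [Real.norm_eq_abs] at h1 h2
      linarith
    have h2 : 2 * K ≤ 2 * K / δ ^ 2 * ‖y - x‖ ^ 2 := by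
      rw [div_mul_eq_mul_div, le_div_iff₀ (by positivity)]
      gcongr
    linarith

end Approximation

/-! ### The kernel as a probability density in x: mass, mean and L¹-contraction. -/

section Mass

variable {E : Type} [NormedAddCommGroup E] [InnerProductSpace ℝ E] [FiniteDimensional ℝ E]
  [CompleteSpace E] [MeasurableSpace E] [BorelSpace E]

/-- Seen from x, the kernel is a normalised Gaussian centred at e^{-tA}y; the integrals over x are
read off from this form. -/
theorem fpKernel_eq (A D : E →L[ℝ] E) (t : ℝ) (x y : E) : fpKernel A D t x y =
    (gaussMass (kernelPrecision A D t))⁻¹ *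
      gaussWeight (kernelPrecision A D t) (x - linFlow A (-t) y) := by
  have e : linFlow A t (x - linFlow A (-t) y) = linFlow A t x - y := by
    rw [map_sub, ← mul_apply_eq_comp, linFlow_mul_neg]
    rfl
  rw [fpKernel, gaussWeight, gaussWeight, inner_kernelPrecision, e]

theorem continuous_fpKernel (A D : E →L[ℝ] E) (t : ℝ) :
    Continuous fun p : E × E => fpKernel A D t p.2 p.1 := by
  have := continuous_gaussWeight (precision A D t)
  unfold fpKernel; fun_prop

variable {A D : E →L[ℝ] E} (h : HypoellipticPair A D) {t : ℝ} (ht : 0 < t)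

include h ht

theorem integrable_fpKernel_left (y : E) : Integrable (fun x => fpKernel A D t x y) := by
  simp_rw [fpKernel_eq]
  exact ((integrable_gaussWeight (quadCoercive_kernelPrecision h ht)).comp_sub_right _).const_mul _

theorem integral_fpKernel_left (y : E) : ∫ x, fpKernel A D t x y = 1 := by
  simp_rw [fpKernel_eq]
  rw [integral_const_mul, integral_sub_right_eq_self (gaussWeight (kernelPrecision A D t))]
  exact inv_mul_cancel₀ (gaussMass_pos (quadCoercive_kernelPrecision h ht)).ne'

theorem integrable_gaussWeight_smul_id {P : E →L[ℝ] E} (hP : QuadCoercive P) :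
    Integrable (fun z : E => gaussWeight P z • z) :=
  integrable_gaussWeight_smul (GaussIntegrable.of_bound (C := 1) aestronglyMeasurable_id
    fun y => by simp only [id]; nlinarith [sq_nonneg (‖y‖ - 1), sq_nonneg ‖y‖]) hP

theorem integrable_fpKernel_smul_left (y : E) : Integrable (fun x => fpKernel A D t x y • x) := by
  have h1 := ((integrable_gaussWeight_smul_id h ht (quadCoercive_kernelPrecision h ht)).comp_sub_right
    (linFlow A (-t) y)).smul (gaussMass (kernelPrecision A D t))⁻¹
  refine (h1.add ((integrable_fpKernel_left h ht y).smul_const (linFlow A (-t) y))).congr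
    (ae_of_all _ fun x => ?_)
  simp only [Pi.add_apply, Pi.smul_apply, fpKernel_eq, smul_smul, ← smul_add, sub_add_cancel]

theorem integral_fpKernel_smul_left (y : E) :
    ∫ x, fpKernel A D t x y • x = linFlow A (-t) y := by
  have hi := integrable_gaussWeight_smul_id h ht (quadCoercive_kernelPrecision h ht)
  have h1 : Integrable (fun x => (gaussMass (kernelPrecision A D t))⁻¹ •
      (gaussWeight (kernelPrecision A D t) (x - linFlow A (-t) y) • (x - linFlow A (-t) y))) :=
    (hi.comp_sub_right (linFlow A (-t) y)).smul (gaussMass (kernelPrecision A D t))⁻¹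
  -- The integrand is odd.
  have h0 : ∫ z, gaussWeight (kernelPrecision A D t) z • z = 0 := by
    have h2 := integral_neg_eq_self (fun z => gaussWeight (kernelPrecision A D t) z • z) volume
    have h3 (z : E) : gaussWeight (kernelPrecision A D t) (-z) • -z =
        -(gaussWeight (kernelPrecision A D t) z • z) := by simp [gaussWeight]
    simp_rw [h3, integral_neg] at h2
    refine (smul_eq_zero.1 ?_).resolve_left (two_ne_zero (α := ℝ))
    rw [two_smul]
    nth_rewrite 1 [← h2]
    exact neg_add_cancel _
  calc _ = ∫ x, ((gaussMass (kernelPrecision A D t))⁻¹ •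
          (gaussWeight (kernelPrecision A D t) (x - linFlow A (-t) y) • (x - linFlow A (-t) y)) +
        fpKernel A D t x y • linFlow A (-t) y) := by
        refine integral_congr_ae (ae_of_all _ fun x => ?_)
        simp only [fpKernel_eq, smul_smul, ← smul_add, sub_add_cancel]
    _ = linFlow A (-t) y := by
        rw [integral_add h1 ((integrable_fpKernel_left h ht y).smul_const _), integral_smul,
          integral_sub_right_eq_self (fun z => gaussWeight (kernelPrecision A D t) z • z), h0,
          integral_smul_const, integral_fpKernel_left h ht]
        simp

/-- The bound is affine in ‖y‖, so a finite first moment of g suffices for Fubini in the computation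
of the mean. -/
theorem integral_norm_fpKernel_smul_left_le : ∃ C, ∀ y,
    ∫ x, ‖fpKernel A D t x y • x‖ ≤ C + ‖linFlow A (-t)‖ * ‖y‖ := by
  have hi := (integrable_gaussWeight_smul_id h ht (quadCoercive_kernelPrecision h ht)).norm
  have hN := gaussMass_pos (quadCoercive_kernelPrecision h ht)
  refine ⟨(gaussMass (kernelPrecision A D t))⁻¹ *
    ∫ z, ‖gaussWeight (kernelPrecision A D t) z • z‖, fun y => ?_⟩
  have h1 := (hi.comp_sub_right (linFlow A (-t) y)).const_mul (gaussMass (kernelPrecision A D t))⁻¹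
  have h2 := (integrable_fpKernel_left h ht y).mul_const ‖linFlow A (-t) y‖
  calc _ ≤ ∫ x, ((gaussMass (kernelPrecision A D t))⁻¹ *
          ‖gaussWeight (kernelPrecision A D t) (x - linFlow A (-t) y) • (x - linFlow A (-t) y)‖ +
        fpKernel A D t x y * ‖linFlow A (-t) y‖) := by
        refine integral_mono (integrable_fpKernel_smul_left h ht y).norm (h1.add h2) fun x => ?_
        simp only
        rw [norm_smul, norm_smul, Real.norm_eq_abs, Real.norm_eq_abs,
          abs_of_pos (fpKernel_pos h ht x y), abs_of_pos (gaussWeight_pos _ _), ← mul_assoc,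
          ← fpKernel_eq, ← mul_add]
        refine mul_le_mul_of_nonneg_left ?_ (fpKernel_pos h ht x y).le
        simpa using norm_add_le (x - linFlow A (-t) y) (linFlow A (-t) y)
    _ ≤ _ := by
        rw [integral_add h1 h2, integral_const_mul, integral_mul_const,
          integral_sub_right_eq_self (fun z => ‖gaussWeight (kernelPrecision A D t) z • z‖),
          integral_fpKernel_left h ht, one_mul]
        gcongr
        exact (linFlow A (-t)).le_opNorm y

variable {g : E → ℝ} (hg : Integrable g)

include hg

theorem integrable_prod_fpKernel :
    Integrable (fun p : E × E => fpKernel A D t p.2 p.1 * g p.1) (volume.prod volume) := by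
  have hm : AEStronglyMeasurable (fun p : E × E => fpKernel A D t p.2 p.1 * g p.1)
      (volume.prod volume) :=
    (continuous_fpKernel A D t).aestronglyMeasurable.mul hg.1.comp_fst
  refine (integrable_prod_iff hm).2 ⟨ae_of_all _ fun y =>
    (integrable_fpKernel_left h ht y).mul_const (g y), hg.norm.congr (ae_of_all _ fun y => ?_)⟩
  simp only [norm_mul, Real.norm_eq_abs, abs_of_pos (fpKernel_pos h ht _ _)]
  rw [integral_mul_const, integral_fpKernel_left h ht, one_mul]

theorem fpEvolve_eq_mul (x : E) : fpEvolve A D g t x = ∫ y, fpKernel A D t x y * g y :=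
  fpEvolve_eq h ht g x

theorem integrable_fpEvolve : Integrable (fpEvolve A D g t) := by
  refine (integrable_prod_fpKernel h ht hg).integral_prod_right.congr (ae_of_all _ fun x => ?_)
  exact (fpEvolve_eq_mul h ht hg x).symm

theorem integral_fpEvolve : ∫ x, fpEvolve A D g t x = ∫ x, g x := by
  simp_rw [fpEvolve_eq_mul h ht hg]
  rw [← integral_integral_swap (f := fun y x => fpKernel A D t x y * g y)
    (integrable_prod_fpKernel h ht hg)]
  simp_rw [integral_mul_const, integral_fpKernel_left h ht, one_mul]

/-- The kernel is positive and preserves mass, hence contracts L¹. -/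
theorem integral_abs_fpEvolve_le : ∫ x, |fpEvolve A D g t x| ≤ ∫ x, |g x| := by
  rw [← integral_fpEvolve h ht hg.abs]
  refine integral_mono (integrable_fpEvolve h ht hg).abs (integrable_fpEvolve h ht hg.abs) fun x => ?_
  simp only
  rw [fpEvolve_eq_mul h ht hg, fpEvolve_eq_mul h ht hg.abs]
  refine abs_integral_le_integral_abs.trans_eq (integral_congr_ae (ae_of_all _ fun y => ?_))
  simp only [abs_mul, abs_of_pos (fpKernel_pos h ht _ _)]

omit hg in
theorem fpEvolve_nonneg (hpos : 0 ≤ᵐ[volume] g) (x : E) : 0 ≤ fpEvolve A D g t x := by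
  rw [fpEvolve_eq h ht]
  refine integral_nonneg_of_ae ?_
  filter_upwards [hpos] with y hy
  exact mul_nonneg (fpKernel_pos h ht x y).le hy

variable (hg1 : Integrable (fun y => g y • y))

include hg1

theorem integrable_prod_fpKernel_smul :
    Integrable (fun p : E × E => (fpKernel A D t p.2 p.1 * g p.1) • p.2) (volume.prod volume) := by
  have hm : AEStronglyMeasurable (fun p : E × E => (fpKernel A D t p.2 p.1 * g p.1) • p.2)
      (volume.prod volume) :=
    ((continuous_fpKernel A D t).aestronglyMeasurable.mul hg.1.comp_fst).smul
      continuous_snd.aestronglyMeasurable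
  obtain ⟨C, hC⟩ := integral_norm_fpKernel_smul_left_le h ht
  refine (integrable_prod_iff hm).2 ⟨ae_of_all _ fun y => ?_, ?_⟩
  · refine ((integrable_fpKernel_smul_left h ht y).smul (g y)).congr (ae_of_all _ fun x => ?_)
    simp only [Pi.smul_apply, smul_smul, mul_comm]
  · refine ((hg.norm.const_mul C).add (hg1.norm.const_mul ‖linFlow A (-t)‖)).mono'
      hm.norm.integral_prod_right' (ae_of_all _ fun y => ?_)
    rw [Real.norm_eq_abs, abs_of_nonneg (integral_nonneg fun x => norm_nonneg _)]
    have e (x : E) : ‖(fpKernel A D t x y * g y) • x‖ = ‖g y‖ * ‖fpKernel A D t x y • x‖ := by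
      rw [mul_comm, mul_smul, norm_smul]
    simp only [e, Pi.add_apply]
    rw [integral_const_mul, norm_smul]
    calc _ ≤ ‖g y‖ * (C + ‖linFlow A (-t)‖ * ‖y‖) := by gcongr; exact hC y
      _ = _ := by ring

theorem integrable_fpEvolve_smul : Integrable (fun x => fpEvolve A D g t x • x) := by
  refine (integrable_prod_fpKernel_smul h ht hg hg1).integral_prod_right.congr
    (ae_of_all _ fun x => ?_)
  simp only [fpEvolve_eq_mul h ht hg]
  rw [integral_smul_const]

theorem integral_fpEvolve_smul :
    ∫ x, fpEvolve A D g t x • x = linFlow A (-t) (∫ x, g x • x) := by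
  simp_rw [fpEvolve_eq_mul h ht hg, ← integral_smul_const]
  rw [← integral_integral_swap (f := fun y x => (fpKernel A D t x y * g y) • x)
    (integrable_prod_fpKernel_smul h ht hg hg1), ← ContinuousLinearMap.integral_comp_comm _ hg1]
  refine integral_congr_ae (ae_of_all _ fun y => ?_)
  simp_rw [mul_comm _ (g y), mul_smul]
  rw [integral_smul, integral_fpKernel_smul_left h ht, map_smul]

end Mass

theorem integral_add_add {X : Type*} [MeasurableSpace X] {μ : Measure X} {a b c : X → ℝ}
    (ha : Integrable a μ) (hb : Integrable b μ) (hc : Integrable c μ) :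
    ∫ x, (a x + b x + c x) ∂μ = (∫ x, a x ∂μ) + (∫ x, b x ∂μ) + ∫ x, c x ∂μ := by
  rw [← integral_add ha hb]
  exact integral_add (ha.add hb) hc

/-! ### L¹-continuity of the evolution in time, up to t = 0. -/

section Continuity

variable {E : Type} [NormedAddCommGroup E] [InnerProductSpace ℝ E] [FiniteDimensional ℝ E]
  [CompleteSpace E] [MeasurableSpace E] [BorelSpace E]

variable {A D : E →L[ℝ] E} (h : HypoellipticPair A D) {g : E → ℝ}

include h

/-- Scheffé's lemma: the evolution is nonnegative, continuous in time at each point, and of constant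
mass. -/
theorem tendsto_fpEvolve_of_pos (hg : Integrable g) (hpos : 0 ≤ᵐ[volume] g) {t₀ : ℝ} (ht : 0 < t₀) :
    Tendsto (fun t => ∫ x, |fpEvolve A D g t x - fpEvolve A D g t₀ x|) (𝓝 t₀) (𝓝 0) := by
  refine tendsto_integral_abs_sub_of_tendsto_integral ?_ (integrable_fpEvolve h ht hg) ?_
    (ae_of_all _ fun x => ?_) ?_
  · filter_upwards [lt_mem_nhds ht] with t ht using integrable_fpEvolve h ht hg
  · filter_upwards [lt_mem_nhds ht] with t ht using ae_of_all _ fun x => fpEvolve_nonneg h ht hpos x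
  · exact (hasDerivAt_fpEvolve h ht (.of_integrable hg) x).continuousAt
  · rw [integral_fpEvolve h ht hg]
    refine tendsto_const_nhds.congr' ?_
    filter_upwards [lt_mem_nhds ht] with t ht using (integral_fpEvolve h ht hg).symm

/-- The kernel is normalised in x; its integral over y is |det e^{tA}| instead of 1, because the
drift does not preserve volume. -/
theorem gaussMass_precision {t : ℝ} (ht : 0 < t) :
    (gaussMass (kernelPrecision A D t))⁻¹ * gaussMass (precision A D t) = |(linFlow A t).det| := by
  have h1 := gaussMass_conj (linFlowEquiv A t) (precision A D t) (kernelPrecision A D t)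
    fun z => inner_kernelPrecision A D t z z
  rw [linFlowEquiv_coe] at h1
  rw [h1, mul_inv, inv_inv, mul_assoc,
    inv_mul_cancel₀ (gaussMass_pos (quadCoercive_precision h ht)).ne', mul_one]

theorem fpEvolve_eq_integral_sub {t : ℝ} (ht : 0 < t) (x : E) : fpEvolve A D g t x =
    (gaussMass (kernelPrecision A D t))⁻¹ *
      ∫ z, gaussWeight (precision A D t) z * g (linFlow A t x - z) := by
  rw [fpEvolve_eq h ht, ← integral_const_mul, ← integral_sub_left_eq_self _ volume (linFlow A t x)]
  refine integral_congr_ae (ae_of_all _ fun z => ?_)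
  simp only [fpKernel, sub_sub_cancel, smul_eq_mul, mul_assoc]

/-- Integrate the quadratic modulus of g at x against the Gaussian centred at e^{tA}x with
covariance S_t: the second moment gives tr S_t, which tends to 0 with t. -/
theorem abs_fpEvolve_sub_le (hc : Continuous g) (hs : HasCompactSupport g) {t : ℝ} (ht : 0 < t)
    {x : E} {ε C : ℝ} (hC0 : 0 ≤ C)
    (hC : ∀ y, |g y - g x| ≤ ε + C * ‖y - x‖ ^ 2) :
    |fpEvolve A D g t x - |(linFlow A t).det| * g x| ≤ |(linFlow A t).det| *
      (ε + 2 * C * ‖linFlow A t x - x‖ ^ 2 + 2 * C * clmTrace (gramian A D t)) := by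
  have hco := quadCoercive_precision h ht
  have hN := gaussMass_pos (quadCoercive_kernelPrecision h ht)
  have i0 := integrable_gaussWeight hco
  obtain ⟨K, hK⟩ := hs.exists_bound_of_continuous hc
  have i1 : Integrable (fun z => gaussWeight (precision A D t) z * g (linFlow A t x - z)) := by
    refine integrable_gaussWeight_smul (GaussIntegrable.of_bound (C := K)
      (by fun_prop : Continuous fun z => g (linFlow A t x - z)).aestronglyMeasurable fun y => ?_) hco
    refine (hK _).trans ?_
    nlinarith [(norm_nonneg _).trans (hK 0), mul_nonneg ((norm_nonneg _).trans (hK 0)) (sq_nonneg ‖y‖)]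
  have i2 : Integrable (fun z => gaussWeight (precision A D t) z * ‖z‖ ^ 2) :=
    integrable_gaussWeight_smul (GaussIntegrable.of_bound (C := 1)
      (by fun_prop : Continuous fun z : E => ‖z‖ ^ 2).aestronglyMeasurable
      fun y => by rw [Real.norm_eq_abs, abs_of_nonneg (sq_nonneg _)]; linarith) hco
  rw [fpEvolve_eq_integral_sub h ht, ← gaussMass_precision h ht, mul_assoc, mul_assoc, ← mul_sub,
    abs_mul, abs_of_pos (inv_pos.2 hN)]
  refine mul_le_mul_of_nonneg_left ?_ (inv_pos.2 hN).le
  rw [gaussMass, ← integral_mul_const, ← integral_sub i1 (i0.mul_const _)]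
  set c := ε + 2 * C * ‖linFlow A t x - x‖ ^ 2
  calc _ ≤ ∫ z, |gaussWeight (precision A D t) z * g (linFlow A t x - z) -
          gaussWeight (precision A D t) z * g x| := abs_integral_le_integral_abs
    _ ≤ ∫ z, (gaussWeight (precision A D t) z * c +
          2 * C * (gaussWeight (precision A D t) z * ‖z‖ ^ 2)) := by
        refine integral_mono (i1.sub (i0.mul_const _)).abs
          ((i0.mul_const c).add (i2.const_mul _)) fun z => ?_
        simp only
        rw [← mul_sub, abs_mul, abs_of_pos (gaussWeight_pos _ _)]
        have h1 : ‖linFlow A t x - z - x‖ ^ 2 ≤ 2 * ‖linFlow A t x - x‖ ^ 2 + 2 * ‖z‖ ^ 2 := by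
          have h2 : ‖linFlow A t x - z - x‖ ≤ ‖linFlow A t x - x‖ + ‖z‖ := by
            rw [sub_right_comm]; exact norm_sub_le _ _
          nlinarith [norm_nonneg (linFlow A t x - z - x), sq_nonneg (‖linFlow A t x - x‖ - ‖z‖)]
        calc _ ≤ gaussWeight (precision A D t) z *
              (ε + C * (2 * ‖linFlow A t x - x‖ ^ 2 + 2 * ‖z‖ ^ 2)) := by
              refine mul_le_mul_of_nonneg_left ((hC _).trans ?_) (gaussWeight_pos _ _).le
              gcongr
          _ = _ := by simp only [c]; ring
    _ = _ := by
        rw [integral_add (i0.mul_const c) (i2.const_mul _), integral_mul_const, integral_const_mul,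
          integral_gaussWeight_mul_norm_sq hco (precision_symm h ht) (precision_gramian h ht)]
        simp only [gaussMass]; ring

theorem tendsto_fpEvolve_apply_zero (hc : Continuous g) (hs : HasCompactSupport g) (x : E) :
    Tendsto (fun t => fpEvolve A D g t x) (𝓝[>] 0) (𝓝 (g x)) := by
  have hdet : Tendsto (fun t => |(linFlow A t).det|) (𝓝 0) (𝓝 1) := by
    have h1 : Continuous fun t => |(linFlow A t).det| :=
      (ContinuousLinearMap.continuous_det.comp (continuous_linFlow A)).abs
    have h2 := h1.tendsto 0
    rw [linFlow_zero] at h2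
    have h3 : (1 : E →L[ℝ] E).det = 1 := LinearMap.det_id
    rwa [h3, abs_one] at h2
  have key : Tendsto (fun t => fpEvolve A D g t x - |(linFlow A t).det| * g x) (𝓝[>] 0) (𝓝 0) := by
    refine Metric.tendsto_nhds.2 fun ε hε => ?_
    obtain ⟨C, hC0, hC⟩ := exists_quadratic_modulus hc hs x (half_pos hε)
    have h1 : Tendsto (fun t => |(linFlow A t).det| *
        (ε / 2 + 2 * C * ‖linFlow A t x - x‖ ^ 2 + 2 * C * clmTrace (gramian A D t))) (𝓝 0)
        (𝓝 (1 * (ε / 2 + 2 * C * ‖linFlow A 0 x - x‖ ^ 2 + 2 * C * clmTrace (gramian A D 0)))) := by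
      refine hdet.mul (Continuous.tendsto ?_ 0)
      have h2 := continuous_linFlow A
      have h3 := (contDiff_gramian A D).continuous
      fun_prop
    rw [linFlow_zero, gramian_zero] at h1
    simp only [one_apply_eq_self, sub_self, norm_zero, map_zero] at h1
    have h2 := h1.eventually_lt_const (u := ε) (by linarith)
    filter_upwards [nhdsWithin_le_nhds h2, self_mem_nhdsWithin] with t h3 ht
    rw [Real.dist_eq, sub_zero]
    exact (abs_fpEvolve_sub_le h hc hs ht hC0 hC).trans_lt h3
  have h4 := key.add ((hdet.mono_left nhdsWithin_le_nhds).mul_const (g x))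
  simpa using h4

theorem tendsto_fpEvolve_zero_of_continuous (hc : Continuous g) (hs : HasCompactSupport g)
    (hg : Integrable g) (hpos : ∀ x, 0 ≤ g x) :
    Tendsto (fun t => ∫ x, |fpEvolve A D g t x - g x|) (𝓝[>] 0) (𝓝 0) := by
  refine tendsto_integral_abs_sub_of_tendsto_integral ?_ hg ?_
    (ae_of_all _ fun x => tendsto_fpEvolve_apply_zero h hc hs x) ?_
  · filter_upwards [self_mem_nhdsWithin] with t ht using integrable_fpEvolve h ht hg
  · filter_upwards [self_mem_nhdsWithin] with t ht using
      ae_of_all _ fun x => fpEvolve_nonneg h ht (ae_of_all _ hpos) x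
  · refine tendsto_const_nhds.congr' ?_
    filter_upwards [self_mem_nhdsWithin] with t ht using (integral_fpEvolve h ht hg).symm

theorem fpEvolve_sub {g' : E → ℝ} (hg : Integrable g) (hg' : Integrable g') {t : ℝ} (ht : 0 < t)
    (x : E) : fpEvolve A D g t x - fpEvolve A D g' t x =
      fpEvolve A D (fun y => g y - g' y) t x := by
  rw [fpEvolve_eq h ht, fpEvolve_eq h ht, fpEvolve_eq h ht,
    ← integral_sub ((GaussIntegrable.of_integrable hg).integrable_fpKernel h ht x)
      ((GaussIntegrable.of_integrable hg').integrable_fpKernel h ht x)]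
  simp_rw [smul_sub]

/-- Three-ε argument: the L¹-contraction carries the approximation error of φ from time 0 to time t.
-/
theorem tendsto_fpEvolve_zero (hg : Integrable g) (hpos : 0 ≤ᵐ[volume] g) :
    Tendsto (fun t => ∫ x, |fpEvolve A D g t x - g x|) (𝓝[>] 0) (𝓝 0) := by
  refine Metric.tendsto_nhds.2 fun ε hε => ?_
  obtain ⟨φ, hc, hφ, hs, hi, hle⟩ := exists_nonneg_continuous_integral_sub_le hg hpos
    (show 0 < ε / 3 by positivity)
  have h1 := (tendsto_fpEvolve_zero_of_continuous h hc hs hi hφ).eventually_lt_const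
    (show 0 < ε / 3 by positivity)
  filter_upwards [h1, self_mem_nhdsWithin] with t h1 ht
  rw [Real.dist_eq, sub_zero, abs_of_nonneg (integral_nonneg fun x => abs_nonneg _)]
  have j1 : Integrable (fun x => g x - φ x) := hg.sub hi
  have j2 := integrable_fpEvolve h ht hi
  have j3 := integrable_fpEvolve h ht j1
  have h2 := integral_abs_fpEvolve_le h ht j1
  calc ∫ x, |fpEvolve A D g t x - g x|
      ≤ ∫ x, (|fpEvolve A D (fun y => g y - φ y) t x| + |fpEvolve A D φ t x - φ x| +
          |g x - φ x|) := by
        refine integral_mono ((integrable_fpEvolve h ht hg).sub hg).abs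
          ((j3.abs.add (j2.sub hi).abs).add j1.abs) fun x => ?_
        simp only
        rw [← fpEvolve_sub h hg hi ht x]
        have e : fpEvolve A D g t x - g x = (fpEvolve A D g t x - fpEvolve A D φ t x) +
          (fpEvolve A D φ t x - φ x) - (g x - φ x) := by ring
        rw [e]
        exact (abs_sub _ _).trans (by gcongr; exact abs_add_le _ _)
    _ = (∫ x, |fpEvolve A D (fun y => g y - φ y) t x|) + (∫ x, |fpEvolve A D φ t x - φ x|) +
          ∫ x, |g x - φ x| := by
        exact integral_add_add j3.abs (j2.sub hi).abs j1.abs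
    _ < ε := by linarith

end Continuity

/-! ### Continuity of translations in L¹. -/

section Translation

variable {E : Type} [NormedAddCommGroup E] [InnerProductSpace ℝ E] [FiniteDimensional ℝ E]
  [MeasurableSpace E] [BorelSpace E]

/-- For continuous φ this is Scheffé's lemma again; the approximation error is invariant under
translation. -/
theorem tendsto_integral_abs_translate_sub {g : E → ℝ} (hg : Integrable g)
    (hpos : 0 ≤ᵐ[volume] g) (s₀ : E) :
    Tendsto (fun s => ∫ x, |g (x - s) - g (x - s₀)|) (𝓝 s₀) (𝓝 0) := by
  refine Metric.tendsto_nhds.2 fun ε hε => ?_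
  obtain ⟨φ, hc, hφ, hs, hi, hle⟩ := exists_nonneg_continuous_integral_sub_le hg hpos
    (show 0 < ε / 3 by positivity)
  have h0 : Tendsto (fun s => ∫ x, |φ (x - s) - φ (x - s₀)|) (𝓝 s₀) (𝓝 0) := by
    refine tendsto_integral_abs_sub_of_tendsto_integral
      (Eventually.of_forall fun s => hi.comp_sub_right s) (hi.comp_sub_right s₀)
      (Eventually.of_forall fun s => ae_of_all _ fun x => hφ _) (ae_of_all _ fun x => ?_) ?_
    · exact (by fun_prop : Continuous fun s => φ (x - s)).tendsto s₀
    · simp_rw [integral_sub_right_eq_self φ]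
      exact tendsto_const_nhds
  filter_upwards [h0.eventually_lt_const (show 0 < ε / 3 by positivity)] with s h1
  rw [Real.dist_eq, sub_zero, abs_of_nonneg (integral_nonneg fun x => abs_nonneg _)]
  have j : Integrable (fun x => |g x - φ x|) := (hg.sub hi).abs
  have j1 := j.comp_sub_right s
  have j2 := j.comp_sub_right s₀
  have j3 : Integrable (fun x => |φ (x - s) - φ (x - s₀)|) :=
    ((hi.comp_sub_right s).sub (hi.comp_sub_right s₀)).abs
  have e1 := integral_sub_right_eq_self (μ := volume) (fun x => |g x - φ x|) s
  have e2 := integral_sub_right_eq_self (μ := volume) (fun x => |g x - φ x|) s₀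
  calc ∫ x, |g (x - s) - g (x - s₀)|
      ≤ ∫ x, (|g (x - s) - φ (x - s)| + |φ (x - s) - φ (x - s₀)| + |g (x - s₀) - φ (x - s₀)|) := by
        refine integral_mono ((hg.comp_sub_right s).sub (hg.comp_sub_right s₀)).abs
          ((j1.add j3).add j2) fun x => ?_
        simp only
        have e : g (x - s) - g (x - s₀) = (g (x - s) - φ (x - s)) + (φ (x - s) - φ (x - s₀)) -
          (g (x - s₀) - φ (x - s₀)) := by ring
        rw [e]
        exact (abs_sub _ _).trans (by gcongr; exact abs_add_le _ _)
    _ = (∫ x, |g (x - s) - φ (x - s)|) + (∫ x, |φ (x - s) - φ (x - s₀)|) +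
          ∫ x, |g (x - s₀) - φ (x - s₀)| := by
        exact integral_add_add j1 j3 j2
    _ < ε := by linarith

end Translation

/-! ### Green's identity and differentiation under the integral sign. -/

section Green

variable {E : Type} [NormedAddCommGroup E] [InnerProductSpace ℝ E] [FiniteDimensional ℝ E]
  [CompleteSpace E] [MeasurableSpace E] [BorelSpace E]

theorem contDiff_gradient {f : E → ℝ} (hf : ContDiff ℝ ∞ f) : ContDiff ℝ ∞ (gradient f) :=
  (InnerProductSpace.toDual ℝ E).symm.contDiff.comp (hf.fderiv_right (by simp))

theorem inner_gradient_left' {f : E → ℝ} (x v : E) :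
    inner ℝ (gradient f x) v = fderiv ℝ f x v := by
  rw [gradient, InnerProductSpace.toDual_symm_apply]

/-- Green's identity for the Fokker–Planck operator and its adjoint. -/
theorem integral_mul_fokkerPlanck {A D : E →L[ℝ] E}
    (hD : ∀ x y, inner ℝ (D x) y = inner ℝ x (D y)) {f θ : E → ℝ} (hf : ContDiff ℝ ∞ f)
    (hθ : ContDiff ℝ ∞ θ) (hs : HasCompactSupport θ) :
    ∫ x, θ x * clmTrace (fderiv ℝ (fun z => f z • A z + D (gradient f z)) x) =
      ∫ x, f x * (clmTrace (fderiv ℝ (fun z => D (gradient θ z)) x) -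
        inner ℝ (gradient θ x) (A x)) := by
  have hf' := contDiff_gradient hf
  have hθ' := contDiff_gradient hθ
  set J : E → E := fun z => f z • A z + D (gradient f z) with hJ
  set H : E → E := fun z => D (gradient θ z) with hH
  have cJ : ContDiff ℝ ∞ J := (hf.smul A.contDiff).add (D.contDiff.comp hf')
  have cH : ContDiff ℝ ∞ H := D.contDiff.comp hθ'
  have hne : (∞ : WithTop ℕ∞) ≠ 0 := by simp
  have hsg : HasCompactSupport (gradient θ) :=
    (hs.fderiv ℝ).comp_left (g := (InnerProductSpace.toDual ℝ E).symm) (map_zero _)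
  have hsH : HasCompactSupport H := hsg.comp_left (g := D) (map_zero D)
  -- Integrating the divergence of this compactly supported field moves all derivatives to θ; the
  -- terms with both gradients cancel by the symmetry of D.
  set W : E → E := fun z => θ z • J z - f z • H z with hW
  have cW : ContDiff ℝ ∞ W := (hθ.smul cJ).sub (hf.smul cH)
  have sW : HasCompactSupport W := (hs.smul_right (f' := J)).sub (hsH.smul_left (f := f))
  have hd (x : E) : HasFDerivAt W (fderiv ℝ W x) x := (cW.differentiable hne x).hasFDerivAt
  have h0 := integral_clmTrace_fderiv_eq_zero hd (cW.continuous.integrable_of_hasCompactSupport sW)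
    ((cW.continuous_fderiv hne).integrable_of_hasCompactSupport (sW.fderiv ℝ))
  have cJ' := clmTrace.continuous.comp (cJ.continuous_fderiv hne)
  have cH' := clmTrace.continuous.comp (cH.continuous_fderiv hne)
  have e (x : E) : clmTrace (fderiv ℝ W x) = θ x * clmTrace (fderiv ℝ J x) -
      f x * (clmTrace (fderiv ℝ H x) - inner ℝ (gradient θ x) (A x)) := by
    have h1 := ((hθ.differentiable hne x).hasFDerivAt.smul (cJ.differentiable hne x).hasFDerivAt).sub
      ((hf.differentiable hne x).hasFDerivAt.smul (cH.differentiable hne x).hasFDerivAt)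
    have h2 : fderiv ℝ W x = _ := h1.fderiv
    rw [h2, map_sub, map_add, map_add, map_smul, map_smul, clmTrace_smulRight, clmTrace_smulRight,
      ← inner_gradient_left', ← inner_gradient_left']
    have h3 : inner ℝ (gradient f x) (H x) = inner ℝ (gradient θ x) (D (gradient f x)) := by
      rw [← hD, real_inner_comm]
    rw [h3]
    simp only [hJ, inner_add_right, inner_smul_right, smul_eq_mul]
    ring
  simp_rw [e] at h0
  have i1 : Integrable (fun x => θ x * clmTrace (fderiv ℝ J x)) :=
    (hθ.continuous.mul cJ').integrable_of_hasCompactSupport hs.mul_right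
  have i2 : Integrable (fun x => f x * (clmTrace (fderiv ℝ H x) - inner ℝ (gradient θ x) (A x))) := by
    refine (hf.continuous.mul (cH'.sub (hθ'.continuous.inner A.continuous))
      ).integrable_of_hasCompactSupport (HasCompactSupport.mul_left ?_)
    refine HasCompactSupport.sub ((hsH.fderiv ℝ).comp_left (g := clmTrace) (map_zero _)) ?_
    exact hsg.mono fun x hx h0 => hx (by simp only [h0, inner_zero_left])
  rw [integral_sub i1 i2] at h0
  exact sub_eq_zero.1 h0

/-- Differentiation under the integral sign for smooth functions supported in a fixed ball. -/
theorem hasDerivAt_integral_of_contDiffOn {q : ℝ → E → ℝ}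
    (hq : ContDiffOn ℝ ∞ (fun p : ℝ × E => q p.1 p.2) (Ioi 0 ×ˢ univ)) {R : ℝ}
    (hR : ∀ t x, R < ‖x‖ → q t x = 0) {t : ℝ} (ht : 0 < t) :
    HasDerivAt (fun τ => ∫ x, q τ x) (∫ x, deriv (fun τ => q τ x) t) t := by
  set Q : ℝ × E → ℝ := fun p => q p.1 p.2
  have hopen : IsOpen (Ioi (0 : ℝ) ×ˢ (univ : Set E)) := isOpen_Ioi.prod isOpen_univ
  have hcont : ContinuousOn (fun p => fderiv ℝ Q p (1, 0)) (Ioi 0 ×ˢ univ) :=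
    (hq.continuousOn_fderiv_of_isOpen hopen (by simp)).clm_apply continuousOn_const
  have hd (τ : ℝ) (hτ : 0 < τ) (x : E) : HasDerivAt (fun τ => q τ x) (fderiv ℝ Q (τ, x) (1, 0)) τ := by
    have h1 : HasFDerivAt Q (fderiv ℝ Q (τ, x)) (τ, x) :=
      ((hq.contDiffAt (hopen.mem_nhds (mk_mem_prod hτ (mem_univ x)))).differentiableAt (by simp)).hasFDerivAt
    exact h1.comp_hasDerivAt τ ((hasDerivAt_id τ).prodMk (hasDerivAt_const τ x))
  -- Radius t/2 keeps the times in a compact subset of (0, ∞), where the time derivative is bounded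
  -- on the fixed ball.
  have hsub : Metric.closedBall t (t / 2) ×ˢ Metric.closedBall (0 : E) R ⊆ Ioi 0 ×ˢ univ := by
    rintro ⟨τ, x⟩ ⟨hτ, -⟩
    rw [Real.closedBall_eq_Icc] at hτ
    exact ⟨by simp only [mem_Ioi]; linarith [hτ.1], mem_univ _⟩
  obtain ⟨C, hC⟩ := ((isCompact_closedBall t (t / 2)).prod
    (isCompact_closedBall (0 : E) R)).exists_bound_of_continuousOn (hcont.mono hsub)
  have hzero (τ : ℝ) (x : E) (hx : R < ‖x‖) : deriv (fun τ => q τ x) τ = 0 := by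
    rw [show (fun τ => q τ x) = fun _ => 0 from funext fun τ => hR τ x hx, deriv_const]
  have hqc (τ : ℝ) (hτ : 0 < τ) : Continuous (q τ) := by
    have := hq.continuousOn.comp_continuous (f := fun x : E => (τ, x)) (by fun_prop)
      fun x => mk_mem_prod hτ (mem_univ x)
    exact this
  have hcs (u : E → ℝ) (hu : ∀ x, R < ‖x‖ → u x = 0) : HasCompactSupport u :=
    HasCompactSupport.intro (isCompact_closedBall (0 : E) R) fun x hx =>
      hu x (by simpa using hx)
  have hdc : Continuous fun x => deriv (fun τ => q τ x) t := by
    simp_rw [(hd t ht _).deriv]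
    exact hcont.comp_continuous (f := fun x : E => (t, x)) (by fun_prop) fun x => mk_mem_prod ht (mem_univ x)
  refine (hasDerivAt_integral_of_dominated_loc_of_deriv_le (F := q)
    (F' := fun τ x => deriv (fun τ => q τ x) τ)
    (bound := (Metric.closedBall (0 : E) R).indicator fun _ => C)
    (Metric.closedBall_mem_nhds t (half_pos ht)) ?_ ?_ hdc.aestronglyMeasurable
    (ae_of_all _ fun x τ hτ => ?_) ?_ (ae_of_all _ fun x τ hτ => ?_)).2
  · filter_upwards [lt_mem_nhds ht] with τ hτ using (hqc τ hτ).aestronglyMeasurable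
  · exact (hqc t ht).integrable_of_hasCompactSupport (hcs _ (hR t))
  · by_cases hx : x ∈ Metric.closedBall (0 : E) R
    · rw [indicator_of_mem hx]
      have := hC (τ, x) (mk_mem_prod hτ hx)
      rwa [← (hd τ (hsub (mk_mem_prod hτ hx)).1 x).deriv] at this
    · rw [indicator_of_notMem hx, hzero τ x (by simpa using hx), norm_zero]
  · exact (integrableOn_const measure_closedBall_lt_top.ne).integrable_indicator
      measurableSet_closedBall
  · have hτ0 : 0 < τ := by
      rw [Real.closedBall_eq_Icc] at hτ
      linarith [hτ.1]
    exact (hd τ hτ0 x).differentiableAt.hasDerivAt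

end Green

/-! ### A radial cutoff with bounded first and second derivatives. -/

section Cutoff

/-- A smooth function equal to `1` on `(-∞, 1]` and to `0` on `[2, ∞)`. -/
noncomputable def radialCutoff (s : ℝ) : ℝ := Real.smoothTransition (2 - s)

theorem contDiff_radialCutoff : ContDiff ℝ ∞ radialCutoff :=
  Real.smoothTransition.contDiff.comp (contDiff_const.sub contDiff_id)

theorem radialCutoff_of_le {s : ℝ} (hs : s ≤ 1) : radialCutoff s = 1 :=
  Real.smoothTransition.one_of_one_le (by linarith)

theorem radialCutoff_of_ge {s : ℝ} (hs : 2 ≤ s) : radialCutoff s = 0 :=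
  Real.smoothTransition.zero_of_nonpos (by linarith)

theorem abs_radialCutoff_le (s : ℝ) : |radialCutoff s| ≤ 1 := by
  rw [radialCutoff, abs_of_nonneg (Real.smoothTransition.nonneg _)]
  exact Real.smoothTransition.le_one _

theorem contDiff_deriv_radialCutoff : ContDiff ℝ ∞ (deriv radialCutoff) :=
  (contDiff_infty_iff_deriv.1 contDiff_radialCutoff).2

theorem deriv_eq_zero_of_eqOn_const {k : ℝ → ℝ} {c : ℝ} {U : Set ℝ} (hU : IsOpen U)
    (hk : ∀ s ∈ U, k s = c) {s : ℝ} (hs : s ∈ U) : deriv k s = 0 := by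
  have : k =ᶠ[𝓝 s] fun _ => c := by filter_upwards [hU.mem_nhds hs] with r hr using hk r hr
  rw [this.deriv_eq, deriv_const]

theorem deriv_radialCutoff_eq_zero {s : ℝ} (hs : s ∈ Iio (1 : ℝ) ∪ Ioi 2) :
    deriv radialCutoff s = 0 ∧ deriv (deriv radialCutoff) s = 0 := by
  have h1 (s : ℝ) (hs : s ∈ Iio (1 : ℝ) ∪ Ioi 2) : deriv radialCutoff s = 0 := by
    rcases hs with hs | hs
    · exact deriv_eq_zero_of_eqOn_const isOpen_Iio (fun r hr => radialCutoff_of_le (le_of_lt hr)) hs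
    · exact deriv_eq_zero_of_eqOn_const isOpen_Ioi (fun r hr => radialCutoff_of_ge (le_of_lt hr)) hs
  exact ⟨h1 s hs, deriv_eq_zero_of_eqOn_const (isOpen_Iio.union isOpen_Ioi) h1 hs⟩

theorem exists_bound_deriv_radialCutoff : ∃ K, 0 ≤ K ∧ ∀ s,
    |deriv radialCutoff s| ≤ K ∧ |deriv (deriv radialCutoff) s| ≤ K := by
  obtain ⟨K₁, h1⟩ := isCompact_Icc.exists_bound_of_continuousOn (s := Icc (1 : ℝ) 2)
    contDiff_deriv_radialCutoff.continuous.continuousOn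
  obtain ⟨K₂, h2⟩ := isCompact_Icc.exists_bound_of_continuousOn (s := Icc (1 : ℝ) 2)
    (contDiff_infty_iff_deriv.1 contDiff_deriv_radialCutoff).2.continuous.continuousOn
  refine ⟨max 0 (max K₁ K₂), le_max_left _ _, fun s => ?_⟩
  by_cases hs : s ∈ Icc (1 : ℝ) 2
  · exact ⟨(h1 s hs).trans ((le_max_left _ _).trans (le_max_right _ _)),
      (h2 s hs).trans ((le_max_right _ _).trans (le_max_right _ _))⟩
  · have hs' : s ∈ Iio (1 : ℝ) ∪ Ioi 2 := by
      by_contra hc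
      simp only [mem_union, mem_Iio, mem_Ioi, not_or, not_lt] at hc
      exact hs hc
    obtain ⟨e1, e2⟩ := deriv_radialCutoff_eq_zero hs'
    simp [e1, e2]

end Cutoff

/-! ### Plane waves solving the backward equation, and the defect caused by the cutoff. -/

section PlaneWave

variable {E : Type} [NormedAddCommGroup E] [InnerProductSpace ℝ E] [FiniteDimensional ℝ E]
  [CompleteSpace E] [MeasurableSpace E] [BorelSpace E]

/-- The dissipation integral `∫₀ᵗ ⟪ξ(s), D ξ(s)⟫ ds` along the adjoint flow. -/
noncomputable def dualExponent (A D : E →L[ℝ] E) (ξ : E) (t : ℝ) : ℝ :=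
  ∫ s in (0 : ℝ)..t, inner ℝ (linFlow (star A) s ξ) (D (linFlow (star A) s ξ))

theorem continuous_dualExponent_integrand (A D : E →L[ℝ] E) (ξ : E) :
    ContDiff ℝ ∞ fun s => inner ℝ (linFlow (star A) s ξ) (D (linFlow (star A) s ξ)) :=
  have h := (contDiff_linFlow (star A)).clm_apply (contDiff_const (c := ξ))
  h.inner ℝ (D.contDiff.comp h)

theorem hasDerivAt_dualExponent (A D : E →L[ℝ] E) (ξ : E) (t : ℝ) :
    HasDerivAt (dualExponent A D ξ)
      (inner ℝ (linFlow (star A) t ξ) (D (linFlow (star A) t ξ))) t :=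
  have hc := (continuous_dualExponent_integrand A D ξ).continuous
  intervalIntegral.integral_hasDerivAt_right (hc.intervalIntegrable _ _)
    (hc.stronglyMeasurableAtFilter _ _) hc.continuousAt

theorem contDiff_dualExponent (A D : E →L[ℝ] E) (ξ : E) : ContDiff ℝ ∞ (dualExponent A D ξ) := by
  refine contDiff_infty_iff_deriv.2 ⟨fun t => (hasDerivAt_dualExponent A D ξ t).differentiableAt, ?_⟩
  rw [show deriv (dualExponent A D ξ) = _ from
    funext fun t => (hasDerivAt_dualExponent A D ξ t).deriv]
  exact continuous_dualExponent_integrand A D ξ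

/-- A real plane wave solving the backward equation. -/
noncomputable def dualWave (A D : E →L[ℝ] E) (ξ : E) (a t : ℝ) (x : E) : ℝ :=
  Real.exp (dualExponent A D ξ t) * Real.cos (inner ℝ (linFlow (star A) t ξ) x + a)

/-- The plane wave cut off at radius `r ^ (-1 / 2)`. -/
noncomputable def cutWave (A D : E →L[ℝ] E) (ξ : E) (a r t : ℝ) (x : E) : ℝ :=
  radialCutoff (r * ‖x‖ ^ 2) * dualWave A D ξ a t x

theorem contDiff_dualWave (A D : E →L[ℝ] E) (ξ : E) (a : ℝ) :
    ContDiff ℝ ∞ fun q : ℝ × E => dualWave A D ξ a q.1 q.2 := by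
  have h1 : ContDiff ℝ ∞ fun q : ℝ × E => linFlow (star A) q.1 ξ :=
    ((contDiff_linFlow (star A)).comp contDiff_fst).clm_apply contDiff_const
  exact ((contDiff_dualExponent A D ξ).comp contDiff_fst).exp.mul
    ((h1.inner ℝ contDiff_snd).add contDiff_const).cos

theorem contDiff_cutWave (A D : E →L[ℝ] E) (ξ : E) (a r : ℝ) :
    ContDiff ℝ ∞ fun q : ℝ × E => cutWave A D ξ a r q.1 q.2 :=
  (contDiff_radialCutoff.comp (contDiff_const.mul (contDiff_snd.norm_sq ℝ))).mul
    (contDiff_dualWave A D ξ a)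

theorem abs_dualWave_le (A D : E →L[ℝ] E) (ξ : E) (a t : ℝ) (x : E) :
    |dualWave A D ξ a t x| ≤ Real.exp (dualExponent A D ξ t) := by
  rw [dualWave, abs_mul, Real.abs_exp]
  exact mul_le_of_le_one_right (Real.exp_pos _).le (Real.abs_cos_le_one _)

theorem abs_cutWave_le (A D : E →L[ℝ] E) (ξ : E) (a r t : ℝ) (x : E) :
    |cutWave A D ξ a r t x| ≤ Real.exp (dualExponent A D ξ t) := by
  rw [cutWave, abs_mul]
  exact (mul_le_of_le_one_left (abs_nonneg _) (abs_radialCutoff_le _)).trans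
    (abs_dualWave_le A D ξ a t x)

/-- A shift of the phase by -π/2 turns cosine into sine, so both waves and their derivatives stay in
one family. -/
theorem dualWave_phase (A D : E →L[ℝ] E) (ξ : E) (a t : ℝ) (x : E) :
    dualWave A D ξ (a - Real.pi / 2) t x =
      Real.exp (dualExponent A D ξ t) * Real.sin (inner ℝ (linFlow (star A) t ξ) x + a) := by
  rw [dualWave, ← add_sub_assoc, Real.cos_sub_pi_div_two]

theorem hasFDerivAt_dualWave (A D : E →L[ℝ] E) (ξ : E) (a t : ℝ) (x : E) :
    HasFDerivAt (dualWave A D ξ a t)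
      (-dualWave A D ξ (a - Real.pi / 2) t x • innerSL ℝ (linFlow (star A) t ξ)) x := by
  have h1 : HasFDerivAt (fun x => inner ℝ (linFlow (star A) t ξ) x + a)
      (innerSL ℝ (linFlow (star A) t ξ)) x :=
    (innerSL ℝ (linFlow (star A) t ξ)).hasFDerivAt.add_const a
  refine (h1.cos.const_mul (Real.exp (dualExponent A D ξ t))).congr_fderiv ?_
  rw [dualWave_phase, smul_smul, mul_neg]

theorem dualWave_sub_pi (A D : E →L[ℝ] E) (ξ : E) (a t : ℝ) (x : E) :
    dualWave A D ξ (a - Real.pi / 2 - Real.pi / 2) t x = -dualWave A D ξ a t x := by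
  rw [dualWave, dualWave, show inner ℝ (linFlow (star A) t ξ) x + (a - Real.pi / 2 - Real.pi / 2) =
    inner ℝ (linFlow (star A) t ξ) x + a - Real.pi by ring, Real.cos_sub_pi, mul_neg]

theorem hasDerivAt_dualWave (A D : E →L[ℝ] E) (ξ : E) (a t : ℝ) (x : E) :
    HasDerivAt (fun τ => dualWave A D ξ a τ x)
      (inner ℝ (linFlow (star A) t ξ) (D (linFlow (star A) t ξ)) * dualWave A D ξ a t x -
        inner ℝ (linFlow (star A) t ξ) (A x) * dualWave A D ξ (a - Real.pi / 2) t x) t := by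
  have h1 : HasDerivAt (fun τ => inner ℝ (linFlow (star A) τ ξ) x + a)
      (inner ℝ (linFlow (star A) t ξ) (A x)) t := by
    have h2 := ((hasDerivAt_linFlow' (star A) t).clm_apply (hasDerivAt_const t ξ)).inner ℝ
      (hasDerivAt_const t x)
    refine (h2.add_const a).congr_deriv ?_
    simp only [map_zero, add_zero, inner_zero_right, zero_add, mul_apply_eq_comp]
    rw [inner_clm_star_left]
  refine ((hasDerivAt_dualExponent A D ξ t).exp.mul h1.cos).congr_deriv ?_
  rw [dualWave_phase, dualWave]
  ring

theorem hasFDerivAt_radial {k : ℝ → ℝ} (hk : Differentiable ℝ k) (r : ℝ) (x : E) :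
    HasFDerivAt (fun x : E => k (r * ‖x‖ ^ 2)) ((2 * r * deriv k (r * ‖x‖ ^ 2)) • innerSL ℝ x) x := by
  have h1 : HasFDerivAt (fun x : E => r * ‖x‖ ^ 2) (r • (2 • innerSL ℝ x)) x :=
    (hasStrictFDerivAt_norm_sq x).hasFDerivAt.const_mul r
  refine ((hk (r * ‖x‖ ^ 2)).hasDerivAt.comp_hasFDerivAt x h1).congr_fderiv ?_
  ext v
  simp only [smul_apply, smul_eq_mul, nsmul_eq_mul, Nat.cast_ofNat]
  ring

theorem gradient_cutWave (A D : E →L[ℝ] E) (ξ : E) (a r t : ℝ) (x : E) :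
    gradient (cutWave A D ξ a r t) x =
      (2 * r * (deriv radialCutoff (r * ‖x‖ ^ 2) * dualWave A D ξ a t x)) • x -
      (radialCutoff (r * ‖x‖ ^ 2) * dualWave A D ξ (a - Real.pi / 2) t x) •
        linFlow (star A) t ξ := by
  refine HasGradientAt.gradient ?_
  rw [hasGradientAt_iff_hasFDerivAt]
  refine ((hasFDerivAt_radial (contDiff_radialCutoff.differentiable (by simp)) r x).mul
    (hasFDerivAt_dualWave A D ξ a t x)).congr_fderiv (ContinuousLinearMap.ext fun v => ?_)
  rw [InnerProductSpace.toDual_apply_apply, inner_sub_left, real_inner_smul_left,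
    real_inner_smul_left]
  simp only [add_apply, smul_apply, innerSL_apply_apply, smul_eq_mul]
  ring

/-- The residual of the cut-off plane wave in the backward equation. -/
noncomputable def cutWaveDefect (A D : E →L[ℝ] E) (ξ : E) (a r t : ℝ) (x : E) : ℝ :=
  4 * r ^ 2 * deriv (deriv radialCutoff) (r * ‖x‖ ^ 2) * dualWave A D ξ a t x * inner ℝ x (D x) -
  4 * r * deriv radialCutoff (r * ‖x‖ ^ 2) * dualWave A D ξ (a - Real.pi / 2) t x *
    inner ℝ (linFlow (star A) t ξ) (D x) +
  2 * r * deriv radialCutoff (r * ‖x‖ ^ 2) * dualWave A D ξ a t x *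
    (clmTrace D - inner ℝ x (A x))

/-- The uncut wave solves the backward equation exactly, so only terms with a derivative of the
cutoff survive. -/
theorem cutWave_backward (A : E →L[ℝ] E) {D : E →L[ℝ] E}
    (hD : ∀ x y, inner ℝ (D x) y = inner ℝ x (D y)) (ξ : E) (a r t : ℝ) (x : E) :
    deriv (fun τ => cutWave A D ξ a r τ x) t +
      (clmTrace (fderiv ℝ (fun z => D (gradient (cutWave A D ξ a r t) z)) x) -
        inner ℝ (gradient (cutWave A D ξ a r t) x) (A x)) = cutWaveDefect A D ξ a r t x := by
  have hk := hasFDerivAt_radial (contDiff_radialCutoff.differentiable (by simp)) r x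
  have hk' := hasFDerivAt_radial (contDiff_deriv_radialCutoff.differentiable (by simp)) r x
  have hψ := hasFDerivAt_dualWave A D ξ a t x
  have hS := hasFDerivAt_dualWave A D ξ (a - Real.pi / 2) t x
  rw [dualWave_sub_pi] at hS
  have h1 := (((hk'.mul hψ).const_mul (2 * r)).smul (D.hasFDerivAt (x := x))).sub
    ((hk.mul hS).smul_const (D (linFlow (star A) t ξ)))
  have h2 : (fun z => D (gradient (cutWave A D ξ a r t) z)) = fun z =>
      (2 * r * (deriv radialCutoff (r * ‖z‖ ^ 2) * dualWave A D ξ a t z)) • D z -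
      (radialCutoff (r * ‖z‖ ^ 2) * dualWave A D ξ (a - Real.pi / 2) t z) •
        D (linFlow (star A) t ξ) := by
    funext z
    rw [gradient_cutWave, map_sub, map_smul, map_smul]
  have h3 := (h1.congr_of_eventuallyEq (Eventually.of_forall fun z => congrFun h2 z)).fderiv
  have h4 : deriv (fun τ => cutWave A D ξ a r τ x) t = _ :=
    ((hasDerivAt_dualWave A D ξ a t x).const_mul (radialCutoff (r * ‖x‖ ^ 2))).deriv
  have e1 : inner ℝ x (D (linFlow (star A) t ξ)) = inner ℝ (linFlow (star A) t ξ) (D x) := by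
    rw [← hD, real_inner_comm]
  rw [h3, h4, gradient_cutWave, map_sub, map_add, map_smul, clmTrace_smulRight, clmTrace_smulRight,
    inner_sub_left, real_inner_smul_left, real_inner_smul_left, cutWaveDefect]
  simp only [add_apply, smul_apply, innerSL_apply_apply, smul_eq_mul, Pi.mul_apply, e1]
  ring

theorem cutWaveDefect_eq_zero (A D : E →L[ℝ] E) (ξ : E) (a t : ℝ) {r : ℝ} {x : E}
    (hx : r * ‖x‖ ^ 2 < 1) : cutWaveDefect A D ξ a r t x = 0 := by
  obtain ⟨e1, e2⟩ := deriv_radialCutoff_eq_zero (Or.inl hx)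
  simp [cutWaveDefect, e1, e2]

/-- The defect lives where 1 ≤ r‖x‖² ≤ 2. The drift grows linearly, but the gradient of the cutoff
has size r‖x‖, and the product is controlled by r‖x‖² ≤ 2, uniformly in r. -/
theorem exists_abs_cutWaveDefect_le (A D : E →L[ℝ] E) (ξ : E) (a T : ℝ) :
    ∃ C, 0 ≤ C ∧ ∀ t ∈ Icc 0 T, ∀ r, 0 < r → r ≤ 1 → ∀ x, |cutWaveDefect A D ξ a r t x| ≤ C := by
  obtain ⟨K, hK0, hK⟩ := exists_bound_deriv_radialCutoff
  obtain ⟨X, hX⟩ := isCompact_Icc.exists_bound_of_continuousOn (s := Icc (0 : ℝ) T)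
    (f := fun t => linFlow (star A) t ξ)
    ((continuous_linFlow (star A)).clm_apply continuous_const).continuousOn
  obtain ⟨B, hB⟩ := isCompact_Icc.exists_bound_of_continuousOn (s := Icc (0 : ℝ) T)
    (f := fun t => Real.exp (dualExponent A D ξ t))
    (contDiff_dualExponent A D ξ).continuous.rexp.continuousOn
  refine ⟨K * max B 0 * (8 * ‖D‖ + 12 * max X 0 * ‖D‖ + 2 * |clmTrace D| + 4 * ‖A‖),
    by positivity, fun t ht r hr hr1 x => ?_⟩
  by_cases hx : r * ‖x‖ ^ 2 ∈ Iio (1 : ℝ) ∪ Ioi 2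
  · obtain ⟨e1, e2⟩ := deriv_radialCutoff_eq_zero hx
    simp only [cutWaveDefect, e1, e2, mul_zero, zero_mul, sub_zero, add_zero, abs_zero]
    positivity
  have hx2 : r * ‖x‖ ^ 2 ≤ 2 := by
    by_contra hc
    exact hx (Or.inr (not_le.1 hc))
  -- From r(‖x‖ - 1)² ≥ 0 one gets 2r‖x‖ ≤ r‖x‖² + r ≤ 3.
  have hx1 : r * ‖x‖ ≤ 3 := by nlinarith [mul_nonneg hr.le (sq_nonneg (‖x‖ - 1))]
  obtain ⟨k1, k2⟩ := hK (r * ‖x‖ ^ 2)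
  set κ₁ := deriv radialCutoff (r * ‖x‖ ^ 2)
  set κ₂ := deriv (deriv radialCutoff) (r * ‖x‖ ^ 2)
  set ζ := linFlow (star A) t ξ
  have hβ : Real.exp (dualExponent A D ξ t) ≤ max B 0 :=
    (Real.le_norm_self _).trans ((hB t ht).trans (le_max_left _ _))
  have hψ : |dualWave A D ξ a t x| ≤ max B 0 := (abs_dualWave_le A D ξ a t x).trans hβ
  have hS : |dualWave A D ξ (a - Real.pi / 2) t x| ≤ max B 0 := (abs_dualWave_le _ _ _ _ _ _).trans hβ
  have hζ : ‖ζ‖ ≤ max X 0 := (hX t ht).trans (le_max_left _ _)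
  have d1 : |r ^ 2 * inner ℝ x (D x)| ≤ 2 * ‖D‖ := by
    rw [abs_mul, abs_of_nonneg (sq_nonneg r)]
    calc _ ≤ r ^ 2 * (‖x‖ * (‖D‖ * ‖x‖)) := by
          gcongr
          exact (abs_real_inner_le_norm _ _).trans (by gcongr; exact D.le_opNorm x)
      _ = r * (r * ‖x‖ ^ 2) * ‖D‖ := by ring
      _ ≤ 1 * 2 * ‖D‖ := by gcongr
      _ = _ := by ring
  have d2 : |r * inner ℝ ζ (D x)| ≤ 3 * max X 0 * ‖D‖ := by
    rw [abs_mul, abs_of_pos hr]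
    calc _ ≤ r * (max X 0 * (‖D‖ * ‖x‖)) := by
          gcongr
          exact (abs_real_inner_le_norm _ _).trans (by gcongr; exact D.le_opNorm x)
      _ = (r * ‖x‖) * max X 0 * ‖D‖ := by ring
      _ ≤ _ := by gcongr
  have d3 : |r * (clmTrace D - inner ℝ x (A x))| ≤ |clmTrace D| + 2 * ‖A‖ := by
    rw [abs_mul, abs_of_pos hr]
    calc _ ≤ r * (|clmTrace D| + ‖x‖ * (‖A‖ * ‖x‖)) := by
          gcongr
          refine (abs_sub _ _).trans ?_
          gcongr
          exact (abs_real_inner_le_norm _ _).trans (by gcongr; exact A.le_opNorm x)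
      _ = r * |clmTrace D| + (r * ‖x‖ ^ 2) * ‖A‖ := by ring
      _ ≤ 1 * |clmTrace D| + 2 * ‖A‖ := by gcongr
      _ = _ := by ring
  have m1 : |κ₂ * dualWave A D ξ a t x * (r ^ 2 * inner ℝ x (D x))| ≤
      K * max B 0 * (2 * ‖D‖) := by
    rw [abs_mul, abs_mul]; gcongr
  have m2 : |κ₁ * dualWave A D ξ (a - Real.pi / 2) t x * (r * inner ℝ ζ (D x))| ≤
      K * max B 0 * (3 * max X 0 * ‖D‖) := by
    rw [abs_mul, abs_mul]; gcongr
  have m3 : |κ₁ * dualWave A D ξ a t x * (r * (clmTrace D - inner ℝ x (A x)))| ≤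
      K * max B 0 * (|clmTrace D| + 2 * ‖A‖) := by
    rw [abs_mul, abs_mul]; gcongr
  have e : cutWaveDefect A D ξ a r t x =
      4 * (κ₂ * dualWave A D ξ a t x * (r ^ 2 * inner ℝ x (D x))) -
      4 * (κ₁ * dualWave A D ξ (a - Real.pi / 2) t x * (r * inner ℝ ζ (D x))) +
      2 * (κ₁ * dualWave A D ξ a t x * (r * (clmTrace D - inner ℝ x (A x)))) := by
    rw [cutWaveDefect]; ring
  rw [e, abs_le]
  rw [abs_le] at m1 m2 m3
  constructor <;> linarith [m1.1, m1.2, m2.1, m2.2, m3.1, m3.2]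

end PlaneWave

/-! ### Conservation of the pairing with a dual wave. -/

section Uniqueness

variable {E : Type} [NormedAddCommGroup E] [InnerProductSpace ℝ E] [FiniteDimensional ℝ E]
  [CompleteSpace E] [MeasurableSpace E] [BorelSpace E]

/-- Continuity of the pairing of an `L¹`-continuous curve with bounded continuous test functions. -/
theorem continuousOn_integral_mul {g θ : ℝ → E → ℝ} {T B : ℝ}
    (hi : ∀ t, 0 ≤ t → Integrable (g t))
    (hc : ∀ t₀, 0 ≤ t₀ → Tendsto (fun t => ∫ x, |g t x - g t₀ x|) (𝓝[Ici 0] t₀) (𝓝 0))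
    (hθ : Continuous fun q : ℝ × E => θ q.1 q.2) (hB : ∀ t ∈ Icc 0 T, ∀ x, |θ t x| ≤ B) :
    ContinuousOn (fun t => ∫ x, g t x * θ t x) (Icc 0 T) := by
  intro t₀ ht₀
  have hθc (t : ℝ) : Continuous (θ t) := hθ.comp (by fun_prop : Continuous fun x : E => (t, x))
  have hle : 𝓝[Icc 0 T] t₀ ≤ 𝓝[Ici 0] t₀ := nhdsWithin_mono _ fun t ht => ht.1
  have hint (s : ℝ) (hs : s ∈ Icc 0 T) (t : ℝ) (ht : t ∈ Icc 0 T) :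
      Integrable (fun x => g s x * θ t x) :=
    (hi s hs.1).mul_bdd (c := B) (hθc t).aestronglyMeasurable (ae_of_all _ fun x => hB t ht x)
  have h1 : Tendsto (fun t => ∫ x, g t₀ x * θ t x) (𝓝[Icc 0 T] t₀)
      (𝓝 (∫ x, g t₀ x * θ t₀ x)) := by
    refine tendsto_integral_filter_of_dominated_convergence (fun x => |g t₀ x| * B) ?_ ?_
      ((hi t₀ ht₀.1).abs.mul_const B) (ae_of_all _ fun x => ?_)
    · filter_upwards [self_mem_nhdsWithin] with t ht using (hint t₀ ht₀ t ht).1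
    · filter_upwards [self_mem_nhdsWithin] with t ht
      refine ae_of_all _ fun x => ?_
      rw [norm_mul]
      exact mul_le_mul_of_nonneg_left (hB t ht x) (norm_nonneg _)
    · exact (((hθ.comp (by fun_prop : Continuous fun t : ℝ => (t, x))).tendsto t₀).const_mul
        (g t₀ x)).mono_left nhdsWithin_le_nhds
  -- The pairing splits into this increment, small in L¹, and the pairing with the fixed g t₀,
  -- treated by dominated convergence.
  have h2 : Tendsto (fun t => ∫ x, (g t x - g t₀ x) * θ t x) (𝓝[Icc 0 T] t₀) (𝓝 0) := by
    have h3 := ((hc t₀ ht₀.1).mono_left hle).mul_const B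
    rw [zero_mul] at h3
    refine squeeze_zero_norm' ?_ h3
    filter_upwards [self_mem_nhdsWithin] with t ht
    rw [← integral_mul_const]
    refine norm_integral_le_of_norm_le
      (((hi t ht.1).sub (hi t₀ ht₀.1)).abs.mul_const B) (ae_of_all _ fun x => ?_)
    rw [norm_mul]
    exact mul_le_mul_of_nonneg_left (hB t ht x) (norm_nonneg _)
  have h4 := h2.add h1
  rw [zero_add] at h4
  refine h4.congr' ?_
  filter_upwards [self_mem_nhdsWithin] with t ht
  simp_rw [sub_mul]
  rw [integral_sub (hint t ht t ht) (hint t₀ ht₀ t ht)]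
  ring

/-- The tails of an `L¹`-continuous curve are uniformly small on compact time intervals. -/
theorem tendstoUniformlyOn_tail {g : ℝ → E → ℝ} {T : ℝ} (hi : ∀ t, 0 ≤ t → Integrable (g t))
    (hc : ∀ t₀, 0 ≤ t₀ → Tendsto (fun t => ∫ x, |g t x - g t₀ x|) (𝓝[Ici 0] t₀) (𝓝 0)) :
    TendstoUniformlyOn (fun (n : ℕ) t => ∫ x in {x : E | (n : ℝ) ≤ ‖x‖}, |g t x|) (fun _ => 0) atTop
      (Icc 0 T) := by
  have hm (n : ℕ) : MeasurableSet {x : E | (n : ℝ) ≤ ‖x‖} :=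
    measurableSet_le measurable_const measurable_norm
  -- Dini's theorem: the tails decrease in n, are continuous in t, and tend to 0 for each t.
  refine Antitone.tendstoUniformlyOn_of_forall_tendsto isCompact_Icc (fun n t₀ ht₀ => ?_)
    (fun t ht n m hnm => ?_) continuousOn_const fun t ht => ?_
  · have hle : 𝓝[Icc 0 T] t₀ ≤ 𝓝[Ici 0] t₀ := nhdsWithin_mono _ fun t ht => ht.1
    refine tendsto_iff_norm_sub_tendsto_zero.2 (squeeze_zero' (Eventually.of_forall fun t =>
      norm_nonneg _) ?_ ((hc t₀ ht₀.1).mono_left hle))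
    filter_upwards [self_mem_nhdsWithin] with t ht
    rw [← integral_sub (hi t ht.1).abs.integrableOn (hi t₀ ht₀.1).abs.integrableOn]
    have j := ((hi t ht.1).sub (hi t₀ ht₀.1)).abs
    refine (norm_integral_le_of_norm_le j.integrableOn (ae_of_all _ fun x => ?_)).trans
      (setIntegral_le_integral j (ae_of_all _ fun x => abs_nonneg _))
    exact abs_abs_sub_abs_le_abs_sub _ _
  · refine setIntegral_mono_set (hi t ht.1).abs.integrableOn (ae_of_all _ fun x => abs_nonneg _)
      (ae_of_all _ fun x hx => ?_)
    exact (Nat.cast_le.2 hnm).trans (show (m : ℝ) ≤ ‖x‖ from hx)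
  · have h1 := tendsto_setIntegral_of_antitone (μ := (volume : Measure E)) (f := fun x => |g t x|)
      hm (fun n m hnm x hx =>
        show (n : ℝ) ≤ ‖x‖ from (Nat.cast_le.2 hnm).trans (show (m : ℝ) ≤ ‖x‖ from hx)) ⟨0, (hi t ht.1).abs.integrableOn⟩
    have h2 : ⋂ n : ℕ, {x : E | (n : ℝ) ≤ ‖x‖} = ∅ := by
      refine eq_empty_of_forall_notMem fun x hx => ?_
      obtain ⟨n, hn⟩ := exists_nat_gt ‖x‖
      exact absurd (mem_iInter.1 hx n) (not_le.2 hn)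
    rwa [h2, setIntegral_empty] at h1

variable {A D : E →L[ℝ] E} (hD : ∀ x y, inner ℝ (D x) y = inner ℝ x (D y)) {g : ℝ → E → ℝ}
  (hi : ∀ t, 0 ≤ t → Integrable (g t))
  (hc : ∀ t₀, 0 ≤ t₀ → Tendsto (fun t => ∫ x, |g t x - g t₀ x|) (𝓝[Ici 0] t₀) (𝓝 0))
  (hsm : ContDiffOn ℝ ∞ (fun q : ℝ × E => g q.1 q.2) (Ioi (0 : ℝ) ×ˢ (univ : Set E)))
  (heq : ∀ t, 0 < t → ∀ x, HasDerivAt (fun τ => g τ x)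
    (clmTrace (fderiv ℝ (fun z => g t z • A z + D (gradient (g t) z)) x)) t)

include hD hsm heq

/-- Product rule and Green's identity put the backward operator on the cut wave, leaving its defect.
The compact support of the wave makes any decay assumption on g superfluous. -/
theorem hasDerivAt_integral_mul_cutWave (ξ : E) (a : ℝ) {r : ℝ} (hr : 0 < r) {t : ℝ} (ht : 0 < t) :
    HasDerivAt (fun τ => ∫ x, g τ x * cutWave A D ξ a r τ x)
      (∫ x, g t x * cutWaveDefect A D ξ a r t x) t := by
  have hne : (∞ : WithTop ℕ∞) ≠ 0 := by simp
  have hgt : ContDiff ℝ ∞ (g t) := contDiffOn_univ.1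
    (hsm.comp (f := fun x : E => (t, x)) (contDiff_const.prodMk contDiff_id).contDiffOn
      fun x _ => mk_mem_prod ht (mem_univ x))
  have hθt : ContDiff ℝ ∞ (cutWave A D ξ a r t) :=
    ContDiff.comp (g := fun q : ℝ × E => cutWave A D ξ a r q.1 q.2) (f := fun x : E => (t, x))
      (contDiff_cutWave A D ξ a r) (contDiff_const.prodMk contDiff_id)
  have hzero (τ : ℝ) (x : E) (hx : 2 / r < ‖x‖ ^ 2) : cutWave A D ξ a r τ x = 0 := by
    rw [cutWave, radialCutoff_of_ge, zero_mul]
    rw [div_lt_iff₀ hr] at hx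
    linarith
  have hzero' (τ : ℝ) (x : E) (hx : 1 + 2 / r < ‖x‖) : cutWave A D ξ a r τ x = 0 := by
    refine hzero τ x ?_
    have : 0 < 2 / r := by positivity
    nlinarith
  have hs : HasCompactSupport (cutWave A D ξ a r t) :=
    HasCompactSupport.intro (isCompact_closedBall (0 : E) (1 + 2 / r)) fun x hx =>
      hzero' t x (by simpa using hx)
  have hq : ContDiffOn ℝ ∞ (fun p : ℝ × E => g p.1 p.2 * cutWave A D ξ a r p.1 p.2)
      (Ioi 0 ×ˢ univ) := hsm.mul (contDiff_cutWave A D ξ a r).contDiffOn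
  have hint := hasDerivAt_integral_of_contDiffOn (q := fun τ x => g τ x * cutWave A D ξ a r τ x) hq
    (R := 1 + 2 / r)
    (fun τ x hx => by rw [hzero' τ x hx, mul_zero]) ht
  refine hint.congr_deriv ?_
  have hθd (x : E) : HasDerivAt (fun τ => cutWave A D ξ a r τ x)
      (deriv (fun τ => cutWave A D ξ a r τ x) t) t := by
    have h1 : ContDiff ℝ ∞ (fun τ => cutWave A D ξ a r τ x) :=
      ContDiff.comp (g := fun q : ℝ × E => cutWave A D ξ a r q.1 q.2) (f := fun τ : ℝ => (τ, x))
        (contDiff_cutWave A D ξ a r) (contDiff_id.prodMk contDiff_const)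
    exact (h1.differentiable hne t).hasDerivAt
  have e (x : E) : deriv (fun τ => g τ x * cutWave A D ξ a r τ x) t =
      cutWave A D ξ a r t x *
        clmTrace (fderiv ℝ (fun z => g t z • A z + D (gradient (g t) z)) x) +
      g t x * deriv (fun τ => cutWave A D ξ a r τ x) t := by
    exact ((heq t ht x).mul (hθd x)).deriv.trans (by ring)
  have cJ : ContDiff ℝ ∞ (fun z => g t z • A z + D (gradient (g t) z)) :=
    (hgt.smul A.contDiff).add (D.contDiff.comp (contDiff_gradient hgt))
  have cH : ContDiff ℝ ∞ (fun z => D (gradient (cutWave A D ξ a r t) z)) :=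
    D.contDiff.comp (contDiff_gradient hθt)
  have i1 : Integrable (fun x => cutWave A D ξ a r t x *
      clmTrace (fderiv ℝ (fun z => g t z • A z + D (gradient (g t) z)) x)) :=
    (hθt.continuous.mul (clmTrace.continuous.comp
      (cJ.continuous_fderiv hne))).integrable_of_hasCompactSupport hs.mul_right
  have hsg : HasCompactSupport (gradient (cutWave A D ξ a r t)) :=
    (hs.fderiv ℝ).comp_left (g := (InnerProductSpace.toDual ℝ E).symm) (map_zero _)
  have i3 : Integrable (fun x => g t x *
      (clmTrace (fderiv ℝ (fun z => D (gradient (cutWave A D ξ a r t) z)) x) -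
        inner ℝ (gradient (cutWave A D ξ a r t) x) (A x))) := by
    have c1 : Continuous fun x =>
        clmTrace (fderiv ℝ (fun z => D (gradient (cutWave A D ξ a r t) z)) x) :=
      clmTrace.continuous.comp (cH.continuous_fderiv hne)
    have c2 : Continuous fun x => inner ℝ (gradient (cutWave A D ξ a r t) x) (A x) :=
      (contDiff_gradient hθt).continuous.inner A.continuous
    have s0 : HasCompactSupport (fun z => D (gradient (cutWave A D ξ a r t) z)) :=
      hsg.comp_left (g := D) (map_zero D)
    have s1 : HasCompactSupport fun x =>
        clmTrace (fderiv ℝ (fun z => D (gradient (cutWave A D ξ a r t) z)) x) :=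
      (s0.fderiv ℝ).comp_left (g := clmTrace) (map_zero _)
    have s2 : HasCompactSupport fun x => inner ℝ (gradient (cutWave A D ξ a r t) x) (A x) :=
      hsg.mono fun x hx h0 => hx (by simp only [h0, inner_zero_left])
    exact (hgt.continuous.mul (c1.sub c2)).integrable_of_hasCompactSupport (s1.sub s2).mul_left
  have cd : Continuous fun x => deriv (fun τ => cutWave A D ξ a r τ x) t := by
    have h1 : Continuous fun x : E =>
        fderiv ℝ (fun q : ℝ × E => cutWave A D ξ a r q.1 q.2) (t, x) (1, 0) :=
      (Continuous.comp (g := fderiv ℝ (fun q : ℝ × E => cutWave A D ξ a r q.1 q.2))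
        (f := fun x : E => (t, x)) ((contDiff_cutWave A D ξ a r).continuous_fderiv hne)
        (by fun_prop)).clm_apply continuous_const
    refine h1.congr fun x => ?_
    have h2 : HasFDerivAt (fun q : ℝ × E => cutWave A D ξ a r q.1 q.2) _ (t, x) :=
      ((contDiff_cutWave A D ξ a r).differentiable hne (t, x)).hasFDerivAt
    have h3 := h2.comp_hasDerivAt t ((hasDerivAt_id t).prodMk (hasDerivAt_const t x))
    exact h3.deriv.symm
  have i2 : Integrable (fun x => g t x * deriv (fun τ => cutWave A D ξ a r τ x) t) := by
    refine (hgt.continuous.mul cd).integrable_of_hasCompactSupport (HasCompactSupport.mul_left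
      (HasCompactSupport.intro (isCompact_closedBall (0 : E) (1 + 2 / r)) fun x hx => ?_))
    have hx' : 1 + 2 / r < ‖x‖ := by simpa using hx
    rw [show (fun τ => cutWave A D ξ a r τ x) = fun _ => 0 from funext fun τ => hzero' τ x hx',
      deriv_const]
  simp_rw [e]
  rw [integral_add i1 i2, integral_mul_fokkerPlanck hD hgt hθt hs, add_comm, ← integral_add i2 i3]
  simp_rw [← mul_add, cutWave_backward A hD]

include hi hc

/-- The pairing of a Fokker–Planck solution with a dual plane wave is constant in time. -/
theorem integral_mul_dualWave_eq (ξ : E) (a : ℝ) {T : ℝ} (hT : 0 < T) :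
    ∫ x, g T x * dualWave A D ξ a T x = ∫ x, g 0 x * dualWave A D ξ a 0 x := by
  -- The cutoff is then 1 for ‖x‖ ≤ n + 1, so the defect vanishes for ‖x‖ < n, and the restriction r
  -- ≤ 1 holds.
  set r : ℕ → ℝ := fun n => 1 / ((n : ℝ) + 1) ^ 2 with hrdef
  have hr (n : ℕ) : 0 < r n := by positivity
  have hr1 (n : ℕ) : r n ≤ 1 := by
    change 1 / ((n : ℝ) + 1) ^ 2 ≤ 1
    rw [div_le_one (by positivity)]
    have : (0 : ℝ) ≤ n := n.cast_nonneg
    nlinarith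
  obtain ⟨C, hC0, hC⟩ := exists_abs_cutWaveDefect_le A D ξ a T
  obtain ⟨B, hB⟩ := isCompact_Icc.exists_bound_of_continuousOn (s := Icc (0 : ℝ) T)
    (f := fun t => Real.exp (dualExponent A D ξ t))
    (contDiff_dualExponent A D ξ).continuous.rexp.continuousOn
  have hBw (n : ℕ) (t : ℝ) (ht : t ∈ Icc 0 T) (x : E) : |cutWave A D ξ a (r n) t x| ≤ B :=
    (abs_cutWave_le A D ξ a (r n) t x).trans ((Real.le_norm_self _).trans (hB t ht))
  have hlim (t : ℝ) (ht : t ∈ Icc 0 T) :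
      Tendsto (fun n => ∫ x, g t x * cutWave A D ξ a (r n) t x) atTop
        (𝓝 (∫ x, g t x * dualWave A D ξ a t x)) := by
    refine tendsto_integral_of_dominated_convergence (fun x => |g t x| * B) (fun n => ?_)
      ((hi t ht.1).abs.mul_const B) (fun n => ae_of_all _ fun x => ?_) (ae_of_all _ fun x => ?_)
    · exact (hi t ht.1).1.mul ((contDiff_cutWave A D ξ a (r n)).continuous.comp
        (by fun_prop : Continuous fun x : E => (t, x))).aestronglyMeasurable
    · rw [norm_mul]
      exact mul_le_mul_of_nonneg_left (hBw n t ht x) (norm_nonneg _)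
    · refine tendsto_const_nhds.congr' ?_
      obtain ⟨N, hN⟩ := exists_nat_gt ‖x‖
      filter_upwards [eventually_ge_atTop N] with n hn
      rw [cutWave, radialCutoff_of_le, one_mul]
      change 1 / ((n : ℝ) + 1) ^ 2 * ‖x‖ ^ 2 ≤ 1
      rw [one_div, inv_mul_le_iff₀ (by positivity), mul_one]
      have : (N : ℝ) ≤ n := Nat.cast_le.2 hn
      gcongr
      linarith
  have hsmall : Tendsto (fun n => (∫ x, g T x * cutWave A D ξ a (r n) T x) -
      ∫ x, g 0 x * cutWave A D ξ a (r n) 0 x) atTop (𝓝 0) := by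
    refine Metric.tendsto_nhds.2 fun ε hε => ?_
    -- The mean value theorem bounds the increment by C · T · (tail); adding 1 avoids dividing by
    -- zero.
    have hδ : 0 < ε / (C * T + 1) := by positivity
    filter_upwards [Metric.tendstoUniformlyOn_iff.1 (tendstoUniformlyOn_tail (T := T) hi hc) _ hδ]
      with n hn
    have hcont : ContinuousOn (fun t => ∫ x, g t x * cutWave A D ξ a (r n) t x) (Icc 0 T) :=
      continuousOn_integral_mul hi hc (contDiff_cutWave A D ξ a (r n)).continuous (hBw n)
    obtain ⟨c, hcm, hslope⟩ := exists_hasDerivAt_eq_slope _ _ hT hcont fun t ht =>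
      hasDerivAt_integral_mul_cutWave hD hsm heq ξ a (hr n) ht.1
    rw [eq_div_iff (by linarith)] at hslope
    rw [Real.dist_eq, sub_zero, ← hslope, sub_zero, abs_mul, abs_of_pos hT]
    have hcI : c ∈ Icc 0 T := Ioo_subset_Icc_self hcm
    have hm : MeasurableSet {x : E | (n : ℝ) ≤ ‖x‖} :=
      measurableSet_le measurable_const measurable_norm
    have htail := hn c hcI
    rw [Real.dist_eq, zero_sub, abs_neg,
      abs_of_nonneg (setIntegral_nonneg hm fun x _ => abs_nonneg _)] at htail
    have h1 : |∫ x, g c x * cutWaveDefect A D ξ a (r n) c x| ≤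
        C * ∫ x in {x : E | (n : ℝ) ≤ ‖x‖}, |g c x| := by
      rw [← integral_const_mul, ← integral_indicator hm, ← Real.norm_eq_abs]
      refine norm_integral_le_of_norm_le
        (((hi c hcI.1).abs.const_mul C).indicator hm) (ae_of_all _ fun x => ?_)
      by_cases hx : x ∈ {x : E | (n : ℝ) ≤ ‖x‖}
      · rw [indicator_of_mem hx, norm_mul, mul_comm]
        exact mul_le_mul_of_nonneg_right (hC c hcI _ (hr n) (hr1 n) x) (norm_nonneg _)
      · rw [indicator_of_notMem hx, cutWaveDefect_eq_zero, mul_zero, norm_zero]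
        change 1 / ((n : ℝ) + 1) ^ 2 * ‖x‖ ^ 2 < 1
        rw [one_div, inv_mul_lt_iff₀ (by positivity), mul_one]
        have : ‖x‖ < n := not_le.1 hx
        gcongr
        linarith
    calc _ ≤ (C * ∫ x in {x : E | (n : ℝ) ≤ ‖x‖}, |g c x|) * T := by gcongr
      _ ≤ (C * (ε / (C * T + 1))) * T := by gcongr
      _ = ε * ((C * T) / (C * T + 1)) := by ring
      _ < ε * 1 := by
          gcongr
          rw [div_lt_one (by positivity)]
          linarith
      _ = ε := mul_one ε
  have hlim2 := (hlim T ⟨hT.le, le_rfl⟩).sub (hlim 0 ⟨le_rfl, hT.le⟩)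
  exact sub_eq_zero.1 (tendsto_nhds_unique hlim2 hsmall)

end Uniqueness

/-! ### Fourier injectivity and uniqueness of the Fokker–Planck solution. -/

section Fourier

variable {E : Type} [NormedAddCommGroup E] [InnerProductSpace ℝ E] [FiniteDimensional ℝ E]
  [CompleteSpace E] [MeasurableSpace E] [BorelSpace E]

open scoped FourierTransform

/-- A continuous integrable function orthogonal to all plane waves vanishes. -/
theorem eq_zero_of_integral_plane_wave_eq_zero {u : E → ℝ} (hc : Continuous u) (hi : Integrable u)
    (h1 : ∀ η : E, ∫ x, u x * Real.cos (inner ℝ η x) = 0)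
    (h2 : ∀ η : E, ∫ x, u x * Real.sin (inner ℝ η x) = 0) : u = 0 := by
  have hF : 𝓕 (fun x => (u x : ℂ)) = 0 := by
    ext w
    rw [Real.fourier_eq']
    have e (v : E) : Complex.exp (↑(-2 * Real.pi * inner ℝ v w) * Complex.I) • (u v : ℂ) =
        ((u v * Real.cos (inner ℝ ((-2 * Real.pi) • w) v) : ℝ) : ℂ) +
          ((u v * Real.sin (inner ℝ ((-2 * Real.pi) • w) v) : ℝ) : ℂ) * Complex.I := by
      rw [real_inner_smul_left, real_inner_comm, Complex.exp_mul_I, smul_eq_mul]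
      push_cast
      ring
    have hm : Continuous fun v : E => inner ℝ ((-2 * Real.pi) • w) v := by fun_prop
    have i1 : Integrable fun v => u v * Real.cos (inner ℝ ((-2 * Real.pi) • w) v) :=
      hi.mul_bdd (c := 1) (Real.continuous_cos.comp hm).aestronglyMeasurable
        (ae_of_all _ fun v => Real.abs_cos_le_one _)
    have i2 : Integrable fun v => u v * Real.sin (inner ℝ ((-2 * Real.pi) • w) v) :=
      hi.mul_bdd (c := 1) (Real.continuous_sin.comp hm).aestronglyMeasurable
        (ae_of_all _ fun v => Real.abs_sin_le_one _)
    simp_rw [e]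
    rw [integral_add i1.ofReal (i2.ofReal.mul_const _), integral_mul_const,
      integral_complex_ofReal, integral_complex_ofReal, h1, h2]
    simp
  -- The transform is zero, hence integrable, so the inversion formula applies to the continuous
  -- function u.
  have hinv := (Complex.continuous_ofReal.comp hc).fourierInv_fourier_eq hi.ofReal (by
    rw [show (Complex.ofReal ∘ u) = fun x => (u x : ℂ) from rfl, hF]
    exact integrable_zero _ _ _)
  rw [show (Complex.ofReal ∘ u) = fun x => (u x : ℂ) from rfl, hF] at hinv
  ext x
  have h3 := congrFun hinv x
  rw [Real.fourierInv_eq] at h3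
  simpa using h3.symm

/-- Uniqueness for the Fokker–Planck equation among `L¹`-continuous curves that are smooth at
positive times. -/
theorem fokkerPlanck_unique {A D : E →L[ℝ] E} (hD : ∀ x y, inner ℝ (D x) y = inner ℝ x (D y))
    {f g : ℝ → E → ℝ}
    (hif : ∀ t, 0 ≤ t → Integrable (f t))
    (hcf : ∀ t₀, 0 ≤ t₀ → Tendsto (fun t => ∫ x, |f t x - f t₀ x|) (𝓝[Ici 0] t₀) (𝓝 0))
    (hsf : ContDiffOn ℝ ∞ (fun q : ℝ × E => f q.1 q.2) (Ioi (0 : ℝ) ×ˢ (univ : Set E)))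
    (hef : ∀ t, 0 < t → ∀ x, HasDerivAt (fun τ => f τ x)
      (clmTrace (fderiv ℝ (fun z => f t z • A z + D (gradient (f t) z)) x)) t)
    (hig : ∀ t, 0 ≤ t → Integrable (g t))
    (hcg : ∀ t₀, 0 ≤ t₀ → Tendsto (fun t => ∫ x, |g t x - g t₀ x|) (𝓝[Ici 0] t₀) (𝓝 0))
    (hsg : ContDiffOn ℝ ∞ (fun q : ℝ × E => g q.1 q.2) (Ioi (0 : ℝ) ×ˢ (univ : Set E)))
    (heg : ∀ t, 0 < t → ∀ x, HasDerivAt (fun τ => g τ x)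
      (clmTrace (fderiv ℝ (fun z => g t z • A z + D (gradient (g t) z)) x)) t)
    (h0 : g 0 = f 0) {T : ℝ} (hT : 0 < T) : g T = f T := by
  have hcont {q : ℝ → E → ℝ}
      (hq : ContDiffOn ℝ ∞ (fun q' : ℝ × E => q q'.1 q'.2) (Ioi (0 : ℝ) ×ˢ (univ : Set E))) :
      Continuous (q T) :=
    continuousOn_univ.1 (hq.continuousOn.comp (f := fun x : E => (T, x)) (by fun_prop)
      fun x _ => mk_mem_prod hT (mem_univ x))
  have key (ξ : E) (a : ℝ) : ∫ x, (g T x - f T x) * dualWave A D ξ a T x = 0 := by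
    have hb : Continuous (dualWave A D ξ a T) :=
      Continuous.comp (g := fun q : ℝ × E => dualWave A D ξ a q.1 q.2) (f := fun x : E => (T, x))
        (contDiff_dualWave A D ξ a).continuous (by fun_prop)
    have hint {q : E → ℝ} (hq : Integrable q) : Integrable fun x => q x * dualWave A D ξ a T x :=
      hq.mul_bdd hb.aestronglyMeasurable (ae_of_all _ fun x => abs_dualWave_le A D ξ a T x)
    simp_rw [sub_mul]
    rw [integral_sub (hint (hig T hT.le)) (hint (hif T hT.le)),
      integral_mul_dualWave_eq hD hig hcg hsg heg ξ a hT,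
      integral_mul_dualWave_eq hD hif hcf hsf hef ξ a hT, h0, sub_self]
  -- The adjoint flow is onto, so every frequency η is reached at time T; the positive exponential
  -- factor is then divided out.
  have hflow (η : E) : linFlow (star A) T (linFlow (star A) (-T) η) = η :=
    DFunLike.congr_fun (linFlow_mul_neg (star A) T) η
  have hexp (η : E) := (Real.exp_pos (dualExponent A D (linFlow (star A) (-T) η) T)).ne'
  refine sub_eq_zero.1 (eq_zero_of_integral_plane_wave_eq_zero ((hcont hsg).sub (hcont hsf))
    ((hig T hT.le).sub (hif T hT.le)) (fun η => ?_) fun η => ?_)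
  · have h := key (linFlow (star A) (-T) η) 0
    simp_rw [dualWave, hflow, add_zero, mul_left_comm _ (Real.exp _)] at h
    rw [integral_const_mul] at h
    exact (mul_eq_zero.1 h).resolve_left (hexp η)
  · have h := key (linFlow (star A) (-T) η) (0 - Real.pi / 2)
    simp_rw [dualWave_phase, hflow, add_zero, mul_left_comm _ (Real.exp _)] at h
    rw [integral_const_mul] at h
    exact (mul_eq_zero.1 h).resolve_left (hexp η)

end Fourier

/-! ### From Fokker–Planck to McKean–Vlasov by translation. -/

section McKeanVlasov

variable {E : Type} [NormedAddCommGroup E] [InnerProductSpace ℝ E] [FiniteDimensional ℝ E]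
  [CompleteSpace E] [MeasurableSpace E] [BorelSpace E]

theorem gradient_comp_sub (f : E → ℝ) (b z : E) :
    gradient (fun x => f (x - b)) z = gradient f (z - b) := by
  rw [gradient, gradient, fderiv_comp_sub]

theorem integral_comp_sub_smul {f : E → ℝ} (hf : Integrable f)
    (hf1 : Integrable fun x => f x • x) (b : E) :
    (Integrable fun x => f (x - b) • x) ∧
      ∫ x, f (x - b) • x = (∫ x, f x • x) + (∫ x, f x) • b := by
  have hi : Integrable fun x => f x • (x + b) := by
    simp_rw [smul_add]
    exact hf1.add (hf.smul_const b)
  have h1 := hi.comp_sub_right b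
  simp_rw [sub_add_cancel] at h1
  refine ⟨h1, ?_⟩
  have h2 := integral_sub_right_eq_self (μ := (volume : Measure E)) (fun x => f x • (x + b)) b
  simp_rw [sub_add_cancel] at h2
  rw [h2]
  simp_rw [smul_add]
  rw [integral_add hf1 (hf.smul_const b), integral_smul_const]

theorem integral_smul_clm_sub {f : E → ℝ} (hf : Integrable f) (hf1 : Integrable fun x => f x • x)
    (K : E →L[ℝ] E) (z : E) :
    ∫ y, f y • K (z - y) = (∫ y, f y) • K z - K (∫ y, f y • y) := by
  rw [← K.integral_comp_comm hf1, ← integral_smul_const, ← integral_sub (hf.smul_const _)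
    (K.integrable_comp hf1)]
  simp_rw [map_sub, smul_sub, map_smul]

/-- The displacement between the mean of the McKean–Vlasov solution and the mean of the
Fokker–Planck solution. -/
noncomputable def meanShift (C A : E →L[ℝ] E) (m : E) (t : ℝ) : E :=
  linFlow C (-t) m - linFlow A (-t) m

theorem hasDerivAt_linFlow_neg_apply (A : E →L[ℝ] E) (m : E) (t : ℝ) :
    HasDerivAt (fun τ => linFlow A (-τ) m) (-A (linFlow A (-t) m)) t := by
  have h := ((hasDerivAt_linFlow' A (-t)).scomp t (hasDerivAt_neg t)).clm_apply
    (hasDerivAt_const t m)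
  simpa using h

theorem contDiff_meanShift (C A : E →L[ℝ] E) (m : E) : ContDiff ℝ ∞ (meanShift C A m) :=
  (((contDiff_linFlow C).comp contDiff_neg).clm_apply contDiff_const).sub
    (((contDiff_linFlow A).comp contDiff_neg).clm_apply contDiff_const)

/-- Let c = e^{-Ct}m, the mean of the translated density. In the frame w = z - s the McKean–Vlasov
drift is (C + K)w + b with b = (C + K)s - Kc, and s' = -b. Thus the extra flux f b, of divergence
∇f·b, equals the transport term -∇f·s' in the time derivative. -/
theorem mckeanVlasov_of_fokkerPlanck {C K D : E →L[ℝ] E} {m : E} {f : ℝ → E → ℝ}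
    (hsm : ContDiffOn ℝ ∞ (fun q : ℝ × E => f q.1 q.2) (Ioi (0 : ℝ) ×ˢ (univ : Set E)))
    (heq : ∀ t, 0 < t → ∀ x, HasDerivAt (fun τ => f τ x)
      (clmTrace (fderiv ℝ (fun z => f t z • (C + K) z + D (gradient (f t) z)) x)) t)
    {t : ℝ} (ht : 0 < t) (hi : Integrable (f t)) (hmass : ∫ x, f t x = 1)
    (hi1 : Integrable fun x => f t x • x) (hmean : ∫ x, f t x • x = linFlow (C + K) (-t) m)
    (x : E) :
    HasDerivAt (fun τ => f τ (x - meanShift C (C + K) m τ))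
      (clmTrace (fderiv ℝ (fun z => f t (z - meanShift C (C + K) m t) • C z +
        f t (z - meanShift C (C + K) m t) •
          (∫ y, f t (y - meanShift C (C + K) m t) • K (z - y)) +
        D (gradient (fun y => f t (y - meanShift C (C + K) m t)) z)) x)) t := by
  have hne : (∞ : WithTop ℕ∞) ≠ 0 := by simp
  set s := meanShift C (C + K) m t with hs
  set c := linFlow C (-t) m with hc
  have hft : ContDiff ℝ ∞ (f t) := contDiffOn_univ.1
    (hsm.comp (f := fun x : E => (t, x)) (contDiff_const.prodMk contDiff_id).contDiffOn
      fun x _ => mk_mem_prod ht (mem_univ x))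
  have hce : linFlow (C + K) (-t) m = c - s := by rw [hs, meanShift]; abel
  have hshift := integral_comp_sub_smul hi hi1 s
  have hmass' : ∫ y, f t (y - s) = 1 := by
    rw [integral_sub_right_eq_self (f t) s, hmass]
  -- Unit mass and the mean c make the nonlocal drift affine.
  have hK (z : E) : ∫ y, f t (y - s) • K (z - y) = K z - K c := by
    rw [integral_smul_clm_sub (hi.comp_sub_right s) hshift.1, hshift.2, hmass', hmass, hmean, hce]
    simp
  set b := (C + K) s - K c with hb
  set G : E → E := fun w => f t w • (C + K) w + D (gradient (f t) w) with hG
  have hGd : Differentiable ℝ G :=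
    ((hft.smul (C + K).contDiff).add (D.contDiff.comp (contDiff_gradient hft))).differentiable hne
  have hF : (fun z => f t (z - s) • C z + f t (z - s) • (∫ y, f t (y - s) • K (z - y)) +
      D (gradient (fun y => f t (y - s)) z)) = fun z => (fun w => G w + f t w • b) (z - s) := by
    ext1 z
    simp only [hK, gradient_comp_sub, hG, hb]
    simp only [add_apply, map_sub, smul_sub, smul_add]
    abel
  have hfd : HasFDerivAt (f t) (fderiv ℝ (f t) (x - s)) (x - s) :=
    (hft.differentiable hne (x - s)).hasFDerivAt
  have hdiv : fderiv ℝ (fun w => G w + f t w • b) (x - s) =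
      fderiv ℝ G (x - s) + (fderiv ℝ (f t) (x - s)).smulRight b :=
    ((hGd (x - s)).hasFDerivAt.add (hfd.smul_const b)).fderiv
  rw [hF, fderiv_comp_sub (f := fun w => G w + f t w • b), hdiv, map_add, clmTrace_smulRight]
  have hjd : DifferentiableAt ℝ (fun q : ℝ × E => f q.1 q.2) (t, x - s) :=
    ((hsm _ (mk_mem_prod ht (mem_univ _))).contDiffAt
      ((isOpen_Ioi.prod isOpen_univ).mem_nhds (mk_mem_prod ht (mem_univ _)))).differentiableAt hne
  have hj := hjd.hasFDerivAt
  set L := fderiv ℝ (fun q : ℝ × E => f q.1 q.2) (t, x - s) with hL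
  have hL1 : L (1, 0) = clmTrace (fderiv ℝ G (x - s)) :=
    (hj.comp_hasDerivAt t ((hasDerivAt_id t).prodMk (hasDerivAt_const t (x - s)))).unique
      (heq t ht (x - s))
  have hL2 (v : E) : L (0, v) = fderiv ℝ (f t) (x - s) v := by
    have h1 : HasFDerivAt (f t) (L.comp ((0 : E →L[ℝ] ℝ).prod (ContinuousLinearMap.id ℝ E)))
        (x - s) :=
      HasFDerivAt.comp (g := fun q : ℝ × E => f q.1 q.2) (f := fun y : E => (t, y)) (x - s) hj
        ((hasFDerivAt_const t (x - s)).prodMk (hasFDerivAt_id (x - s)))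
    rw [h1.fderiv]
    rfl
  have hsd : HasDerivAt (fun τ => x - meanShift C (C + K) m τ) b t := by
    have h1 := ((hasDerivAt_linFlow_neg_apply C m t).sub
      (hasDerivAt_linFlow_neg_apply (C + K) m t)).const_sub x
    refine h1.congr_deriv ?_
    rw [hce, ← hc, hb]
    simp only [add_apply, map_sub]
    abel
  have hfin : HasDerivAt (fun τ => f τ (x - meanShift C (C + K) m τ)) (L (1, b)) t :=
    HasFDerivAt.comp_hasDerivAt (l := fun q : ℝ × E => f q.1 q.2)
      (f := fun τ => (τ, x - meanShift C (C + K) m τ)) t hj ((hasDerivAt_id t).prodMk hsd)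
  refine hfin.congr_deriv ?_
  rw [← hL1, ← hL2, ← map_add, Prod.mk_add_mk, add_zero, zero_add]

/-- Translating an `L¹`-continuous curve along a continuous path gives an `L¹`-continuous curve. -/
theorem tendsto_integral_abs_shift {f : ℝ → E → ℝ} {s : ℝ → E} {t₀ : ℝ} {l : Filter ℝ}
    (hi : ∀ᶠ t in l, Integrable (f t)) (hi₀ : Integrable (f t₀)) (hpos : 0 ≤ᵐ[volume] f t₀)
    (hs : Tendsto s l (𝓝 (s t₀)))
    (hf : Tendsto (fun t => ∫ x, |f t x - f t₀ x|) l (𝓝 0)) :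
    Tendsto (fun t => ∫ x, |f t (x - s t) - f t₀ (x - s t₀)|) l (𝓝 0) := by
  have h1 := hf.add ((tendsto_integral_abs_translate_sub hi₀ hpos (s t₀)).comp hs)
  rw [add_zero] at h1
  refine squeeze_zero' (Eventually.of_forall fun t => integral_nonneg fun x => abs_nonneg _) ?_ h1
  filter_upwards [hi] with t ht
  have i1 : Integrable fun x => |f t (x - s t) - f t₀ (x - s t)| :=
    ((ht.comp_sub_right (s t)).sub (hi₀.comp_sub_right (s t))).abs
  have i2 : Integrable fun x => |f t₀ (x - s t) - f t₀ (x - s t₀)| :=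
    ((hi₀.comp_sub_right (s t)).sub (hi₀.comp_sub_right (s t₀))).abs
  rw [← integral_sub_right_eq_self (fun x => |f t x - f t₀ x|) (s t), Function.comp_apply,
    ← integral_add i1 i2]
  refine integral_mono ((ht.comp_sub_right (s t)).sub (hi₀.comp_sub_right (s t₀))).abs
    (i1.add i2) fun x => ?_
  exact abs_sub_le _ _ _

end McKeanVlasov

/-! ### The evolution joined to its initial datum. -/

section EvolutionFromInitialDatum

variable {E : Type} [NormedAddCommGroup E] [InnerProductSpace ℝ E] [FiniteDimensional ℝ E]
  [CompleteSpace E] [MeasurableSpace E] [BorelSpace E]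

/-- The Fokker–Planck evolution, including the initial datum. -/
noncomputable def fpFlow (A D : E →L[ℝ] E) (g : E → ℝ) (t : ℝ) : E → ℝ :=
  if t ≤ 0 then g else fpEvolve A D g t

theorem fpFlow_zero (A D : E →L[ℝ] E) (g : E → ℝ) : fpFlow A D g 0 = g := if_pos le_rfl

theorem fpFlow_of_pos (A D : E →L[ℝ] E) (g : E → ℝ) {t : ℝ} (ht : 0 < t) :
    fpFlow A D g t = fpEvolve A D g t := if_neg (not_le.2 ht)

variable {A D : E →L[ℝ] E} (h : HypoellipticPair A D) {g : E → ℝ} (hg : Integrable g)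
include h hg

theorem contDiffOn_fpFlow : ContDiffOn ℝ ∞ (fun q : ℝ × E => fpFlow A D g q.1 q.2)
    (Ioi (0 : ℝ) ×ˢ (univ : Set E)) := by
  refine ContDiffOn.congr (f := fun q : ℝ × E => fpEvolve A D g q.1 q.2) (fun q hq =>
    (contDiffAt_fpEvolve h hq.1 (GaussIntegrable.of_integrable hg) q.2).contDiffWithinAt)
    fun q hq => ?_
  rw [fpFlow_of_pos A D g hq.1]

theorem fokkerPlanck_fpFlow {t : ℝ} (ht : 0 < t) (x : E) :
    HasDerivAt (fun τ => fpFlow A D g τ x) (clmTrace (fderiv ℝ (fun z =>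
      fpFlow A D g t z • A z + D (gradient (fpFlow A D g t) z)) x)) t := by
  rw [fpFlow_of_pos A D g ht]
  refine (fokkerPlanck_fpEvolve h ht (GaussIntegrable.of_integrable hg) x).congr_of_eventuallyEq ?_
  filter_upwards [lt_mem_nhds ht] with τ hτ
  rw [fpFlow_of_pos A D g hτ]

theorem integrable_fpFlow {t : ℝ} (ht : 0 ≤ t) : Integrable (fpFlow A D g t) := by
  rcases ht.eq_or_lt with rfl | ht
  · rwa [fpFlow_zero]
  · rw [fpFlow_of_pos A D g ht]
    exact integrable_fpEvolve h ht hg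

theorem integral_fpFlow {t : ℝ} (ht : 0 ≤ t) : ∫ x, fpFlow A D g t x = ∫ x, g x := by
  rcases ht.eq_or_lt with rfl | ht
  · rw [fpFlow_zero]
  · rw [fpFlow_of_pos A D g ht]
    exact integral_fpEvolve h ht hg

theorem integrable_fpFlow_smul (hg1 : Integrable fun y => g y • y) {t : ℝ} (ht : 0 ≤ t) :
    Integrable fun x => fpFlow A D g t x • x := by
  rcases ht.eq_or_lt with rfl | ht
  · rwa [fpFlow_zero]
  · rw [fpFlow_of_pos A D g ht]
    exact integrable_fpEvolve_smul h ht hg hg1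

theorem integral_fpFlow_smul (hg1 : Integrable fun y => g y • y) {t : ℝ} (ht : 0 < t) :
    ∫ x, fpFlow A D g t x • x = linFlow A (-t) (∫ x, g x • x) := by
  rw [fpFlow_of_pos A D g ht]
  exact integral_fpEvolve_smul h ht hg hg1

omit hg in
theorem fpFlow_nonneg (hpos : 0 ≤ᵐ[volume] g) {t : ℝ} (ht : 0 ≤ t) :
    0 ≤ᵐ[volume] fpFlow A D g t := by
  rcases ht.eq_or_lt with rfl | ht
  · rwa [fpFlow_zero]
  · rw [fpFlow_of_pos A D g ht]
    exact ae_of_all _ fun x => fpEvolve_nonneg h ht hpos x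

/-- At t₀ = 0 the filter on [0, ∞) splits into the point 0, where the integral is zero, and the
limit from the right. -/
theorem tendsto_fpFlow (hpos : 0 ≤ᵐ[volume] g) {t₀ : ℝ} (ht₀ : 0 ≤ t₀) :
    Tendsto (fun t => ∫ x, |fpFlow A D g t x - fpFlow A D g t₀ x|) (𝓝[Ici 0] t₀) (𝓝 0) := by
  rcases ht₀.eq_or_lt with rfl | ht₀
  · rw [← Ioi_insert, nhdsWithin_insert, tendsto_sup]
    refine ⟨?_, ?_⟩
    · rw [tendsto_pure_left]
      intro s hs
      simpa using mem_of_mem_nhds hs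
    · refine (tendsto_fpEvolve_zero h hg hpos).congr' ?_
      filter_upwards [self_mem_nhdsWithin] with t ht
      rw [fpFlow_of_pos A D g ht, fpFlow_zero]
  · refine ((tendsto_fpEvolve_of_pos h hg hpos ht₀).congr' ?_).mono_left nhdsWithin_le_nhds
    filter_upwards [lt_mem_nhds ht₀] with t ht
    rw [fpFlow_of_pos A D g ht, fpFlow_of_pos A D g ht₀]

end EvolutionFromInitialDatum

/-! ### Translation between matrices and operators. -/

section Bridge

variable {d : ℕ}

theorem toEuclideanLin_eq_clm (A : Matrix (Fin d) (Fin d) ℝ) (x : EuclideanSpace ℝ (Fin d)) :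
    Matrix.toEuclideanLin A x = Matrix.toEuclideanCLM (𝕜 := ℝ) A x := rfl

theorem euclideanDiv_eq_clmTrace (F : EuclideanSpace ℝ (Fin d) → EuclideanSpace ℝ (Fin d))
    (x : EuclideanSpace ℝ (Fin d)) : euclideanDiv F x = clmTrace (fderiv ℝ F x) := by
  rw [clmTrace_apply, LinearMap.trace_eq_sum_inner _ (EuclideanSpace.basisFun (Fin d) ℝ),
    euclideanDiv]
  simp [EuclideanSpace.inner_single_left]

/-- A continuous algebra isomorphism commutes with the exponential series. The norm put on matrices
here is auxiliary, as the exponential depends only on the topology and the algebra. -/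
theorem toEuclideanCLM_exp (A : Matrix (Fin d) (Fin d) ℝ) :
    Matrix.toEuclideanCLM (𝕜 := ℝ) (NormedSpace.exp A) =
      NormedSpace.exp (Matrix.toEuclideanCLM (𝕜 := ℝ) A) := by
  let _ : NormedRing (Matrix (Fin d) (Fin d) ℝ) := Matrix.linftyOpNormedRing
  let _ : NormedAlgebra ℚ (EuclideanSpace ℝ (Fin d) →L[ℝ] EuclideanSpace ℝ (Fin d)) :=
    NormedAlgebra.restrictScalars ℚ ℝ _
  have hcont : Continuous (Matrix.toEuclideanCLM (n := Fin d) (𝕜 := ℝ)).symm :=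
    ((Matrix.toEuclideanCLM (n := Fin d) (𝕜 := ℝ)).symm.toAlgEquiv.toLinearMap
      ).continuous_of_finiteDimensional
  have h := NormedSpace.map_exp (Matrix.toEuclideanCLM (n := Fin d) (𝕜 := ℝ)).symm hcont
    (Matrix.toEuclideanCLM (𝕜 := ℝ) A)
  rw [StarAlgEquiv.symm_apply_apply] at h
  exact (congrArg (Matrix.toEuclideanCLM (n := Fin d) (𝕜 := ℝ)) h).symm.trans
    (StarAlgEquiv.apply_symm_apply _ _)

theorem toEuclideanCLM_exp_neg_smul (A : Matrix (Fin d) (Fin d) ℝ) (t : ℝ) :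
    Matrix.toEuclideanCLM (𝕜 := ℝ) (NormedSpace.exp (-(t • A))) =
      linFlow (Matrix.toEuclideanCLM (𝕜 := ℝ) A) (-t) := by
  rw [toEuclideanCLM_exp, linFlow, ← neg_smul, map_smul]

theorem hypoellipticPair_toEuclideanCLM {A D : Matrix (Fin d) (Fin d) ℝ} (hD : D.PosSemidef)
    (hA : NoInvariantSubspaceInKer A D) :
    HypoellipticPair (Matrix.toEuclideanCLM (𝕜 := ℝ) A) (Matrix.toEuclideanCLM (𝕜 := ℝ) D) where
  symm := (Matrix.isPositive_toEuclideanLin_iff.2 hD).isSymmetric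
  nonneg := fun x => by
    rw [real_inner_comm]
    exact (Matrix.isPositive_toEuclideanLin_iff.2 hD).2 x
  kalman := fun V hV hVA => hA V (fun v hv => hV v hv) fun v hv => by
    have h := hVA v hv
    rwa [← map_star, Matrix.star_eq_conjTranspose, Matrix.conjTranspose_eq_transpose_of_trivial] at h

theorem mkShift_eq_meanShift (C K : Matrix (Fin d) (Fin d) ℝ)
    (ρ₀ : EuclideanSpace ℝ (Fin d) → ℝ) (t : ℝ) :
    mkShift C K ρ₀ t = meanShift (Matrix.toEuclideanCLM (𝕜 := ℝ) C)
      (Matrix.toEuclideanCLM (𝕜 := ℝ) (C + K)) (∫ x, ρ₀ x • x) t := by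
  rw [mkShift, meanShift, toEuclideanLin_eq_clm, map_sub, toEuclideanCLM_exp_neg_smul,
    toEuclideanCLM_exp_neg_smul, sub_apply]

end Bridge

theorem theorem2p1 (d : ℕ) (C K D : Matrix (Fin d) (Fin d) ℝ)
    (hD : D.PosSemidef) (hCK : NoInvariantSubspaceInKer (C + K) D)
    (p : ℝ≥0∞) (hp : 1 < p) (ρ₀ : EuclideanSpace ℝ (Fin d) → ℝ)
    (hnonneg : 0 ≤ᵐ[volume] ρ₀) (hL1 : Integrable ρ₀ volume) (hLp : MemLp ρ₀ p volume)
    (hmass : ∫ x, ρ₀ x = 1) (hmoment : Integrable (fun x => ρ₀ x • x) volume) :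
    ∃ f : ℝ → EuclideanSpace ℝ (Fin d) → ℝ,
      IsFokkerPlanckSolution (C + K) D ρ₀ f ∧
      (∀ g : ℝ → EuclideanSpace ℝ (Fin d) → ℝ, IsFokkerPlanckSolution (C + K) D ρ₀ g →
        ∀ t, 0 ≤ t → ∀ x, g t x = f t x) ∧
      IsMcKeanVlasovSolution C K D ρ₀ (fun t x => f t (x - mkShift C K ρ₀ t)) ∧
      (∀ t, 0 ≤ t → ∫ x, f t (x - mkShift C K ρ₀ t) = 1) := by
  set A := Matrix.toEuclideanCLM (𝕜 := ℝ) (C + K) with hA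
  set Dc := Matrix.toEuclideanCLM (𝕜 := ℝ) D with hDc
  have h : HypoellipticPair A Dc := hypoellipticPair_toEuclideanCLM hD hCK
  set m := ∫ x, ρ₀ x • x with hm
  set s := meanShift (Matrix.toEuclideanCLM (𝕜 := ℝ) C) A m with hs
  have hsC : ContDiff ℝ ∞ s := contDiff_meanShift _ _ _
  have hs0 : s 0 = 0 := by simp [hs, meanShift, linFlow_zero]
  have hsmooth := contDiffOn_fpFlow h hL1
  have hfp : IsFokkerPlanckSolution (C + K) D ρ₀ (fpFlow A Dc ρ₀) :=
    { initial := fun x => by rw [fpFlow_zero]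
      integrable := fun t ht => integrable_fpFlow h hL1 ht
      continuous_L1 := fun t₀ ht₀ => tendsto_fpFlow h hL1 hnonneg ht₀
      smooth := hsmooth
      equation := fun t ht x => by
        rw [euclideanDiv_eq_clmTrace]
        exact fokkerPlanck_fpFlow h hL1 ht x }
  simp_rw [mkShift_eq_meanShift]
  refine ⟨fpFlow A Dc ρ₀, hfp, fun g hg t ht x => ?_, ?_, fun t ht => ?_⟩
  · rcases ht.eq_or_lt with rfl | ht
    · rw [hg.initial, hfp.initial]
    · have hge (t : ℝ) (ht : 0 < t) (x : EuclideanSpace ℝ (Fin d)) := hg.equation t ht x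
      simp_rw [euclideanDiv_eq_clmTrace] at hge
      exact congrFun (fokkerPlanck_unique (A := A) (D := Dc) h.symm hfp.integrable
        hfp.continuous_L1 hfp.smooth (fun t ht x => fokkerPlanck_fpFlow h hL1 ht x)
        hg.integrable hg.continuous_L1 hg.smooth hge
        (funext fun x => (hg.initial x).trans (hfp.initial x).symm) ht) x
  · exact
    { initial := fun x => by
        change fpFlow A Dc ρ₀ 0 (x - s 0) = ρ₀ x
        rw [hs0, sub_zero, fpFlow_zero]
      integrable := fun t ht => (integrable_fpFlow h hL1 ht).comp_sub_right (s t)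
      continuous_L1 := fun t₀ ht₀ => by
        refine tendsto_integral_abs_shift (f := fpFlow A Dc ρ₀) (s := s) ?_
          (integrable_fpFlow h hL1 ht₀) (fpFlow_nonneg h hnonneg ht₀)
          (hsC.continuous.continuousAt.mono_left nhdsWithin_le_nhds)
          (tendsto_fpFlow h hL1 hnonneg ht₀)
        filter_upwards [self_mem_nhdsWithin] with t ht using integrable_fpFlow h hL1 ht
      smooth := hsmooth.comp
        (f := fun q : ℝ × EuclideanSpace ℝ (Fin d) => (q.1, q.2 - s q.1))
        (contDiff_fst.prodMk (contDiff_snd.sub (hsC.comp contDiff_fst))).contDiffOn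
        fun q hq => mk_mem_prod hq.1 (mem_univ _)
      first_moment := fun t ht => (integral_comp_sub_smul (integrable_fpFlow h hL1 ht)
        (integrable_fpFlow_smul h hL1 hmoment ht) (s t)).1
      equation := fun t ht x => by
        have hadd : A = Matrix.toEuclideanCLM (𝕜 := ℝ) C + Matrix.toEuclideanCLM (𝕜 := ℝ) K :=
          map_add _ C K
        have hfin := mckeanVlasov_of_fokkerPlanck (m := m) (t := t)
          (C := Matrix.toEuclideanCLM (𝕜 := ℝ) C) (K := Matrix.toEuclideanCLM (𝕜 := ℝ) K) (D := Dc)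
          (f := fpFlow A Dc ρ₀) hsmooth
          (by rw [← hadd]; exact fun t ht x => fokkerPlanck_fpFlow h hL1 ht x) ht
          (integrable_fpFlow h hL1 ht.le) ((integral_fpFlow h hL1 ht.le).trans hmass)
          (integrable_fpFlow_smul h hL1 hmoment ht.le)
          (by rw [← hadd]; exact integral_fpFlow_smul h hL1 hmoment ht) x
        rw [← hadd] at hfin
        rw [euclideanDiv_eq_clmTrace]
        exact hfin }
  · rw [integral_sub_right_eq_self (fpFlow A Dc ρ₀ t), integral_fpFlow h hL1 ht, hmass]
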